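/- **Notation.** Let $\mathcal H_{\sqcup\!\sqcup}=\mathbb Q\langle e_0,e_1\rangle$ with shuffle product $\sqcup\!\sqcup$, and $\mathcal H_*=\mathbb Q\langle y_s : s\ge 1\rangle$ with stuffle product $*$, defined on words by $y_su*y_tv=y_s(u*y_tv)+y_t(y_su*v)+y_{s+t}(u*v)$ and $1*v=v$, $u*1=u$. Embed $\mathcal H_*$ in $\mathcal H_{\sqcup\!\sqcup}$ as $\mathbb Q\oplus\mathbb Q\langle e_0,e_1\rangle e_1$ by $y_{s_d}\cdots y_{s_1}\mapsto e_0^{s_d-1}e_1\cdots e_0^{s_1-1}e_1$. Juxtaposition is concatenation; the weight of $y_{s_d}\cdots y_{s_1}$ is $s_d+\dots+s_1$. Let $\mathrm{inv}:\mathcal H_*\to\mathcal H_*$ be the anti-morphism for concatenation with $\mathrm{inv}(y_s)=(-1)^sy_s$; let $\imath_{*,T}:\mathcal H_*\to\mathcal H_*[[T]]$ be the morphism for concatenation with $\imath_{*,T}(y_s)=\sum_{l\ge0}(-1)^l\binom{l+s-1}{s-1}T^ly_{s+l}$; let $\tilde\imath_T=\mathrm{inv}\circ\imath_{*,T}$ ($\mathrm{inv}$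 extended $T$-linearly), the anti-morphism with $\tilde\imath_T(y_s)=(-1)^s\sum_{l\ge0}\binom{l+s-1}{s-1}T^ly_{s+l}$. Put $\jmath^{\mathrm{Lie}}_T(P)=\frac1{1-Te_0}e_1P$ for $P\in\mathcal H_{\sqcup\!\sqcup}[[T]]$. All maps and products are extended $T$-linearly and coefficientwise to power series in formal variables. **Multiple zeta values setting.** Let $R$ be a commutative $\mathbb Q$-algebra. A linear map $f:\mathcal H_{\sqcup\!\sqcup}\to R$ is identified with the series $\sum_wf[w]w\in R\langle\langle e_0,e_1\rangle\rangle$, and similarly for $\mathcal H_*$. The coproduct $\Delta_{\sqcup\!\sqcup}$ is dual to $\sqcup\!\sqcup$; $f$ is grouplike if $\Delta_{\sqcup\!\sqcup}f=f\otimes f$ and $f[\emptyset]=1$, and a Lie series if $\Delta_{\sqcup\!\sqcup}f=f\otimes1+1\otimes f$. 1) If $f:\mathcal H_*\to R$ satisfies $f(u*v)=f(u)f(v)$ for all $u,v\in\mathcal H_*$, then so does the product of series $(f^{\mathrm{inv}}\circ\imath_{*,T})f:\mathcal H_*\to R[[T]]$, where $f^{\mathrm{inv}}=f\circ\mathrm{inv}$;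 its value on a word $w$ is $\sum_{w=uv}f(\tilde\imath_T(u))f(v)$. 2) Let $f\in R\langle\langle e_0,e_1\rangle\rangle$ with $f[\emptyset]=1$ and $f[e_1^n]=0$ for all $n\ge1$, and $h=f^{-1}e_1f$. The following are equivalent: i) $f$ is grouplike; ii) $h$ is a Lie series; iii) $h$ satisfies the $e_0$-shuffle regularization: for all $d\ge 0$ and $s_d,\dots,s_1\ge1$, in $R[[T,U_1,\dots,U_d]]$, $$h\Big[\tfrac{e_0^{s_d-1}}{(1-U_de_0)^{s_d}}e_1\cdots\tfrac{e_0^{s_1-1}}{(1-U_1e_0)^{s_1}}e_1\tfrac1{1-Te_0}\Big]=h\Big[\tfrac{e_0^{s_d-1}}{(1-(U_d-T)e_0)^{s_d}}e_1\cdots\tfrac{e_0^{s_1-1}}{(1-(U_1-T)e_0)^{s_1}}e_1\Big]e^{h[e_0]T},$$ together with any one of the following conditions, which for every series $h$ are equivalent to each other: a) $h[\jmath^{\mathrm{Lie}}_T(y_sw \mathbin{\sqcup\!\sqcup} w'-w \mathbin{\sqcup\!\sqcup} \tilde\imath_T(y_s)w')]=0$ for all $s\ge1$, $w,w'\in\mathcal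 H_*$; b) $h[\jmath^{\mathrm{Lie}}_T(uw \mathbin{\sqcup\!\sqcup} w'-w \mathbin{\sqcup\!\sqcup} \tilde\imath_T(u)w')]=0$ for all $u,w,w'\in\mathcal H_*$; c) $h[\jmath^{\mathrm{Lie}}_T(w \mathbin{\sqcup\!\sqcup} w'-\tilde\imath_T(w)w')]=0$ for all $w,w'\in\mathcal H_*$. 2') If $h$ is a Lie series, then $h[\jmath^{\mathrm{Lie}}_T(\tilde\imath_T(w')w)]=h[\jmath^{\mathrm{Lie}}_T(\tilde\imath_T(w)w')]$ for all $w,w'\in\mathcal H_*$. 3) Let $(f_*,f_{\sqcup\!\sqcup})$, $f_*:\mathcal H_*\to R$, $f_{\sqcup\!\sqcup}:\mathcal H_{\sqcup\!\sqcup}\to R$, be a solution of the regularized double shuffle equations: $f_{\sqcup\!\sqcup}$ is grouplike, $f_*(\emptyset)=1$, $f_*(u*v)=f_*(u)f_*(v)$ for all $u,v$, $f_{\sqcup\!\sqcup}[e_0]=f_{\sqcup\!\sqcup}[e_1]=f_*[y_1]=0$, $f_*$ and $f_{\sqcup\!\sqcup}$ agree on the words $w=y_sv$ with $s\ge2$,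 and $f_{\sqcup\!\sqcup}[w_1 \mathbin{\sqcup\!\sqcup} w-w_1*w]=0$ for all $w_1\in\mathcal H_*$ and all such $w$. Then for every $w\in\mathcal H_*$ all coefficients in $T$ of $(f_{\sqcup\!\sqcup}^{-1}e_1f_{\sqcup\!\sqcup})[\jmath^{\mathrm{Lie}}_T(w)]-((f_*^{\mathrm{inv}}\circ\imath_{*,T})f_*)[w]$ lie in the ideal of $R$ generated by $f_{\sqcup\!\sqcup}[e_0e_1]$. **Finite multiple zeta values setting.** Let $H_N(s_d,\dots,s_1)=\sum_{0<n_1<\dots<n_d<N}n_1^{-s_1}\cdots n_d^{-s_d}$, with $H_N(\emptyset)=1$. For $k\ge1$ let $\zeta_{f^{\{-k\}}}$ be the linear map $\mathcal H_*\to\prod_p\mathbb Q_p$ with $y_{s_d}\cdots y_{s_1}\mapsto\big((p^k)^{s_d+\dots+s_1}H_{p^k}(s_d,\dots,s_1)\big)_p$. For $P=\sum_nP_nT^n\in\mathcal H_*[[T]]$ write $\zeta_{f^{\{-k\}}}(P|_{T=1})=\sum_n\zeta_{f^{\{-k\}}}(P_n)$, the sum being taken in $\prod_p\mathbb Q_p$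 with the product topology. For all $w,w'\in\mathcal H_*$, all the sums below converge (unconditionally), and: 1) $\zeta_{f^{\{-k\}}}(w*w')=\zeta_{f^{\{-k\}}}(w)\,\zeta_{f^{\{-k\}}}(w')$; 2) $\zeta_{f^{\{-k\}}}(w \mathbin{\sqcup\!\sqcup} w')=\zeta_{f^{\{-k\}}}(\tilde\imath_{1}(w')w)$; 2') $\zeta_{f^{\{-k\}}}(\tilde\imath_{1}(w')w)=\zeta_{f^{\{-k\}}}(\tilde\imath_{1}(w)w')$; 3) no regularization is involved: for every word $w$ of $\mathcal H_*$, including those starting with $y_1$, the truncated iterated sum and the truncated iterated integral agree, that is $\zeta_{f^{\{-k\}}}(w)=\big((p^k)^{\mathrm{weight}(w)}\sum_{0\le n<p^k}c_n(\mathrm{Li}_w)\big)_p$, where $\mathrm{Li}_w(z)=\sum_nc_n(\mathrm{Li}_w)z^n$ is the iterated integral from $0$ to $z$ of the word $w$ with $e_0=dz/z$, $e_1=dz/(1-z)$. Appendix. For words $w,w'$ of $\mathcal H_*$, with $\partial$ the removal of the leftmost letter: if $w=y_{s}\,\partial w$ is non-empty, then $$\zeta_{f^{\{-k\}}}(\tilde\imath_{1}(w)w')=\Big((p^k)^{\mathrm{weight}(w)+\mathrm{weight}(w')}\sum_{n=1}^{p^k-1}\frac{H_n(\partial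 w)}{n^{s}}H_{p^k-n}(w')\Big)_p,$$ and if $w'=y_t\,\partial w'$ is non-empty, then $$\zeta_{f^{\{-k\}}}(\tilde\imath_{1}(w)w')=\Big((p^k)^{\mathrm{weight}(w)+\mathrm{weight}(w')}\sum_{n=1}^{p^k-1}H_n(w)\frac{H_{p^k-n}(\partial w')}{(p^k-n)^{t}}\Big)_p.$$ -/

import Mathlib

namespace DShuffle

open Finset

/-! ### Words and the two concatenation algebras -/

section Words

variable {α : Type*}

/-- The concatenation algebra `ℚ⟨α⟩` of non-commutative polynomials in the letters `α`. -/
abbrev WordAlg (α : Type*) : Type _ := MonoidAlgebra ℚ (FreeMonoid α)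

/-- The word `w`, seen as an element of `ℚ⟨α⟩`. -/
noncomputable def mono (w : List α) : WordAlg α :=
  MonoidAlgebra.single (FreeMonoid.ofList w) 1

/-- The `ℚ`-linear extension to `ℚ⟨α⟩` of a function on words. -/
noncomputable def linExt {V : Type*} [AddCommGroup V] [Module ℚ V] (F : List α → V) :
    WordAlg α →ₗ[ℚ] V :=
  Finsupp.linearCombination ℚ (fun w : FreeMonoid α => F (FreeMonoid.toList w)) ∘ₗ
    (MonoidAlgebra.coeffLinearEquiv ℚ).toLinearMap

theorem linExt_mono {V : Type*} [AddCommGroup V] [Module ℚ V] (F : List α → V) (w : List α) :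
    linExt F (mono w) = F w := by
  simp [linExt, mono]

end Words

/-- `ℚ⟨e₀, e₁⟩`, the vector space underlying the shuffle Hopf algebra; the letter `e₀` is
`0 : Fin 2` and the letter `e₁` is `1 : Fin 2`. -/
abbrev Hsh : Type := WordAlg (Fin 2)

/-- `ℚ⟨y₁, y₂, …⟩`, the vector space underlying the stuffle Hopf algebra. -/
abbrev Hst : Type := WordAlg ℕ+

/-- The letter `y_s`. -/
noncomputable def y (s : ℕ+) : Hst := mono [s]

/-- The shuffle of two words. -/
noncomputable def shWord : List (Fin 2) → List (Fin 2) → Hsh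
  | [], v => mono v
  | u, [] => mono u
  | a :: u, b :: v => mono [a] * shWord u (b :: v) + mono [b] * shWord (a :: u) v
termination_by u v => u.length + v.length

/-- The shuffle product on `ℚ⟨e₀, e₁⟩`. -/
noncomputable def sh : Hsh →ₗ[ℚ] Hsh →ₗ[ℚ] Hsh :=
  linExt fun u => linExt fun v => shWord u v

/-- The stuffle of two words in the letters `y_s`. -/
noncomputable def stWord : List ℕ+ → List ℕ+ → Hst
  | [], v => mono v
  | u, [] => mono u
  | a :: u, b :: v =>
      y a * stWord u (b :: v) + y b * stWord (a :: u) v + y (a + b) * stWord u v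
termination_by u v => u.length + v.length

/-- The stuffle product on `ℚ⟨y₁, y₂, …⟩`. -/
noncomputable def st : Hst →ₗ[ℚ] Hst →ₗ[ℚ] Hst :=
  linExt fun u => linExt fun v => stWord u v

/-- The word `e₀^{s_d - 1} e₁ ⋯ e₀^{s_1 - 1} e₁` of a word `y_{s_d} ⋯ y_{s_1}`. -/
def toLetters (w : List ℕ+) : List (Fin 2) :=
  w.flatMap fun s => List.replicate ((s : ℕ) - 1) 0 ++ [1]

/-- The embedding of `ℚ⟨y₁, y₂, …⟩` in `ℚ⟨e₀, e₁⟩`, with image `ℚ ⊕ ℚ⟨e₀, e₁⟩e₁`. -/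
noncomputable def phi : Hst →ₗ[ℚ] Hsh := linExt fun w => mono (toLetters w)

/-- Reads `e₀^k w` as a word in the letters `y_s`; no result if the word ends with `e₀`. -/
def decode : ℕ → List (Fin 2) → Option (List ℕ+)
  | k, [] => if k = 0 then some [] else none
  | k, a :: w => if a = 0 then decode (k + 1) w else (decode 0 w).map (Nat.succPNat k :: ·)

theorem decode_toLetters (w : List ℕ+) : decode 0 (toLetters w) = some w := by
  have aux : ∀ (m k : ℕ) (u : List (Fin 2)),
      decode k (List.replicate m 0 ++ u) = decode (k + m) u := by
    intro m
    induction m with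
    | zero => intro k u; simp
    | succ m ih => intro k u; simp [List.replicate_succ, decode, ih, add_assoc, add_comm 1 m]
  induction w with
  | nil => simp [toLetters, decode]
  | cons s w ih =>
    have h : toLetters (s :: w) = List.replicate ((s : ℕ) - 1) 0 ++ (1 :: toLetters w) := by
      simp [toLetters]
    rw [h, aux]
    simp only [decode, ih]
    simp only [one_ne_zero, if_false, Option.map_some, zero_add]
    congr 2
    apply PNat.eq
    have := s.pos
    simp [Nat.succPNat]
    omega

/-- The projection of `ℚ⟨e₀, e₁⟩` onto `ℚ⟨y₁, y₂, …⟩` that kills the words ending with `e₀`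
and is inverse to `phi` on `ℚ ⊕ ℚ⟨e₀, e₁⟩e₁`. -/
noncomputable def piY : Hsh →ₗ[ℚ] Hst :=
  linExt fun u => ((decode 0 u).map mono).getD 0

/-- The weight `s_d + ⋯ + s_1` of `y_{s_d} ⋯ y_{s_1}`. -/
def weight (w : List ℕ+) : ℕ := (w.map fun s => (s : ℕ)).sum

/-- The concatenation anti-morphism with `y_n ↦ (-1)^n y_n`. -/
noncomputable def inv : Hst →ₗ[ℚ] Hst :=
  linExt fun w => ((-1 : ℚ) ^ weight w) • mono w.reverse

/-! ### Formal variables: `ℚ⟨α⟩[[T]]` is the ring of power series over `ℚ⟨α⟩` -/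

section Formal

/-- The coefficientwise (that is, `T`-linear and continuous) extension of a linear map. -/
noncomputable def mapT {A V : Type*} [Ring A] [Module ℚ A] [Ring V] [Module ℚ V]
    (F : A →ₗ[ℚ] V) (P : PowerSeries A) : PowerSeries V :=
  PowerSeries.mk fun n => F (PowerSeries.coeff n P)

/-- `ι_{*,T}(y_s) = ∑_l (-1)^l binom(l+s-1, s-1) T^l y_{s+l}`. -/
noncomputable def iotaLetter (s : ℕ+) : PowerSeries Hst :=
  PowerSeries.mk fun l =>
    ((-1 : ℚ) ^ l * (Nat.choose (l + s - 1) (s - 1) : ℚ)) • mono [⟨s + l, by positivity⟩]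

/-- `ι_{*,T}`, the concatenation morphism `ℚ⟨y⟩ → ℚ⟨y⟩[[T]]` extending `iotaLetter`. -/
noncomputable def iota : Hst →ₗ[ℚ] PowerSeries Hst :=
  linExt fun w => (w.map iotaLetter).prod

/-- The anti-morphism `inv ∘ ι_{*,T}`,
`y_s ↦ (-1)^s ∑_l binom(l+s-1, s-1) T^l y_{s+l}`. -/
noncomputable def itilde (w : Hst) : PowerSeries Hst := mapT inv (iota w)

/-- `ȷ^Lie_T : P ↦ (1 - T e₀)⁻¹ e₁ P`, on `ℚ⟨e₀, e₁⟩[[T]]`. -/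
noncomputable def jLie (P : PowerSeries Hsh) : PowerSeries Hsh :=
  (PowerSeries.mk fun l => mono (List.replicate l 0)) * PowerSeries.C (mono [1]) * P

end Formal

/-! ### Non-commutative power series with coefficients in a `ℚ`-algebra -/

section Series

variable {α : Type*} {R : Type*} [CommRing R]

/-- `R⟨⟨α⟩⟩`: the series `∑_w f[w] w` is the function `w ↦ f[w]` on words.  Equivalently, this
is the space of linear maps `ℚ⟨α⟩ → R`; the value of `f` at `P ∈ ℚ⟨α⟩` is `linExt f P`. -/
abbrev Ser (α : Type*) (R : Type*) : Type _ := List α → R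

/-- The product of non-commutative series. -/
def Ser.mul (f g : Ser α R) : Ser α R := fun w =>
  ∑ i ∈ range (w.length + 1), f (w.take i) * g (w.drop i)

/-- The series `1`. -/
def Ser.one : Ser α R
  | [] => 1
  | _ :: _ => 0

/-- The inverse of a series with constant term `1`. -/
def Ser.inverse (f : Ser α R) : Ser α R
  | [] => 1
  | a :: w => - ∑ i : Fin (w.length + 1),
      Ser.inverse f ((a :: w).take i) * f ((a :: w).drop i)
termination_by w => w.length
decreasing_by
  have := i.isLt
  simp only [List.length_take, List.length_cons]
  omega

theorem Ser.inverse_mul (f : Ser α R) (hf : f [] = 1) : Ser.mul (Ser.inverse f) f = Ser.one := by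
  funext w
  cases w with
  | nil => simp [Ser.mul, Ser.one, Ser.inverse, hf]
  | cons a w =>
    rw [Ser.mul, List.length_cons, Finset.sum_range_succ, Ser.one]
    have h1 : (a :: w).take (w.length + 1) = a :: w := by simp
    have h2 : (a :: w).drop (w.length + 1) = [] := by simp
    rw [h1, h2, hf, mul_one, Ser.inverse, Finset.sum_range, add_neg_cancel]

/-- The series `e₁`. -/
def serE1 : Ser (Fin 2) R := fun w => if w = [1] then 1 else 0

/-- `f⁻¹ e₁ f`, for `f` with constant term `1`. -/
def conjE1 (f : Ser (Fin 2) R) : Ser (Fin 2) R :=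
  Ser.mul (Ser.mul (Ser.inverse f) serE1) f

variable [Algebra ℚ R]

/-- The coefficient of `u ⊗ v` in `Δ_sh(f)`, where `Δ_sh` is dual to the shuffle product. -/
noncomputable def coprodSh (f : Ser (Fin 2) R) (u v : List (Fin 2)) : R :=
  linExt f (sh (mono u) (mono v))

/-- `ε(f) = 1` and `Δ_sh(f) = f ⊗ f`. -/
def IsGrouplike (f : Ser (Fin 2) R) : Prop :=
  f [] = 1 ∧ ∀ u v, coprodSh f u v = f u * f v

/-- `Δ_sh(h) = h ⊗ 1 + 1 ⊗ h`. -/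
def IsLieSeries (h : Ser (Fin 2) R) : Prop :=
  ∀ u v, coprodSh h u v = h u * Ser.one v + Ser.one u * h v

/-- The series shuffle relation `f(u * v) = f(u) f(v)`. -/
def StuffleRel (f : Ser ℕ+ R) : Prop :=
  ∀ u v : Hst, linExt f (st u v) = linExt f u * linExt f v

/-- The value in `R[[T]]` of a series at an element of `ℚ⟨α⟩[[T]]`. -/
noncomputable def evalT (f : Ser α R) (P : PowerSeries (WordAlg α)) : PowerSeries R :=
  mapT (linExt f) P

/-- `(f^inv ∘ ι_{*,T}) f`, a series with coefficients in `R[[T]]`; here `f^inv = f ∘ inv`. -/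
noncomputable def symStuffle (f : Ser ℕ+ R) : Ser ℕ+ (PowerSeries R) :=
  Ser.mul (fun w => evalT (fun v => linExt f (inv (mono v))) (iota (mono w)))
    (fun w => PowerSeries.C (f w))

/-- `e₀^{s-1} / (1 - X e₀)^s = ∑_l binom(l+s-1, l) X^l e₀^{s-1+l}`, for a commutative power
series `X` without constant term: only the `l ≤ deg m` contribute to the monomial `m`. -/
noncomputable def frac {σ : Type*} (s : ℕ+) (X : MvPowerSeries σ ℚ) : MvPowerSeries σ Hsh :=
  fun m => ∑ l ∈ range (m.degree + 1),
    ((Nat.choose (l + s - 1) l : ℚ) * MvPowerSeries.coeff m (X ^ l)) •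
      mono (List.replicate ((s : ℕ) - 1 + l) 0)

/-- The value of a series at an element of `ℚ⟨e₀, e₁⟩[[σ]]`. -/
noncomputable def evalM {σ : Type*} (f : Ser (Fin 2) R) (P : MvPowerSeries σ Hsh) :
    MvPowerSeries σ R :=
  fun m => linExt f (MvPowerSeries.coeff m P)

/-- `e^{aT}` in `R[[T, U_1, …, U_d]]`; the variable `T` is `none`, and `U_i` is `some i`. -/
noncomputable def expT {d : ℕ} (a : R) : MvPowerSeries (Option (Fin d)) R :=
  fun m => if m = Finsupp.single none (m none)
    then ((Nat.factorial (m none) : ℚ)⁻¹) • a ^ (m none) else 0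

/-- The `e₀`-shuffle regularization: for all `d` and `s_1, …, s_d ≥ 1`, in `R[[T, U_1, …, U_d]]`,
`h[e₀^{s_1-1}/(1-U_1 e₀)^{s_1} e₁ ⋯ e₀^{s_d-1}/(1-U_d e₀)^{s_d} e₁ · 1/(1-T e₀)]`
`= h[e₀^{s_1-1}/(1-(U_1-T)e₀)^{s_1} e₁ ⋯ e₀^{s_d-1}/(1-(U_d-T)e₀)^{s_d} e₁] · e^{h[e₀]T}`. -/
def E0Reg (h : Ser (Fin 2) R) : Prop :=
  ∀ (d : ℕ) (s : Fin d → ℕ+),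
    evalM h
      ((List.ofFn fun i : Fin d =>
          frac (s i) (MvPowerSeries.X (some i)) * MvPowerSeries.C (mono [1])).prod *
        frac 1 (MvPowerSeries.X (none : Option (Fin d)))) =
    evalM h
      (List.ofFn fun i : Fin d =>
          frac (s i) (MvPowerSeries.X (some i) - MvPowerSeries.X (none : Option (Fin d))) *
            MvPowerSeries.C (mono [1])).prod * expT (h [0])

/-- `h[ȷ_T(y_s w ⧢ w₂ - w ⧢ (inv ∘ ι_{*,T})(y_s) w₂)] = 0`. -/
def CondA (h : Ser (Fin 2) R) : Prop :=
  ∀ (s : ℕ+) (w w₂ : Hst),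
    evalT h (jLie (PowerSeries.C (sh (phi (y s * w)) (phi w₂)) -
      mapT (sh (phi w)) (mapT phi (itilde (y s) * PowerSeries.C w₂)))) = 0

/-- `h[ȷ_T(u w ⧢ w₂ - w ⧢ (inv ∘ ι_{*,T})(u) w₂)] = 0`. -/
def CondB (h : Ser (Fin 2) R) : Prop :=
  ∀ u w w₂ : Hst,
    evalT h (jLie (PowerSeries.C (sh (phi (u * w)) (phi w₂)) -
      mapT (sh (phi w)) (mapT phi (itilde u * PowerSeries.C w₂)))) = 0

/-- `h[ȷ_T(w ⧢ w₂ - (inv ∘ ι_{*,T})(w) w₂)] = 0`. -/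
def CondC (h : Ser (Fin 2) R) : Prop :=
  ∀ w w₂ : Hst,
    evalT h (jLie (PowerSeries.C (sh (phi w) (phi w₂)) -
      mapT phi (itilde w * PowerSeries.C w₂))) = 0

/-- Solutions `(f_*, f_sh)` of the regularized double shuffle equations. -/
structure RegDoubleShuffle (fst : Ser ℕ+ R) (fsh : Ser (Fin 2) R) : Prop where
  shuffle : IsGrouplike fsh
  stuffle : StuffleRel fst
  stuffle_one : fst [] = 1
  sh_e0 : fsh [0] = 0
  sh_e1 : fsh [1] = 0
  st_y1 : fst [1] = 0
  /-- The two families extend the same family indexed by the words `y_s w` with `s ≥ 2`. -/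
  agree : ∀ (s : ℕ+) (w : List ℕ+), 2 ≤ s → fst (s :: w) = fsh (toLetters (s :: w))
  /-- The regularized relations `f(w₁ ⧢ w - w₁ * w) = 0` with `w = y_s v`, `s ≥ 2`. -/
  reg : ∀ (w₁ : List ℕ+) (s : ℕ+) (v : List ℕ+), 2 ≤ s →
    linExt fsh (sh (phi (mono w₁)) (phi (mono (s :: v))) -
      phi (st (mono w₁) (mono (s :: v)))) = 0

end Series

/-! ### Finite multiple zeta values -/

section Finite

instance factPrime (p : Nat.Primes) : Fact (p : ℕ).Prime := ⟨p.2⟩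

/-- `∏_p ℚ_p`, with the product topology. -/
abbrev ProdQp : Type := (p : Nat.Primes) → ℚ_[(p : ℕ)]

/-- The multiple harmonic sum
`H_N(s_d, …, s_1) = ∑_{0 < n_1 < ⋯ < n_d < N} 1 / (n_1^{s_1} ⋯ n_d^{s_d})`,
obtained by summing over the largest index `n_d` first. -/
def harm : List ℕ+ → ℕ → ℚ
  | [], _ => 1
  | s :: w, N => ∑ n ∈ Ico 1 N, harm w n / (n : ℚ) ^ (s : ℕ)

/-- The finite multiple zeta value `((p^k)^{s_d + ⋯ + s_1} H_{p^k}(s_d, …, s_1))_p`. -/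
noncomputable def zetaF (k : ℕ) : Ser ℕ+ ProdQp := fun w p =>
  (((((p : ℕ) : ℚ) ^ k) ^ weight w * harm w ((p : ℕ) ^ k) : ℚ) : ℚ_[(p : ℕ)])

/-- Taylor expansion at `0` of the iterated integral `Li_w` of `e₀ = dz/z` and `e₁ = dz/(1-z)`,
for `w` empty or ending with `e₁`: `z Li_{e₀w}' = Li_w`, `(1-z) Li_{e₁w}' = Li_w`, and
`Li_w(0) = 0` for `w` non-empty. -/
noncomputable def Li : List (Fin 2) → PowerSeries ℚ
  | [] => 1
  | a :: w => PowerSeries.mk fun n =>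
      if a = 0 then PowerSeries.coeff n (Li w) / n
      else (∑ m ∈ range n, PowerSeries.coeff m (Li w)) / n

/-- `x` is the value of `ζ_{f^{-k}}` at the specialization `T = 1` of `P ∈ ℚ⟨y⟩[[T]]`. -/
def HasZetaValue (k : ℕ) (P : PowerSeries Hst) (x : ProdQp) : Prop :=
  HasSum (fun n => linExt (zetaF k) (PowerSeries.coeff n P)) x

end Finite

end DShuffle

open DShuffle

/-!
Series are treated as elements of a ring `NCS` of non-commutative power series.  The shuffle and
stuffle products are both quasi-shuffle products, and the dual coproducts are ring morphisms into
`NCS α (NCS α S)` (`NCS.cop_mul`), with the two factors embedded by `NCS.inl` and `NCS.inr`.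

*Series shuffle.*  Let `D` be the derivation of concatenation with `D y_s = s y_{s+1}`.  Then
`ι_{*,T} = exp(-T D)` (`coeff_iota`), and `D` is also a derivation of the stuffle product, so that
`ι_{*,T}` is a morphism for it.  Hence `f ∘ inv ∘ ι_{*,T}` respects the stuffle product when `f`
does, and so does its product with `f`, as the coproduct is multiplicative
(`StuffleRel.symStuffle`).

*Grouplike series and Lie series.*  That `f⁻¹ e₁ f` is a Lie series means that
`K = Δ(f) (f ⊗ f)⁻¹` commutes with `e₁ ⊗ 1 + 1 ⊗ e₁`.  This forces `K` to be supported on the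
`e₁^m ⊗ e₁^n` (`NCS.eq_zero_of_commute`), where the normalization of `f` gives `K = 1`
(`isGrouplike_of_isLieSeries_conjE1`).

*Integral shuffle.*  Put `∂V = e₀ ⧢ V` (`dsh`).  Except for the last letter, `∂` acts as a
derivation.  For a series with `h[e₀] = 0`, the regularization relation says that `h` vanishes on
the image of `∂` (`e0Reg_iff`), because `∂ (w e₀^n) = (n + 1) w e₀^{n+1} + (D w) e₀^n` for `w` in
the letters `y_s`.  When it holds, condition c) becomes the identity
`h[e₁ (V ⧢ W)] = h[S(V) e₁ W]`, with `S` the antipode (`relB_one_iff_defect`): the sum over the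
powers of `T` turns `inv ∘ ι_{*,T}` into `S` of the divided powers of `∂`, and words in the `y_s`
span everything under these.  The identity is the recursive form of the vanishing on shuffles, that
is, of being a Lie series (`IsLieSeries.letter_mul_sh`, `isLieSeries_of_relB`).  The conditions a),
b) and c) are equivalent because `inv ∘ ι_{*,T}` is an anti-morphism (`condABC_tfae`).

*Comparison.*  The inverse of a grouplike series is given by the antipode, whence the value of
`f⁻¹ e₁ f` at `e₀^n e₁ w` is the coefficient of `T^n` in the symmetrization of the restriction of
`f_⧢` to the words in the `y_s` (`IsGrouplike.conjE1_apply`).  The regularization relations say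
that `f_* = Λ(y_1) f_⧢` on these words, with `Λ(x) = ∑_n f_*(y_1^n) x^n`
(`RegDoubleShuffle.eq_onesSer_mul`). As no word `D w` has terms that are powers of `y_1`,
composition with `ι_{*,T}` fixes `Λ(y_1)`, and the two symmetrizations differ by the factor `Λ(-y_1)
Λ(y_1)` placed between the two factors (`symStuffle_onesSer_mul`). By Newton's identities this
factor depends only on the values at the letters `y_{2n}`, which the double shuffle relations in
depth two put into the ideal generated by the value at `y_2` (`RegDoubleShuffle.even_mem`).

*Finite multiple zeta values.*  For `N = p^k` and `0 < m < N` the number `N / m` has `p`-adic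
absolute value less than one, and `(-1)^s ∑_l binom(l+s-1, s-1) (N/m)^{s+l} = (N / (N - m))^s`.
The specialization `T = 1` of `inv ∘ ι_{*,T}` thus replaces the summation indices `m` by `N - m`
(`HasHarmValue.itilde_mul`), which gives a sum over pairs of words with indices below `n` and below
`N - n`.  The truncation of the product of two iterated integrals, which is given by the shuffle
product, is the same sum (`liSeries_sh`, `hz_piY_sh`).
-/

namespace DShuffle

open Finset

/-! ### Linear maps on word algebras -/

section WordAlgebra

variable {α V W : Type*} [AddCommGroup V] [Module ℚ V] [AddCommGroup W] [Module ℚ W]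

theorem mono_nil : mono ([] : List α) = 1 := rfl

theorem mono_mul_mono (u v : List α) : mono u * mono v = mono (u ++ v) := by
  simp [mono, MonoidAlgebra.single_mul_single]

theorem mono_cons (a : α) (u : List α) : mono (a :: u) = mono [a] * mono u := by
  rw [mono_mul_mono]; rfl

/-- Linear combinations of words are reached from words by addition and scaling. -/
theorem word_induction {P : WordAlg α → Prop} (hmono : ∀ w, P (mono w))
    (hadd : ∀ x z, P x → P z → P (x + z)) (hsmul : ∀ (r : ℚ) x, P x → P (r • x))
    (x : WordAlg α) : P x := by
  induction x using MonoidAlgebra.induction_linear with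
  | zero => simpa using hsmul 0 _ (hmono [])
  | add x y hx hy => exact hadd _ _ hx hy
  | single w r =>
    have : (MonoidAlgebra.single w r : WordAlg α) = r • mono (FreeMonoid.toList w) := by
      simp [mono, MonoidAlgebra.smul_single]
    rw [this]
    exact hsmul _ _ (hmono _)

theorem linMap_ext {F G : WordAlg α →ₗ[ℚ] V} (h : ∀ w, F (mono w) = G (mono w)) : F = G := by
  refine LinearMap.ext fun x => ?_
  induction x using word_induction with
  | hmono w => exact h w
  | hadd x z hx hz => simp [hx, hz]
  | hsmul r x hx => simp [hx]

/-- Linear maps on a word algebra that agree on words agree everywhere. -/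
theorem linMap_congr {F G : WordAlg α →ₗ[ℚ] V} (h : ∀ w, F (mono w) = G (mono w))
    (x : WordAlg α) : F x = G x := by
  rw [linMap_ext h]

theorem linExt_mono_mul (F : List α → V) (u : List α) (x : WordAlg α) :
    linExt F (mono u * x) = linExt (fun w => F (u ++ w)) x := by
  refine linMap_congr (F := linExt F ∘ₗ LinearMap.mulLeft ℚ (mono u)) (fun w => ?_) x
  simp [mono_mul_mono, linExt_mono]

theorem map_linExt (G : V →ₗ[ℚ] W) (F : List α → V) (x : WordAlg α) :
    G (linExt F x) = linExt (fun w => G (F w)) x := by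
  refine linMap_congr (F := G ∘ₗ linExt F) (fun w => ?_) x
  simp [linExt_mono]

theorem linExt_add_fun (F G : List α → V) (x : WordAlg α) :
    linExt (fun w => F w + G w) x = linExt F x + linExt G x := by
  refine linMap_congr (F := linExt (fun w => F w + G w)) (G := linExt F + linExt G) (fun w => ?_) x
  simp [linExt_mono]

end WordAlgebra

/-! ### The ring of non-commutative power series -/

/-- Non-commutative power series in the letters `α` over a ring `S` that need not be commutative,
so that `NCS α (NCS α S)` is the completed tensor square of `NCS α S`. -/
def NCS (α S : Type*) : Type _ := List α → S

namespace NCS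

variable {α S : Type*}

@[ext] theorem ext {f g : NCS α S} (h : ∀ w, f w = g w) : f = g := funext h

/-- The series `∑_w f[a w] w`. -/
def tail (a : α) (f : NCS α S) : NCS α S := fun w => f (a :: w)

theorem tail_apply (a : α) (f : NCS α S) (w : List α) : tail a f w = f (a :: w) := rfl

variable [Ring S]

instance : AddCommGroup (NCS α S) := inferInstanceAs (AddCommGroup (List α → S))

instance : Mul (NCS α S) :=
  ⟨fun f g w => ∑ i ∈ range (w.length + 1), f (w.take i) * g (w.drop i)⟩

instance : One (NCS α S) := ⟨fun w => match w with | [] => 1 | _ :: _ => 0⟩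

theorem add_apply (f g : NCS α S) (w : List α) : (f + g) w = f w + g w := rfl
theorem neg_apply (f : NCS α S) (w : List α) : (-f) w = -f w := rfl
theorem zero_apply (w : List α) : (0 : NCS α S) w = 0 := rfl
theorem one_nil : (1 : NCS α S) [] = 1 := rfl
theorem one_cons (a : α) (w : List α) : (1 : NCS α S) (a :: w) = 0 := rfl

theorem mul_apply (f g : NCS α S) (w : List α) :
    (f * g) w = ∑ i ∈ range (w.length + 1), f (w.take i) * g (w.drop i) := rfl

theorem mul_nil (f g : NCS α S) : (f * g) [] = f [] * g [] := by simp [mul_apply]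

theorem mul_cons (f g : NCS α S) (a : α) (w : List α) :
    (f * g) (a :: w) = f [] * g (a :: w) + (tail a f * g) w := by
  rw [mul_apply, mul_apply, List.length_cons, Finset.sum_range_succ', add_comm]
  simp [tail]

theorem tail_add (a : α) (f g : NCS α S) : tail a (f + g) = tail a f + tail a g := rfl

theorem left_distrib' (f g h : NCS α S) : f * (g + h) = f * g + f * h := by
  ext w; simp [mul_apply, add_apply, mul_add, Finset.sum_add_distrib]

theorem right_distrib' (f g h : NCS α S) : (f + g) * h = f * h + g * h := by
  ext w; simp [mul_apply, add_apply, add_mul, Finset.sum_add_distrib]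

theorem zero_mul' (f : NCS α S) : 0 * f = 0 := by
  ext w; simp [mul_apply, zero_apply]

theorem mul_zero' (f : NCS α S) : f * 0 = 0 := by
  ext w; simp [mul_apply, zero_apply]

theorem one_mul' (f : NCS α S) : 1 * f = f := by
  ext w
  cases w with
  | nil => simp [mul_nil, one_nil]
  | cons a w =>
    have h : tail a (1 : NCS α S) = 0 := rfl
    simp [mul_cons, one_nil, h, zero_mul', zero_apply]

theorem mul_one' (f : NCS α S) : f * 1 = f := by
  ext w
  induction w generalizing f with
  | nil => simp [mul_nil, one_nil]
  | cons a w ih => simp [mul_cons, one_cons, ih, tail]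

/-- Left multiplication of the coefficients by a scalar. -/
def lsmul (c : S) (f : NCS α S) : NCS α S := fun w => c * f w

theorem lsmul_apply (c : S) (f : NCS α S) (w : List α) : lsmul c f w = c * f w := rfl

theorem tail_mul (a : α) (f g : NCS α S) :
    tail a (f * g) = lsmul (f []) (tail a g) + tail a f * g := by
  ext w; exact mul_cons f g a w

theorem lsmul_mul (c : S) (f g : NCS α S) : lsmul c f * g = lsmul c (f * g) := by
  ext w; simp [mul_apply, lsmul_apply, Finset.mul_sum, mul_assoc]

theorem mul_assoc' (f g h : NCS α S) : f * g * h = f * (g * h) := by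
  ext w
  induction w generalizing f g h with
  | nil => simp [mul_nil, mul_assoc]
  | cons a w ih =>
    simp only [mul_cons, tail_mul, right_distrib', lsmul_mul, add_apply, lsmul_apply, ih, mul_nil,
      mul_add, mul_assoc, add_assoc]

instance : Ring (NCS α S) where
  left_distrib := left_distrib'
  right_distrib := right_distrib'
  zero_mul := zero_mul'
  mul_zero := mul_zero'
  one_mul := one_mul'
  mul_one := mul_one'
  mul_assoc := mul_assoc'
  zsmul := (inferInstance : AddCommGroup (NCS α S)).zsmul
  zsmul_zero' := (inferInstance : AddCommGroup (NCS α S)).zsmul_zero'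
  zsmul_succ' := (inferInstance : AddCommGroup (NCS α S)).zsmul_succ'
  zsmul_neg' := (inferInstance : AddCommGroup (NCS α S)).zsmul_neg'
  neg_add_cancel := neg_add_cancel
  sub_eq_add_neg := sub_eq_add_neg
  nsmul := (inferInstance : AddCommGroup (NCS α S)).nsmul
  nsmul_zero := (inferInstance : AddCommGroup (NCS α S)).nsmul_zero
  nsmul_succ := (inferInstance : AddCommGroup (NCS α S)).nsmul_succ

/-- The underlying function of `const`. -/
def constFun (c : S) : NCS α S := fun w => match w with | [] => c | _ :: _ => 0

/-- The constant series. -/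
def const : S →+* NCS α S where
  toFun := constFun
  map_one' := rfl
  map_zero' := by ext w; cases w <;> rfl
  map_add' c d := by ext w; cases w <;> simp [add_apply, constFun]
  map_mul' c d := by
    ext w
    cases w with
    | nil => simp [mul_nil, constFun]
    | cons a w =>
      have h : tail a (constFun c : NCS α S) = 0 := rfl
      rw [mul_cons, h]
      simp [constFun, zero_apply]

theorem const_nil (c : S) : (const c : NCS α S) [] = c := rfl
theorem const_cons (c : S) (a : α) (w : List α) : (const c : NCS α S) (a :: w) = 0 := rfl

theorem const_mul_apply (c : S) (f : NCS α S) (w : List α) : ((const c : NCS α S) * f) w = c * f w := by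
  cases w with
  | nil => rw [mul_nil, const_nil]
  | cons a w =>
    have : tail a (const c : NCS α S) = 0 := rfl
    rw [mul_cons, this, zero_mul, const_nil, zero_apply, add_zero]

theorem lsmul_eq (c : S) (f : NCS α S) : lsmul c f = const c * f := by
  ext w; rw [const_mul_apply, lsmul_apply]

theorem mul_const_apply (c : S) (f : NCS α S) (w : List α) : (f * (const c : NCS α S)) w = f w * c := by
  induction w generalizing f with
  | nil => rw [mul_nil, const_nil]
  | cons a w ih => rw [mul_cons, ih, const_cons, mul_zero, zero_add, tail_apply]

/-- The underlying function of `map`. -/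
def mapFun {S' : Type*} (φ : S → S') (f : NCS α S) : NCS α S' := fun w => φ (f w)

/-- The action of a ring morphism on the coefficients. -/
def map {S' : Type*} [Ring S'] (φ : S →+* S') : NCS α S →+* NCS α S' where
  toFun := mapFun φ
  map_one' := by ext w; cases w <;> simp [one_nil, one_cons, mapFun]
  map_zero' := by ext w; simp [zero_apply, mapFun]
  map_add' f g := by ext w; simp [add_apply, mapFun]
  map_mul' f g := by ext w; simp [mul_apply, mapFun]

theorem map_apply {S' : Type*} [Ring S'] (φ : S →+* S') (f : NCS α S) (w : List α) :
    map φ f w = φ (f w) := rfl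

/-- The constant coefficient. -/
def constCoeff : NCS α S →+* S where
  toFun f := f []
  map_one' := rfl
  map_zero' := rfl
  map_add' _ _ := rfl
  map_mul' := mul_nil

end NCS

/-! ### Quasi-shuffle coproducts are multiplicative -/

/-- The coproduct dual to the quasi-shuffle product for which the product of the letters `a`, `b`
is `m a b`, read as zero if it is `none`: the coefficient of `u ⊗ v` in the coproduct of `f` is the
value of `f` at the quasi-shuffle of `u` and `v`. -/
def qsCoprod {α S : Type*} [Ring S] (m : α → α → Option α) :
    NCS α S → List α → List α → S
  | f, [], v => f v
  | f, a :: u, [] => f (a :: u)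
  | f, a :: u, b :: v =>
      qsCoprod m (f.tail a) u (b :: v) + qsCoprod m (f.tail b) (a :: u) v +
        qsCoprod m ((m a b).elim 0 fun c => f.tail c) u v
termination_by _ u v => u.length + v.length

namespace NCS

variable {α S : Type*} [Ring S] (m : α → α → Option α)

/-- `qsCoprod` with values in the completed tensor square. -/
def cop (f : NCS α S) : NCS α (NCS α S) := fun u v => qsCoprod m f u v

theorem cop_nil (f : NCS α S) : cop m f [] = f := by
  ext v; simp [cop, qsCoprod]

theorem cop_nil_right (f : NCS α S) (u : List α) : cop m f u [] = f u := by
  cases u <;> simp [cop, qsCoprod]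

theorem cop_cons_cons (f : NCS α S) (a b : α) (u v : List α) :
    cop m f (a :: u) (b :: v) = cop m (f.tail a) u (b :: v) + cop m (f.tail b) (a :: u) v +
      cop m ((m a b).elim 0 fun c => f.tail c) u v := by
  simp only [cop]; rw [qsCoprod]

theorem cop_add (f g : NCS α S) : cop m (f + g) = cop m f + cop m g := by
  suffices h : ∀ (n : ℕ) (f g : NCS α S) (u v : List α), u.length + v.length ≤ n →
      cop m (f + g) u v = cop m f u v + cop m g u v from
    ext fun u => ext fun v => h _ f g u v le_rfl
  intro n
  induction n with
  | zero =>
    intro f g u v h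
    obtain rfl : u = [] := List.length_eq_zero_iff.mp (by omega)
    simp only [cop_nil, add_apply]
  | succ n ih =>
    intro f g u v h
    rcases u with _ | ⟨a, u⟩
    · simp only [cop_nil, add_apply]
    rcases v with _ | ⟨b, v⟩
    · simp only [cop_nil_right, add_apply]
    simp only [List.length_cons] at h
    have h3 : ((m a b).elim 0 fun c => (f + g).tail c) =
        ((m a b).elim 0 fun c => f.tail c) + ((m a b).elim 0 fun c => g.tail c) := by
      cases m a b <;> simp [tail_add]
    rw [cop_cons_cons, cop_cons_cons, cop_cons_cons, h3, tail_add, tail_add,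
      ih _ _ _ _ (by simp only [List.length_cons]; omega),
      ih _ _ _ _ (by simp only [List.length_cons]; omega), ih _ _ _ _ (by omega)]
    abel

theorem cop_const_mul (c : S) (f : NCS α S) (u v : List α) :
    cop m (const c * f) u v = c * cop m f u v := by
  suffices h : ∀ (n : ℕ) (f : NCS α S) (u v : List α), u.length + v.length ≤ n →
      cop m (lsmul c f) u v = c * cop m f u v by
    rw [← lsmul_eq]; exact h _ f u v le_rfl
  intro n
  induction n with
  | zero =>
    intro f u v h
    obtain rfl : u = [] := List.length_eq_zero_iff.mp (by omega)
    simp only [cop_nil, lsmul_apply]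
  | succ n ih =>
    intro f u v h
    rcases u with _ | ⟨a, u⟩
    · simp only [cop_nil, lsmul_apply]
    rcases v with _ | ⟨b, v⟩
    · simp only [cop_nil_right, lsmul_apply]
    simp only [List.length_cons] at h
    have h2 : ∀ a, (lsmul c f).tail a = lsmul c (f.tail a) := fun _ => rfl
    have h3 : ((m a b).elim 0 fun a => (lsmul c f).tail a) =
        lsmul c ((m a b).elim 0 fun c => f.tail c) := by
      cases m a b with
      | none => ext w; simp [lsmul_apply, zero_apply]
      | some a => rfl
    rw [cop_cons_cons, cop_cons_cons, h3, h2, h2,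
      ih _ _ _ (by simp only [List.length_cons]; omega),
      ih _ _ _ (by simp only [List.length_cons]; omega), ih _ _ _ (by omega), mul_add, mul_add]

theorem sum_apply {ι : Type*} (s : Finset ι) (f : ι → NCS α S) (w : List α) :
    (∑ i ∈ s, f i) w = ∑ i ∈ s, f i w :=
  map_sum (⟨⟨fun f : NCS α S => f w, rfl⟩, fun _ _ => rfl⟩ : NCS α S →+ S) f s

/-- `tail` in the right-hand factor of the tensor square. -/
def rtail (b : α) (F : NCS α (NCS α S)) : NCS α (NCS α S) := fun u => tail b (F u)

/-- The part of an element of the tensor square that is constant in the right-hand factor. -/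
def constPart : NCS α (NCS α S) →+* NCS α (NCS α S) := map (const.comp constCoeff)

theorem constPart_apply (F : NCS α (NCS α S)) (u : List α) :
    constPart F u = const (F u []) := rfl

/-- In the tensor square, a product is computed at a word `b v` of the right-hand factor by
separating the part of the first argument that is constant there. -/
theorem mul_apply_cons (F G : NCS α (NCS α S)) (u : List α) (b : α) (v : List α) :
    (F * G) u (b :: v) =
      (constPart F * G) u (b :: v) + (rtail b F * G) u v := by
  simp only [mul_apply (S := NCS α S), sum_apply, ← Finset.sum_add_distrib]
  refine Finset.sum_congr rfl fun i _ => ?_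
  rw [mul_cons, constPart_apply, const_mul_apply]
  rfl

theorem mul_apply_nil (F G : NCS α (NCS α S)) (u : List α) :
    (F * G) u [] = (map constCoeff F * map constCoeff G) u := by
  rw [← map_mul]; rfl

/-- Quasi-shuffle products and deconcatenation are compatible. -/
theorem cop_mul (f g : NCS α S) : cop m (f * g) = cop m f * cop m g := by
  suffices h : ∀ (n : ℕ) (f g : NCS α S) (u v : List α), u.length + v.length ≤ n →
      cop m (f * g) u v = (cop m f * cop m g) u v from
    ext fun u => ext fun v => h _ f g u v le_rfl
  intro n
  induction n with
  | zero =>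
    intro f g u v h
    obtain rfl : u = [] := List.length_eq_zero_iff.mp (by omega)
    rw [cop_nil, mul_nil, cop_nil, cop_nil]
  | succ n ih =>
    intro f g u v h
    rcases u with _ | ⟨a, u⟩
    · rw [cop_nil, mul_nil, cop_nil, cop_nil]
    rcases v with _ | ⟨b, v⟩
    · have h1 : ∀ f : NCS α S, map constCoeff (cop m f) = f := fun f =>
        ext fun u => cop_nil_right m f u
      rw [cop_nil_right, mul_apply_nil, h1, h1]
    simp only [List.length_cons] at h
    set T : NCS α S → NCS α S := fun f => (m a b).elim 0 fun c => f.tail c with hT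
    have hTm : T (f * g) = const (f []) * T g + T f * g := by
      simp only [hT]
      cases m a b with
      | none => simp
      | some c => simp only [Option.elim, tail_mul, lsmul_eq]
    have tm : ∀ a, tail a (f * g) = const (f []) * tail a g + tail a f * g := fun a => by
      rw [tail_mul, lsmul_eq]
    have hT' : ∀ f u v, cop m f (a :: u) (b :: v) = cop m (f.tail a) u (b :: v) +
        cop m (f.tail b) (a :: u) v + cop m (T f) u v := fun f u v => cop_cons_cons m f a b u v
    -- the two ways of removing the letter `a` agree on the terms constant on the right
    have e1 : constPart (tail a (cop m f)) = constPart (cop m (tail a f)) := by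
      ext1 u
      rw [constPart_apply, constPart_apply, tail_apply, cop_nil_right, cop_nil_right, tail_apply]
    have e2 : rtail b (tail a (cop m f)) =
        rtail b (cop m (tail a f)) + tail a (cop m (tail b f)) + cop m (T f) :=
      ext fun u => ext fun v => hT' f u v
    have e3 : (tail a (cop m f) * cop m g) u (b :: v) =
        (cop m (tail a f) * cop m g) u (b :: v) + (tail a (cop m (tail b f)) * cop m g) u v +
          (cop m (T f) * cop m g) u v := by
      rw [mul_apply_cons, e1, e2, mul_apply_cons (cop m (tail a f)), add_mul, add_mul]
      simp only [add_apply]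
      abel
    have e4 : (cop m (tail b f) * cop m g) (a :: u) v =
        (tail b f * cop m g (a :: u)) v + (tail a (cop m (tail b f)) * cop m g) u v := by
      rw [mul_cons, cop_nil, add_apply]
    rw [hT' (f * g), tm, tm, hTm, cop_add, cop_add, cop_add]
    simp only [add_apply]
    rw [cop_const_mul, cop_const_mul, cop_const_mul,
      ih _ _ _ _ (by simp only [List.length_cons]; omega),
      ih _ _ _ _ (by simp only [List.length_cons]; omega), ih _ _ _ _ (by omega), e4,
      mul_cons (cop m f), add_apply, e3, cop_nil, mul_cons, hT' g]
    simp only [mul_add]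
    abel

/-- The coproduct dual to a quasi-shuffle product, as a morphism of rings. -/
def copHom : NCS α S →+* NCS α (NCS α S) where
  toFun := cop m
  map_one' := by
    suffices h : ∀ u v, cop m (1 : NCS α S) u v = (1 : NCS α (NCS α S)) u v from
      ext fun u => ext fun v => h u v
    intro u v
    rcases u with _ | ⟨a, u⟩
    · rw [cop_nil]; rfl
    have hz : ∀ u v, cop m (0 : NCS α S) u v = 0 := fun u v => by
      simpa using cop_const_mul m (0 : S) 0 u v
    have h0 : ∀ a, tail a (1 : NCS α S) = 0 := fun _ => rfl
    rcases v with _ | ⟨b, v⟩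
    · rw [cop_nil_right]; rfl
    rw [cop_cons_cons, h0, h0, hz, hz, one_cons, zero_apply]
    cases m a b <;> simp [h0, hz]
  map_zero' := ext fun u => ext fun v => by
    simpa [zero_apply] using cop_const_mul m (0 : S) 0 u v
  map_add' := cop_add m
  map_mul' := cop_mul m

theorem copHom_apply (f : NCS α S) : copHom m f = cop m f := rfl

/-- `f ↦ f ⊗ 1`. -/
def inl : NCS α S →+* NCS α (NCS α S) := map const

/-- `g ↦ 1 ⊗ g`. -/
def inr : NCS α S →+* NCS α (NCS α S) := const

theorem inl_mul_inr_apply (f g : NCS α S) (u v : List α) :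
    (inl f * inr g) u v = f u * g v := by
  rw [inr, mul_const_apply, inl, map_apply, const_mul_apply]

theorem inr_mul_inl_apply (f g : NCS α S) (u v : List α) :
    (inr g * inl f) u v = g v * f u := by
  rw [inr, const_mul_apply, inl, map_apply, mul_const_apply]

end NCS

/-- Over a commutative ring, `f ⊗ 1` and `1 ⊗ g` commute. -/
theorem NCS.inr_mul_inl {α R : Type*} [CommRing R] (f g : NCS α R) :
    inr g * inl f = inl f * inr g :=
  ext fun u => ext fun v => by rw [inr_mul_inl_apply, inl_mul_inr_apply, mul_comm]

/-! ### Shuffle and stuffle products as quasi-shuffle products -/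

section Products

/-- The product of letters for which the quasi-shuffle product is the shuffle product. -/
def mSh {α : Type*} : α → α → Option α := fun _ _ => none

/-- The product of letters for which the quasi-shuffle product is the stuffle product. -/
def mSt : ℕ+ → ℕ+ → Option ℕ+ := fun a b => some (a + b)

theorem sh_mono (u v : List (Fin 2)) : sh (mono u) (mono v) = shWord u v := by
  simp [sh, linExt_mono]

theorem st_mono (u v : List ℕ+) : st (mono u) (mono v) = stWord u v := by
  simp [st, linExt_mono]

variable {S : Type*} [Ring S] [Module ℚ S]

theorem linExt_series_mono {α : Type*} (f : NCS α S) (w : List α) : linExt f (mono w) = f w :=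
  linExt_mono _ _

theorem linExt_letter_mul {α : Type*} (f : NCS α S) (a : α) (x : WordAlg α) :
    linExt f (mono [a] * x) = linExt (f.tail a) x :=
  linExt_mono_mul _ _ _

theorem linExt_shWord (f : NCS (Fin 2) S) (u v : List (Fin 2)) :
    linExt f (shWord u v) = NCS.cop mSh f u v := by
  suffices h : ∀ (n : ℕ) (f : NCS (Fin 2) S) (u v : List (Fin 2)), u.length + v.length ≤ n →
      linExt f (shWord u v) = NCS.cop mSh f u v from h _ f u v le_rfl
  intro n
  induction n with
  | zero =>
    intro f u v h
    obtain rfl : u = [] := List.length_eq_zero_iff.mp (by omega)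
    rw [NCS.cop_nil, shWord, linExt_series_mono]
  | succ n ih =>
    intro f u v h
    rcases u with _ | ⟨a, u⟩
    · rw [NCS.cop_nil, shWord, linExt_series_mono]
    rcases v with _ | ⟨b, v⟩
    · rw [NCS.cop_nil_right, shWord, linExt_series_mono]; simp
    simp only [List.length_cons] at h
    have hz : NCS.cop mSh (0 : NCS (Fin 2) S) u v = 0 := by
      rw [← NCS.copHom_apply, map_zero]; rfl
    rw [NCS.cop_cons_cons, shWord, map_add, linExt_letter_mul, linExt_letter_mul,
      ih _ _ _ (by simp only [List.length_cons]; omega),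
      ih _ _ _ (by simp only [List.length_cons]; omega)]
    simp [mSh, hz]

theorem linExt_stWord (f : NCS ℕ+ S) (u v : List ℕ+) :
    linExt f (stWord u v) = NCS.cop mSt f u v := by
  suffices h : ∀ (n : ℕ) (f : NCS ℕ+ S) (u v : List ℕ+), u.length + v.length ≤ n →
      linExt f (stWord u v) = NCS.cop mSt f u v from h _ f u v le_rfl
  intro n
  induction n with
  | zero =>
    intro f u v h
    obtain rfl : u = [] := List.length_eq_zero_iff.mp (by omega)
    rw [NCS.cop_nil, stWord, linExt_series_mono]
  | succ n ih =>
    intro f u v h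
    rcases u with _ | ⟨a, u⟩
    · rw [NCS.cop_nil, stWord, linExt_series_mono]
    rcases v with _ | ⟨b, v⟩
    · rw [NCS.cop_nil_right, stWord, linExt_series_mono]; simp
    simp only [List.length_cons] at h
    rw [NCS.cop_cons_cons, stWord, map_add, map_add, y, y, y, linExt_letter_mul,
      linExt_letter_mul, linExt_letter_mul, ih _ _ _ (by simp only [List.length_cons]; omega),
      ih _ _ _ (by simp only [List.length_cons]; omega), ih _ _ _ (by omega)]
    simp [mSt]

/-- Two bilinear maps on word algebras that agree on words agree everywhere. -/
theorem bilin_congr {α β V : Type*} [AddCommGroup V] [Module ℚ V]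
    {F G : WordAlg α →ₗ[ℚ] WordAlg β →ₗ[ℚ] V}
    (h : ∀ u v, F (mono u) (mono v) = G (mono u) (mono v)) (x : WordAlg α) (z : WordAlg β) :
    F x z = G x z := by
  rw [linMap_ext (F := F) (G := G) fun u => linMap_ext fun v => h u v]

theorem st_one_left (x : Hst) : st 1 x = x := by
  refine linMap_congr (F := st 1) (G := LinearMap.id) (fun w => ?_) x
  rw [← mono_nil, st_mono, stWord]; rfl

theorem st_one_right (x : Hst) : st x 1 = x := by
  refine linMap_congr (F := st.flip 1) (G := LinearMap.id) (fun w => ?_) x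
  rw [LinearMap.flip_apply, ← mono_nil, st_mono]
  cases w <;> simp [stWord]

theorem st_letter_mul (a b : ℕ+) (x z : Hst) :
    st (y a * x) (y b * z) =
      y a * st x (y b * z) + y b * st (y a * x) z + y (a + b) * st x z := by
  refine bilin_congr
    (F := st.compl₁₂ (LinearMap.mulLeft ℚ (y a)) (LinearMap.mulLeft ℚ (y b)))
    (G := (st.compl₂ (LinearMap.mulLeft ℚ (y b))).compr₂ (LinearMap.mulLeft ℚ (y a)) +
      (st ∘ₗ LinearMap.mulLeft ℚ (y a)).compr₂ (LinearMap.mulLeft ℚ (y b)) +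
      st.compr₂ (LinearMap.mulLeft ℚ (y (a + b)))) (fun u v => ?_) x z
  simp [y, mono_mul_mono, st_mono, stWord]

theorem sh_letter_mul (a b : Fin 2) (x z : Hsh) :
    sh (mono [a] * x) (mono [b] * z) =
      mono [a] * sh x (mono [b] * z) + mono [b] * sh (mono [a] * x) z := by
  refine bilin_congr
    (F := sh.compl₁₂ (LinearMap.mulLeft ℚ (mono [a])) (LinearMap.mulLeft ℚ (mono [b])))
    (G := (sh.compl₂ (LinearMap.mulLeft ℚ (mono [b]))).compr₂ (LinearMap.mulLeft ℚ (mono [a])) +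
      (sh ∘ₗ LinearMap.mulLeft ℚ (mono [a])).compr₂ (LinearMap.mulLeft ℚ (mono [b])))
    (fun u v => ?_) x z
  simp [mono_mul_mono, sh_mono, shWord]

theorem sh_one_left (x : Hsh) : sh 1 x = x := by
  refine linMap_congr (F := sh 1) (G := LinearMap.id) (fun w => ?_) x
  rw [← mono_nil, sh_mono, shWord]; rfl

theorem sh_one_right (x : Hsh) : sh x 1 = x := by
  refine linMap_congr (F := sh.flip 1) (G := LinearMap.id) (fun w => ?_) x
  rw [LinearMap.flip_apply, ← mono_nil, sh_mono]
  cases w <;> simp [shWord]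

end Products

/-! ### Reversal of words and quasi-shuffle products -/

namespace NCS

variable {α S : Type*} [Ring S] (m : α → α → Option α)

/-- The series `∑_w f[w a] w`. -/
def init (a : α) (f : NCS α S) : NCS α S := fun w => f (w ++ [a])

theorem init_apply (a : α) (f : NCS α S) (w : List α) : init a f w = f (w ++ [a]) := rfl

theorem tail_init (a b : α) (f : NCS α S) : tail a (init b f) = init b (tail a f) := rfl

/-- Quasi-shuffle products satisfy the recursion on last letters that mirrors their definition. -/
theorem cop_append_append (f : NCS α S) (a b : α) (u v : List α) :
    cop m f (u ++ [a]) (v ++ [b]) = cop m (f.init a) u (v ++ [b]) + cop m (f.init b) (u ++ [a]) v +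
      cop m ((m a b).elim 0 fun c => f.init c) u v := by
  have zc : ∀ u v, cop m (0 : NCS α S) u v = 0 := fun u v => by
    rw [← copHom_apply, map_zero]; rfl
  have ht : ∀ (o o' : Option α) (f : NCS α S),
      (o.elim 0 fun c => ((o'.elim 0 fun d => f.init d) : NCS α S).tail c) =
        (o'.elim 0 fun d => ((o.elim 0 fun c => f.tail c) : NCS α S).init d) := by
    intro o o' f
    cases o <;> cases o' <;> rfl
  suffices h : ∀ (n : ℕ) (f : NCS α S) (u v : List α), u.length + v.length ≤ n →
      cop m f (u ++ [a]) (v ++ [b]) = cop m (f.init a) u (v ++ [b]) +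
        cop m (f.init b) (u ++ [a]) v + cop m ((m a b).elim 0 fun c => f.init c) u v from
    h _ f u v le_rfl
  have ht1 : ∀ (c : α) (f : NCS α S), ((m a b).elim 0 fun d => f.init d).tail c =
      ((m a b).elim 0 fun d => (f.tail c).init d) := fun c f => by
    simpa using ht (some c) (m a b) f
  have base : ∀ (f : NCS α S), cop m f [a] [b] = f [a, b] + f [b, a] +
      ((m a b).elim 0 fun c => f.init c) [] := by
    intro f
    rw [cop_cons_cons, cop_nil, cop_nil_right]
    cases m a b <;> simp [cop_nil, zero_apply, tail_apply, init_apply]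
  intro n
  induction n with
  | zero =>
    intro f u v h
    obtain rfl : u = [] := List.length_eq_zero_iff.mp (by omega)
    obtain rfl : v = [] := List.length_eq_zero_iff.mp (by omega)
    rw [List.nil_append, List.nil_append, base, cop_nil, cop_nil, cop_nil_right]
    simp only [init_apply, List.cons_append, List.nil_append]
    abel
  | succ n ih =>
    intro f u v h
    rcases u with _ | ⟨c, u⟩ <;> rcases v with _ | ⟨d, v⟩
    · rw [List.nil_append, List.nil_append, base, cop_nil, cop_nil, cop_nil_right]
      simp only [init_apply, List.cons_append, List.nil_append]
      abel
    · simp only [List.length_cons] at h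
      rw [List.nil_append, List.cons_append, cop_cons_cons, ← List.nil_append [a],
        ih (f.tail d) [] v (by simp; omega), List.nil_append, cop_cons_cons m (f.init b)]
      simp only [cop_nil, init_apply, tail_apply, List.cons_append, ← ht1]
      have e : ((m a d).elim 0 fun c => f.tail c) (v ++ [b]) =
          ((m a d).elim 0 fun c => (f.init b).tail c) v := by cases m a d <;> rfl
      rw [e]; simp only [tail_init]; abel
    · simp only [List.length_cons] at h
      rw [List.nil_append, List.cons_append, cop_cons_cons, ← List.nil_append [b],
        ih (f.tail c) u [] (by simp; omega), List.nil_append, cop_cons_cons m (f.init a)]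
      simp only [cop_nil_right, init_apply, tail_apply, List.cons_append, ← ht1]
      have e : ((m c b).elim 0 fun c => f.tail c) (u ++ [a]) =
          ((m c b).elim 0 fun c => (f.init a).tail c) u := by cases m c b <;> rfl
      rw [e]; simp only [tail_init]; abel
    · simp only [List.length_cons] at h
      rw [List.cons_append, List.cons_append, cop_cons_cons,
        ← List.cons_append, ← List.cons_append, ih (f.tail c) u (d :: v) (by simp; omega),
        ih (f.tail d) (c :: u) v (by simp; omega), ih _ u v (by omega),
        List.cons_append, List.cons_append, cop_cons_cons m (f.init a),
        cop_cons_cons m (f.init b), cop_cons_cons m ((m a b).elim 0 fun c => f.init c), ht, ht1,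
        ht1]
      have e : ∀ x : α, ((m c d).elim 0 fun c => f.tail c).init x =
          ((m c d).elim 0 fun c => (f.init x).tail c) := fun x => by cases m c d <;> rfl
      simp only [tail_init, e]
      abel

/-- The series `∑_w f[w̄] w`, with `w̄` the reversal of `w`. -/
def rev (f : NCS α S) : NCS α S := fun w => f w.reverse

theorem rev_apply (f : NCS α S) (w : List α) : rev f w = f w.reverse := rfl

theorem cop_rev (f : NCS α S) (u v : List α) :
    cop m (rev f) u v = cop m f u.reverse v.reverse := by
  suffices h : ∀ (n : ℕ) (f : NCS α S) (u v : List α), u.length + v.length ≤ n →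
      cop m (rev f) u v = cop m f u.reverse v.reverse from h _ f u v le_rfl
  intro n
  induction n with
  | zero =>
    intro f u v h
    obtain rfl : u = [] := List.length_eq_zero_iff.mp (by omega)
    rw [cop_nil, List.reverse_nil, cop_nil, rev_apply]
  | succ n ih =>
    intro f u v h
    rcases u with _ | ⟨a, u⟩
    · rw [cop_nil, List.reverse_nil, cop_nil, rev_apply]
    rcases v with _ | ⟨b, v⟩
    · rw [cop_nil_right, List.reverse_nil, cop_nil_right, rev_apply]
    simp only [List.length_cons] at h
    have e1 : ∀ a, tail a (rev f) = rev (init a f) := fun a => by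
      ext w; simp [tail_apply, rev_apply, init_apply]
    have e2 : ((m a b).elim 0 fun c => (rev f).tail c) =
        rev ((m a b).elim 0 fun c => f.init c) := by
      cases m a b with
      | none => rfl
      | some c => exact e1 c
    rw [cop_cons_cons, e2, e1, e1, ih _ _ _ (by simp only [List.length_cons]; omega),
      ih _ _ _ (by simp only [List.length_cons]; omega), ih _ _ _ (by omega),
      List.reverse_cons, List.reverse_cons, cop_append_append]

/-- The series `∑_w (-1)^(weight of w) f[w] w`, for a weight given on letters. -/
def sgn (wt : α → ℕ) (f : NCS α S) : NCS α S := fun w => (-1) ^ (w.map wt).sum * f w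

theorem sgn_apply (wt : α → ℕ) (f : NCS α S) (w : List α) :
    sgn wt f w = (-1) ^ (w.map wt).sum * f w := rfl

/-- Twisting a series by the sign `(-1)^(weight)`, for a weight that is additive for the product of
letters, twists its quasi-shuffle coproduct. -/
theorem cop_sign (wt : α → ℕ) (hm : ∀ a b c, m a b = some c → wt c = wt a + wt b) (f : NCS α S)
    (u v : List α) :
    cop m (sgn wt f) u v =
      (-1) ^ ((u.map wt).sum + (v.map wt).sum) * cop m f u v := by
  suffices h : ∀ (n : ℕ) (f : NCS α S) (u v : List α), u.length + v.length ≤ n →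
      cop m (sgn wt f) u v =
        (-1) ^ ((u.map wt).sum + (v.map wt).sum) * cop m f u v from h _ f u v le_rfl
  have e1 : ∀ (a : α) (f : NCS α S),
      tail a (sgn wt f) =
        const ((-1) ^ wt a) * sgn wt (tail a f) := by
    intro a f
    ext w
    rw [const_mul_apply, tail_apply, sgn_apply, sgn_apply, tail_apply, List.map_cons, List.sum_cons, pow_add, mul_assoc]
  intro n
  induction n with
  | zero =>
    intro f u v h
    obtain rfl : u = [] := List.length_eq_zero_iff.mp (by omega)
    simp [cop_nil, sgn_apply]
  | succ n ih =>
    intro f u v h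
    rcases u with _ | ⟨a, u⟩
    · simp [cop_nil, sgn_apply]
    rcases v with _ | ⟨b, v⟩
    · simp [cop_nil_right, sgn_apply]
    simp only [List.length_cons] at h
    have e2 : ((m a b).elim 0 fun c => tail c (sgn wt f)) =
        const ((-1) ^ (wt a + wt b)) * sgn wt ((m a b).elim 0 fun c => tail c f) := by
      cases h : m a b with
      | none =>
        ext w; rw [const_mul_apply]; simp [zero_apply, sgn_apply]
      | some c => rw [← hm a b c h]; exact e1 c f
    rw [cop_cons_cons, e2, e1, e1, cop_const_mul, cop_const_mul, cop_const_mul,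
      ih _ _ _ (by simp only [List.length_cons]; omega),
      ih _ _ _ (by simp only [List.length_cons]; omega), ih _ _ _ (by omega), cop_cons_cons]
    simp only [List.map_cons, List.sum_cons, mul_add, ← mul_assoc, ← pow_add]
    congr 3 <;> ring_nf

end NCS

/-! ### Divided powers of derivations -/

section DividedPowers

variable {V₁ V₂ V₃ : Type*} [AddCommGroup V₁] [Module ℚ V₁] [AddCommGroup V₂] [Module ℚ V₂]
  [AddCommGroup V₃] [Module ℚ V₃]

/-- The divided power `Dⁿ / n!`. -/
noncomputable def dpow (D : V₁ →ₗ[ℚ] V₁) (n : ℕ) : V₁ →ₗ[ℚ] V₁ := (n.factorial : ℚ)⁻¹ • D ^ n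

theorem dpow_zero (D : V₁ →ₗ[ℚ] V₁) (x : V₁) : dpow D 0 x = x := by simp [dpow]

theorem dpow_succ (D : V₁ →ₗ[ℚ] V₁) (n : ℕ) (x : V₁) :
    ((n + 1 : ℕ) : ℚ) • dpow D (n + 1) x = D (dpow D n x) := by
  have h : ((n + 1 : ℕ) : ℚ) ≠ 0 := by positivity
  rw [dpow, dpow, LinearMap.smul_apply, LinearMap.smul_apply, map_smul, smul_smul,
    Nat.factorial_succ, Nat.cast_mul, mul_inv, mul_inv_cancel_left₀ h, pow_succ', Module.End.mul_apply]

theorem dpow_succ' (D : V₁ →ₗ[ℚ] V₁) (n : ℕ) (x : V₁) :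
    ((n + 1 : ℕ) : ℚ) • dpow D (n + 1) x = dpow D n (D x) := by
  have h : ((n + 1 : ℕ) : ℚ) ≠ 0 := by positivity
  rw [dpow, dpow, LinearMap.smul_apply, LinearMap.smul_apply, smul_smul,
    Nat.factorial_succ, Nat.cast_mul, mul_inv, mul_inv_cancel_left₀ h, pow_succ, Module.End.mul_apply]

/-- A sequence with `(n + 1) c_{n+1} = D c_n` is the sequence of divided powers of `D` at `c_0`. -/
theorem eq_dpow (D : V₁ →ₗ[ℚ] V₁) (c : ℕ → V₁)
    (h : ∀ n, ((n + 1 : ℕ) : ℚ) • c (n + 1) = D (c n)) (n : ℕ) : c n = dpow D n (c 0) := by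
  induction n with
  | zero => rw [dpow_zero]
  | succ n ih =>
    have h0 : ((n + 1 : ℕ) : ℚ) ≠ 0 := by positivity
    exact smul_right_injective V₁ h0 (by simp only [h, dpow_succ, ih])

theorem map_dpow {D : V₁ →ₗ[ℚ] V₁} {D' : V₂ →ₗ[ℚ] V₂} (F : V₁ →ₗ[ℚ] V₂)
    (h : ∀ x, F (D x) = D' (F x)) (n : ℕ) (x : V₁) : F (dpow D n x) = dpow D' n (F x) := by
  rw [eq_dpow D' (fun n => F (dpow D n x)) (fun n => by
    rw [← map_smul, dpow_succ, h]) n, dpow_zero]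

/-- Leibniz's formula for divided powers. -/
theorem dpow_leibniz {D₁ : V₁ →ₗ[ℚ] V₁} {D₂ : V₂ →ₗ[ℚ] V₂} {D₃ : V₃ →ₗ[ℚ] V₃}
    (B : V₁ →ₗ[ℚ] V₂ →ₗ[ℚ] V₃) (h : ∀ x z, D₃ (B x z) = B (D₁ x) z + B x (D₂ z)) (n : ℕ)
    (x : V₁) (z : V₂) :
    dpow D₃ n (B x z) = ∑ ij ∈ antidiagonal n, B (dpow D₁ ij.1 x) (dpow D₂ ij.2 z) := by
  have key := eq_dpow D₃
    (fun n => ∑ ij ∈ antidiagonal n, B (dpow D₁ ij.1 x) (dpow D₂ ij.2 z)) (fun n => by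
      have e1 : ((n + 1 : ℕ) : ℚ) • ∑ ij ∈ antidiagonal (n + 1),
            B (dpow D₁ ij.1 x) (dpow D₂ ij.2 z) =
          ∑ ij ∈ antidiagonal (n + 1), (ij.1 : ℚ) • B (dpow D₁ ij.1 x) (dpow D₂ ij.2 z) +
          ∑ ij ∈ antidiagonal (n + 1), (ij.2 : ℚ) • B (dpow D₁ ij.1 x) (dpow D₂ ij.2 z) := by
        rw [Finset.smul_sum, ← Finset.sum_add_distrib]
        refine Finset.sum_congr rfl fun ij hij => ?_
        rw [← add_smul, ← Nat.cast_add, mem_antidiagonal.mp hij]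
      rw [e1, Finset.Nat.sum_antidiagonal_succ, Finset.Nat.sum_antidiagonal_succ', map_sum]
      simp only [Nat.cast_zero, zero_smul, zero_add]
      rw [← Finset.sum_add_distrib]
      refine Finset.sum_congr rfl fun ij _ => ?_
      rw [h, ← dpow_succ, ← dpow_succ, map_smul, map_smul, LinearMap.smul_apply]) n
  rw [key]
  simp [dpow_zero]

end DividedPowers

/-! ### The derivation `y_s ↦ s y_{s+1}` -/

section Derivation

/-- The value on words of the derivation `y_s ↦ s y_{s+1}`. -/
noncomputable def dstWord : List ℕ+ → Hst
  | [] => 0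
  | a :: w => ((a : ℕ) : ℚ) • mono ((a + 1) :: w) + y a * dstWord w

/-- The derivation `D` of the concatenation algebra with `D y_s = s y_{s+1}`.  It is also a
derivation of the stuffle product, and `ι_{*,T} = exp(-T D)`. -/
noncomputable def dst : Hst →ₗ[ℚ] Hst := linExt dstWord

theorem dst_letter_mul (a : ℕ+) (x : Hst) :
    dst (y a * x) = ((a : ℕ) : ℚ) • (y (a + 1) * x) + y a * dst x := by
  refine linMap_congr (F := dst ∘ₗ LinearMap.mulLeft ℚ (y a))
    (G := ((a : ℕ) : ℚ) • LinearMap.mulLeft ℚ (y (a + 1)) + LinearMap.mulLeft ℚ (y a) ∘ₗ dst)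
    (fun w => ?_) x
  simp [y, mono_mul_mono, dst, linExt_mono, dstWord]

theorem dst_one : dst 1 = 0 := by
  rw [← mono_nil, dst, linExt_mono, dstWord]

theorem dst_y (a : ℕ+) : dst (y a) = ((a : ℕ) : ℚ) • y (a + 1) := by
  have := dst_letter_mul a 1
  rwa [dst_one, mul_zero, add_zero, mul_one, mul_one] at this

theorem dst_mul (x z : Hst) : dst (x * z) = dst x * z + x * dst z := by
  refine linMap_congr (F := dst ∘ₗ LinearMap.mulRight ℚ z)
    (G := LinearMap.mulRight ℚ z ∘ₗ dst + LinearMap.mulRight ℚ (dst z)) (fun w => ?_) x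
  simp only [LinearMap.comp_apply, LinearMap.add_apply, LinearMap.mulRight_apply]
  induction w with
  | nil => rw [mono_nil, one_mul, dst_one, zero_mul, one_mul, zero_add]
  | cons a w ih =>
    have e : mono (a :: w) = y a * mono w := mono_cons a w
    rw [e, mul_assoc, dst_letter_mul, ih, dst_letter_mul, add_mul, smul_mul_assoc, mul_add]
    simp only [mul_assoc]
    abel

theorem dst_st (x z : Hst) : dst (st x z) = st (dst x) z + st x (dst z) := by
  refine bilin_congr (F := st.compr₂ dst) (G := st ∘ₗ dst + st.compl₂ dst) (fun u v => ?_) x z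
  simp only [LinearMap.compr₂_apply, LinearMap.add_apply, LinearMap.comp_apply,
    LinearMap.compl₂_apply]
  suffices h : ∀ (n : ℕ) (u v : List ℕ+), u.length + v.length ≤ n →
      dst (st (mono u) (mono v)) = st (dst (mono u)) (mono v) + st (mono u) (dst (mono v)) from
    h _ u v le_rfl
  intro n
  induction n with
  | zero =>
    intro u v h
    obtain rfl : u = [] := List.length_eq_zero_iff.mp (by omega)
    rw [mono_nil, st_one_left, dst_one, map_zero, LinearMap.zero_apply, zero_add, st_one_left]
  | succ n ih =>
    intro u v h
    rcases u with _ | ⟨a, u⟩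
    · rw [mono_nil, st_one_left, dst_one, map_zero, LinearMap.zero_apply, zero_add, st_one_left]
    rcases v with _ | ⟨b, v⟩
    · rw [mono_nil, st_one_right, dst_one, map_zero, add_zero, st_one_right]
    simp only [List.length_cons] at h
    have ea : mono (a :: u) = y a * mono u := mono_cons a u
    have eb : mono (b :: v) = y b * mono v := mono_cons b v
    have h1 := ih u (b :: v) (by simp only [List.length_cons]; omega)
    have h2 := ih (a :: u) v (by simp only [List.length_cons]; omega)
    have h3 := ih u v (by omega)
    rw [ea] at h2 ⊢
    rw [eb] at h1 ⊢
    have c1 : ((a + b : ℕ+) : ℕ) = (a : ℕ) + b := rfl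
    have c2 : a + 1 + b = a + b + 1 := by rw [add_right_comm]
    have c3 : a + (b + 1) = a + b + 1 := (add_assoc _ _ _).symm
    rw [st_letter_mul, map_add, map_add, dst_letter_mul, dst_letter_mul, dst_letter_mul, h1, h2, h3,
      dst_letter_mul, dst_letter_mul]
    simp only [map_add, map_smul, LinearMap.add_apply, LinearMap.smul_apply, st_letter_mul, c1, c2,
      c3, mul_add, smul_add, Nat.cast_add, add_smul, mul_smul_comm]
    abel

/-- The index `s + l`, for a letter `y_s` and a natural number `l`. -/
def shiftIdx (s : ℕ+) (l : ℕ) : ℕ+ := ⟨s + l, by positivity⟩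

theorem dpow_dst_y (a : ℕ+) (n : ℕ) :
    dpow dst n (y a) = (Nat.choose (n + a - 1) (a - 1) : ℚ) • y (shiftIdx a n) := by
  have key := eq_dpow dst (fun n => (Nat.choose (n + a - 1) (a - 1) : ℚ) •
    y (shiftIdx a n)) (fun n => ?_) n
  · rw [key]
    simp only [zero_add, Nat.choose_self, Nat.cast_one, one_smul]
    rfl
  · have hd : dst (y (shiftIdx a n)) = ((a + n : ℕ) : ℚ) •
        y (shiftIdx a (n + 1)) := dst_y (shiftIdx a n)
    rw [map_smul, hd, smul_smul, smul_smul]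
    obtain ⟨k, hk⟩ : ∃ k, (a : ℕ) = k + 1 := ⟨a - 1, by have := a.pos; omega⟩
    have hc : (n + 1) * Nat.choose (n + 1 + a - 1) (a - 1) =
        Nat.choose (n + a - 1) (a - 1) * (a + n) := by
      have h := Nat.add_one_mul_choose_eq (n + k) n
      have s1 : Nat.choose (n + k + 1) (n + 1) = Nat.choose (n + k + 1) k :=
        Nat.choose_symm_of_eq_add (by omega)
      have s2 : Nat.choose (n + k) n = Nat.choose (n + k) k := Nat.choose_symm_of_eq_add (by omega)
      have t1 : n + 1 + (a : ℕ) - 1 = n + k + 1 := by omega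
      have t2 : n + (a : ℕ) - 1 = n + k := by omega
      have t3 : (a : ℕ) - 1 = k := by omega
      rw [t1, t2, t3, ← s1, ← s2, hk]
      rw [mul_comm, ← h]; ring
    have hc' : ((n + 1 : ℕ) : ℚ) * (Nat.choose (n + 1 + a - 1) (a - 1) : ℚ) =
        (Nat.choose (n + a - 1) (a - 1) : ℚ) * ((a + n : ℕ) : ℚ) := by exact_mod_cast hc
    rw [hc']

end Derivation

/-! ### The coefficients of `ι_{*,T}` -/

section Iota

/-- The coefficient of `T ^ n`, as a `ℚ`-linear map. -/
noncomputable def coeffL {A : Type*} [Ring A] [Module ℚ A] (n : ℕ) : PowerSeries A →ₗ[ℚ] A where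
  toFun := PowerSeries.coeff n
  map_add' := by simp
  map_smul' _ _ := rfl

theorem coeffL_apply {A : Type*} [Ring A] [Module ℚ A] (n : ℕ) (P : PowerSeries A) :
    coeffL n P = PowerSeries.coeff n P := rfl

theorem coeff_mapT {A V : Type*} [Ring A] [Module ℚ A] [Ring V] [Module ℚ V] (F : A →ₗ[ℚ] V)
    (P : PowerSeries A) (n : ℕ) :
    PowerSeries.coeff n (mapT F P) = F (PowerSeries.coeff n P) := by
  simp [mapT]

theorem coeff_evalT {α R : Type*} [CommRing R] [Algebra ℚ R] (f : Ser α R)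
    (P : PowerSeries (WordAlg α)) (n : ℕ) :
    PowerSeries.coeff n (evalT f P) = linExt f (PowerSeries.coeff n P) :=
  coeff_mapT _ _ _

theorem coeff_iotaLetter (a : ℕ+) (n : ℕ) :
    PowerSeries.coeff n (iotaLetter a) = (-1 : ℚ) ^ n • dpow dst n (y a) := by
  rw [iotaLetter, PowerSeries.coeff_mk, dpow_dst_y, smul_smul]
  rfl

theorem iota_mono (w : List ℕ+) : iota (mono w) = (w.map iotaLetter).prod := linExt_mono _ _

theorem iota_mono_cons (a : ℕ+) (w : List ℕ+) :
    iota (mono (a :: w)) = iotaLetter a * iota (mono w) := by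
  rw [iota_mono, iota_mono, List.map_cons, List.prod_cons]

/-- `ι_{*,T} = exp(-T D)`. -/
theorem coeff_iota (x : Hst) (n : ℕ) :
    PowerSeries.coeff n (iota x) = (-1 : ℚ) ^ n • dpow dst n x := by
  refine linMap_congr (F := coeffL n ∘ₗ iota) (G := (-1 : ℚ) ^ n • dpow dst n) (fun w => ?_) x
  rw [LinearMap.comp_apply, coeffL_apply, LinearMap.smul_apply]
  induction w generalizing n with
  | nil =>
    rw [iota_mono, List.map_nil, List.prod_nil, mono_nil]
    cases n with
    | zero => simp [dpow_zero]
    | succ n =>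
      have h0 : ∀ n, (dst ^ (n + 1)) 1 = 0 := fun n => by
        rw [pow_succ, Module.End.mul_apply, dst_one, map_zero]
      simp [PowerSeries.coeff_one, dpow, h0]
  | cons a w ih =>
    have e : mono (a :: w) = LinearMap.mul ℚ Hst (y a) (mono w) := mono_cons a w
    rw [iota_mono_cons, PowerSeries.coeff_mul, e,
      dpow_leibniz (LinearMap.mul ℚ Hst) (D₁ := dst) (D₂ := dst)
        (fun x z => by simp only [LinearMap.mul_apply', dst_mul]), Finset.smul_sum]
    refine Finset.sum_congr rfl fun ij hij => ?_
    rw [ih, coeff_iotaLetter, LinearMap.mul_apply', smul_mul_smul_comm, ← pow_add,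
      mem_antidiagonal.mp hij]

/-- `ι_{*,T}` is a morphism for the stuffle product. -/
theorem coeff_iota_st (x z : Hst) (n : ℕ) :
    PowerSeries.coeff n (iota (st x z)) =
      ∑ ij ∈ antidiagonal n,
        st (PowerSeries.coeff ij.1 (iota x)) (PowerSeries.coeff ij.2 (iota z)) := by
  rw [coeff_iota, dpow_leibniz st dst_st, Finset.smul_sum]
  refine Finset.sum_congr rfl fun ij hij => ?_
  rw [coeff_iota, coeff_iota, map_smul, map_smul, LinearMap.smul_apply, smul_smul, ← pow_add,
    ← mem_antidiagonal.mp hij, add_comm ij.2]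

end Iota

/-! ### Series that respect the stuffle product -/

section Stuffle

variable {R : Type*} [CommRing R] [Algebra ℚ R]

/-- A series with coefficients in `R`, as an element of the ring `NCS α R`. -/
def toNCS {α R : Type*} (f : Ser α R) : NCS α R := f

theorem toNCS_apply {α R : Type*} (f : Ser α R) (w : List α) : toNCS f w = f w := rfl

theorem toNCS_mul {α R : Type*} [CommRing R] (f g : Ser α R) :
    toNCS (Ser.mul f g) = toNCS f * toNCS g := rfl

theorem stuffleRel_iff_words (f : Ser ℕ+ R) :
    StuffleRel f ↔ ∀ u v, NCS.cop mSt (toNCS f) u v = f u * f v := by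
  constructor
  · intro h u v
    have := h (mono u) (mono v)
    rw [st_mono, linExt_mono, linExt_mono] at this
    exact (linExt_stWord (toNCS f) u v).symm.trans this
  · intro h x z
    refine bilin_congr (F := st.compr₂ (linExt f))
      (G := (LinearMap.mul ℚ R).compl₁₂ (linExt f) (linExt f)) (fun u v => ?_) x z
    simp only [LinearMap.compr₂_apply, LinearMap.compl₁₂_apply, LinearMap.mul_apply',
      linExt_mono, st_mono, ← h]
    exact linExt_stWord (toNCS f) u v

theorem stuffleRel_iff (f : Ser ℕ+ R) :
    StuffleRel f ↔ NCS.copHom mSt (toNCS f) = NCS.inl (toNCS f) * NCS.inr (toNCS f) := by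
  rw [stuffleRel_iff_words]
  constructor
  · intro h
    ext u v
    exact (h u v).trans (NCS.inl_mul_inr_apply _ _ u v).symm
  · intro h u v
    have := congrFun (congrFun h u) v
    rw [NCS.inl_mul_inr_apply] at this
    exact this

theorem StuffleRel.mul {f g : Ser ℕ+ R} (hf : StuffleRel f) (hg : StuffleRel g) :
    StuffleRel (Ser.mul f g) := by
  rw [stuffleRel_iff] at *
  rw [toNCS_mul, map_mul, hf, hg, map_mul, map_mul, mul_assoc, mul_assoc,
    ← mul_assoc _ (NCS.inl (toNCS g)), NCS.inr_mul_inl, mul_assoc]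

theorem weight_eq (w : List ℕ+) : weight w = (w.map fun s : ℕ+ => (s : ℕ)).sum := by
  induction w with
  | nil => simp [weight]
  | cons a w ih =>
    rw [List.map_cons, List.sum_cons, ← ih]
    simp [weight]

/-- The series `f ∘ inv`. -/
noncomputable def invSer (f : Ser ℕ+ R) : Ser ℕ+ R := fun w => linExt f (inv (mono w))

theorem invSer_apply (f : Ser ℕ+ R) (w : List ℕ+) :
    invSer f w = (-1) ^ weight w * f w.reverse := by
  rw [invSer, inv, linExt_mono, map_smul, linExt_mono, Algebra.smul_def, map_pow, map_neg, map_one]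

theorem StuffleRel.invSer {f : Ser ℕ+ R} (hf : StuffleRel f) : StuffleRel (invSer f) := by
  rw [stuffleRel_iff_words] at *
  intro u v
  have e : toNCS (DShuffle.invSer f) = NCS.sgn (fun s : ℕ+ => (s : ℕ)) (NCS.rev (toNCS f)) :=
    funext fun w => by
      rw [toNCS_apply, invSer_apply, weight_eq]; rfl
  have hm : ∀ a b c : ℕ+, mSt a b = some c → (c : ℕ) = a + b := by
    intro a b c h
    rw [mSt, Option.some_inj] at h
    rw [← h, PNat.add_coe]
  rw [e, NCS.cop_sign _ _ hm, NCS.cop_rev, hf, invSer_apply, invSer_apply, pow_add]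
  simp only [weight_eq]
  ring

/-- The series `f ∘ ι_{*,T}`. -/
noncomputable def iotaSer (f : Ser ℕ+ R) : Ser ℕ+ (PowerSeries R) :=
  fun w => evalT f (iota (mono w))

theorem coeff_linExt_iotaSer (f : Ser ℕ+ R) (x : Hst) (n : ℕ) :
    PowerSeries.coeff n (linExt (iotaSer f) x) =
      linExt f (PowerSeries.coeff n (iota x)) := by
  refine linMap_congr (F := coeffL n ∘ₗ linExt (iotaSer f)) (G := linExt f ∘ₗ coeffL n ∘ₗ iota)
    (fun w => ?_) x
  rw [LinearMap.comp_apply, linExt_mono, iotaSer, coeffL_apply, coeff_evalT]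
  rfl

theorem StuffleRel.iotaSer {f : Ser ℕ+ R} (hf : StuffleRel f) : StuffleRel (iotaSer f) := by
  intro x z
  ext n
  rw [coeff_linExt_iotaSer, coeff_iota_st, map_sum, PowerSeries.coeff_mul]
  refine Finset.sum_congr rfl fun ij _ => ?_
  rw [hf, coeff_linExt_iotaSer, coeff_linExt_iotaSer]

theorem StuffleRel.C {f : Ser ℕ+ R} (hf : StuffleRel f) :
    StuffleRel (fun w => PowerSeries.C (f w)) := by
  have e : ∀ x, linExt (fun w => PowerSeries.C (f w)) x = PowerSeries.C (linExt f x) := by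
    intro x
    refine (map_linExt (⟨⟨PowerSeries.C, map_add _⟩, fun c r => ?_⟩ : R →ₗ[ℚ] PowerSeries R)
      f x).symm
    ext n
    simp only [PowerSeries.coeff_C, RingHom.id_apply]
    rw [← coeffL_apply, map_smul, coeffL_apply, PowerSeries.coeff_C]
    split_ifs <;> simp
  intro x z
  rw [e, e, e, hf, map_mul]

theorem symStuffle_eq (f : Ser ℕ+ R) :
    symStuffle f = Ser.mul (iotaSer (invSer f)) (fun w => PowerSeries.C (f w)) := rfl

/-- The symmetrization of a series that respects the stuffle product respects it. -/
theorem StuffleRel.symStuffle {f : Ser ℕ+ R} (hf : StuffleRel f) : StuffleRel (symStuffle f) := by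
  rw [symStuffle_eq]
  exact hf.invSer.iotaSer.mul hf.C

end Stuffle

/-! ### Grouplike series and Lie series -/

section Grouplike

variable {S R : Type*} [Ring S] [CommRing R]

namespace NCS

/-- The series `e₁`. -/
def e1 : NCS (Fin 2) S := fun w => if w = [1] then 1 else 0

theorem e1_mul_nil (k : NCS (Fin 2) S) : ((e1 : NCS (Fin 2) S) * k) [] = 0 := by
  rw [mul_nil]; simp [e1]

theorem tail_e1 (a : Fin 2) : tail a (e1 : NCS (Fin 2) S) = if a = 1 then 1 else 0 := by
  ext w
  rw [tail_apply]
  by_cases h : a = 1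
  · subst h
    cases w <;> simp [e1, one_nil, one_cons]
  · simp [e1, h, zero_apply]

theorem e1_mul_cons (k : NCS (Fin 2) S) (a : Fin 2) (w : List (Fin 2)) :
    ((e1 : NCS (Fin 2) S) * k) (a :: w) = if a = 1 then k w else 0 := by
  rw [mul_cons, tail_e1]
  have : (e1 : NCS (Fin 2) S) [] = 0 := by simp [e1]
  rw [this, zero_mul, zero_add]
  split_ifs
  · rw [one_mul]
  · rw [zero_mul, zero_apply]

theorem mul_e1_nil (k : NCS (Fin 2) S) : (k * (e1 : NCS (Fin 2) S)) [] = 0 := by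
  rw [mul_nil]; simp [e1]

theorem mul_e1_append (k : NCS (Fin 2) S) (a : Fin 2) (w : List (Fin 2)) :
    (k * (e1 : NCS (Fin 2) S)) (w ++ [a]) = if a = 1 then k w else 0 := by
  induction w generalizing k with
  | nil =>
    rw [List.nil_append, mul_cons, mul_e1_nil]
    simp [e1]
  | cons b w ih =>
    rw [List.cons_append, mul_cons, ih, tail_apply]
    simp [e1]

theorem inl_e1 : inl (e1 : NCS (Fin 2) S) = e1 := by
  ext u v
  rw [inl, map_apply, e1, e1]
  split_ifs <;> simp

/-- The series `e₁` is a Lie series. -/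
theorem copHom_e1 : copHom mSh (e1 : NCS (Fin 2) S) = inl e1 + inr e1 := by
  have h1 : ∀ (u : List (Fin 2)) (b : Fin 2) (v : List (Fin 2)),
      (1 : NCS (Fin 2) (NCS (Fin 2) S)) u (b :: v) = 0 := by
    intro u b v
    cases u
    · rw [one_nil, one_cons]
    · rw [one_cons, zero_apply]
  have h2 : ∀ (u : List (Fin 2)) (b : Fin 2) (v : List (Fin 2)),
      (1 : NCS (Fin 2) (NCS (Fin 2) S)) (b :: u) v = 0 := by
    intro u b v
    rw [one_cons, zero_apply]
  ext u v
  rw [copHom_apply, inl_e1, inr, add_apply, add_apply]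
  rcases u with _ | ⟨a, u⟩
  · rw [cop_nil, const_nil]; simp [e1, zero_apply]
  rcases v with _ | ⟨b, v⟩
  · rw [cop_nil_right, const_cons]
    simp only [e1, zero_apply, add_zero]
    split_ifs <;> rfl
  have hz : ∀ u v, cop mSh (0 : NCS (Fin 2) S) u v = 0 := fun u v => by
    rw [← copHom_apply, map_zero]; rfl
  have ho : ∀ u v, cop mSh (1 : NCS (Fin 2) S) u v = (1 : NCS (Fin 2) (NCS (Fin 2) S)) u v :=
    fun u v => by rw [← copHom_apply, map_one]
  rw [cop_cons_cons, tail_e1, tail_e1, const_cons, zero_apply, add_zero]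
  have e : cop mSh (if a = 1 then 1 else 0 : NCS (Fin 2) S) u (b :: v) = 0 := by
    split_ifs
    · rw [ho, h1]
    · rw [hz]
  have e' : cop mSh (if b = 1 then 1 else 0 : NCS (Fin 2) S) (a :: u) v = 0 := by
    split_ifs
    · rw [ho, h2]
    · rw [hz]
  rw [e, e']
  simp only [mSh, Option.elim, hz, e1, add_zero]
  split_ifs
  · rw [one_cons]
  · rw [zero_apply]

/-- Left multiplication by `e₁`. -/
def e1L (k : NCS (Fin 2) S) : NCS (Fin 2) S := e1 * k

/-- Right multiplication by `e₁`. -/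
def e1R (k : NCS (Fin 2) S) : NCS (Fin 2) S := k * e1

theorem e1L_nil (k : NCS (Fin 2) S) : e1L k [] = 0 := e1_mul_nil k
theorem e1R_nil (k : NCS (Fin 2) S) : e1R k [] = 0 := mul_e1_nil k
theorem e1L_cons (k : NCS (Fin 2) S) (a : Fin 2) (w : List (Fin 2)) :
    e1L k (a :: w) = if a = 1 then k w else 0 := e1_mul_cons k a w
theorem e1R_append (k : NCS (Fin 2) S) (a : Fin 2) (w : List (Fin 2)) :
    e1R k (w ++ [a]) = if a = 1 then k w else 0 := mul_e1_append k a w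

/-- The coefficient of a word `v` of the right-hand factor of the tensor square. -/
def col (K : List (Fin 2) → NCS (Fin 2) S) (v : List (Fin 2)) : NCS (Fin 2) S := fun u => K u v

theorem col_apply (K : List (Fin 2) → NCS (Fin 2) S) (u v : List (Fin 2)) :
    col K v u = K u v := rfl

/-- An element of the tensor square that commutes with `e₁ ⊗ 1 + 1 ⊗ e₁` has no term `u ⊗ v` for
which `u` contains the letter `e₀`.  The commutation relation is stated on coefficients, in a form
that is symmetric in the two factors. -/
theorem eq_zero_of_commute (K : List (Fin 2) → NCS (Fin 2) S)
    (hK : ∀ u v, e1L (col K v) u + e1L (K u) v = e1R (col K v) u + e1R (K u) v)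
    (x v : List (Fin 2)) (b : ℕ) : K (x ++ 0 :: List.replicate b 1) v = 0 := by
  suffices h : ∀ (n : ℕ) (x v : List (Fin 2)) (b : ℕ), b + v.length ≤ n →
      K (x ++ 0 :: List.replicate b 1) v = 0 from h _ x v b le_rfl
  intro n
  induction n with
  | zero =>
    intro x v b h
    obtain rfl : v = [] := List.length_eq_zero_iff.mp (by omega)
    obtain rfl : b = 0 := by omega
    have := hK (1 :: (x ++ [0])) []
    rw [e1L_cons, e1L_nil, e1R_nil, ← List.cons_append, e1R_append] at this
    simpa [col_apply] using this
  | succ n ih =>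
    intro x v b h
    have key := hK (1 :: (x ++ 0 :: List.replicate b 1)) v
    have t1 : e1L (K (1 :: (x ++ 0 :: List.replicate b 1))) v = 0 := by
      rcases v with _ | ⟨c, v⟩
      · rw [e1L_nil]
      · rw [e1L_cons, ← List.cons_append, ih]
        · simp
        · simp only [List.length_cons] at h; omega
    have t2 : e1R (K (1 :: (x ++ 0 :: List.replicate b 1))) v = 0 := by
      rcases List.eq_nil_or_concat' v with rfl | ⟨v, c, rfl⟩
      · rw [e1R_nil]
      · rw [e1R_append, ← List.cons_append, ih]
        · simp
        · simp only [List.length_append, List.length_singleton] at h; omega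
    have t3 : e1R (col K v) (1 :: (x ++ 0 :: List.replicate b 1)) = 0 := by
      rcases b with _ | b
      · rw [List.replicate_zero, ← List.cons_append, e1R_append]
        simp
      · have e : 1 :: (x ++ 0 :: List.replicate (b + 1) (1 : Fin 2)) =
            ((1 :: x) ++ 0 :: List.replicate b 1) ++ [1] := by
          simp [List.replicate_succ']
        rw [e, e1R_append, if_pos rfl]
        exact ih (1 :: x) v b (by omega)
    rw [t1, t2, t3, e1L_cons, if_pos rfl, add_zero, add_zero] at key
    exact key

/-- A word contains `e₀`, and then has a last such letter, or is a power of `e₁`. -/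
theorem exists_eq_append_or_eq_replicate (u : List (Fin 2)) :
    (∃ x b, u = x ++ 0 :: List.replicate b 1) ∨ ∃ n, u = List.replicate n 1 := by
  induction u with
  | nil => exact Or.inr ⟨0, rfl⟩
  | cons a u ih =>
    rcases ih with ⟨x, b, rfl⟩ | ⟨n, rfl⟩
    · exact Or.inl ⟨a :: x, b, rfl⟩
    · fin_cases a
      · exact Or.inl ⟨[], n, rfl⟩
      · exact Or.inr ⟨n + 1, rfl⟩

theorem mul_apply_replicate {α : Type*} (a : α) (k g : NCS α S)
    (hg : ∀ n, 1 ≤ n → g (List.replicate n a) = 0) (n : ℕ) :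
    (k * g) (List.replicate n a) = k (List.replicate n a) * g [] := by
  induction n generalizing k with
  | zero => rw [List.replicate_zero, mul_nil]
  | succ n ih =>
    rw [List.replicate_succ, mul_cons, ← List.replicate_succ, hg _ (by omega), mul_zero, zero_add,
      ih, tail_apply]
    rfl

theorem cop_mSh_replicate {α : Type*} (a : α) (f : NCS α S) (m n : ℕ)
    (h : f (List.replicate (m + n) a) = 0) :
    cop mSh f (List.replicate m a) (List.replicate n a) = 0 := by
  suffices H : ∀ (N m n : ℕ) (f : NCS α S), m + n ≤ N → f (List.replicate (m + n) a) = 0 →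
      cop mSh f (List.replicate m a) (List.replicate n a) = 0 from H _ m n f le_rfl h
  intro N
  induction N with
  | zero =>
    intro m n f hN hf
    obtain rfl : m = 0 := by omega
    rw [List.replicate_zero, cop_nil]
    simpa using hf
  | succ N ih =>
    intro m n f hN hf
    rcases m with _ | m
    · rw [List.replicate_zero, cop_nil]
      simpa using hf
    rcases n with _ | n
    · rw [List.replicate_zero, cop_nil_right]
      exact hf
    have hz : cop mSh (0 : NCS α S) (List.replicate m a) (List.replicate n a) = 0 := by
      rw [← copHom_apply, map_zero]; rfl
    rw [List.replicate_succ, List.replicate_succ, cop_cons_cons, ← List.replicate_succ,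
      ← List.replicate_succ, ih _ _ _ (by omega), ih _ _ _ (by omega)]
    · simp [mSh, hz]
    · rw [tail_apply, ← List.replicate_succ]
      convert hf using 3
      omega
    · rw [tail_apply, ← List.replicate_succ]
      convert hf using 3
      omega

end NCS

theorem toNCS_one : toNCS (Ser.one : Ser (Fin 2) R) = 1 := by
  ext w; cases w <;> rfl

theorem Ser.inverse_nil (f : Ser (Fin 2) R) : Ser.inverse f [] = 1 := by
  rw [Ser.inverse]

theorem inverse_mul_toNCS (f : Ser (Fin 2) R) (hf : f [] = 1) :
    toNCS (Ser.inverse f) * toNCS f = 1 := by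
  rw [← toNCS_mul, Ser.inverse_mul f hf, toNCS_one]

theorem mul_inverse_toNCS (f : Ser (Fin 2) R) (hf : f [] = 1) :
    toNCS f * toNCS (Ser.inverse f) = 1 := by
  have h1 := inverse_mul_toNCS f hf
  have h2 := inverse_mul_toNCS _ (Ser.inverse_nil f)
  have h3 : toNCS (Ser.inverse (Ser.inverse f)) = toNCS f := by
    calc _ = toNCS (Ser.inverse (Ser.inverse f)) * (toNCS (Ser.inverse f) * toNCS f) := by
          rw [h1, mul_one]
      _ = _ := by rw [← mul_assoc, h2, one_mul]
  rwa [h3] at h2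

theorem toNCS_conjE1 (f : Ser (Fin 2) R) :
    toNCS (conjE1 f) = toNCS (Ser.inverse f) * NCS.e1 * toNCS f := rfl

variable [Algebra ℚ R]

theorem coprodSh_eq (f : Ser (Fin 2) R) (u v : List (Fin 2)) :
    coprodSh f u v = NCS.cop mSh (toNCS f) u v := by
  rw [coprodSh, sh_mono]; exact linExt_shWord (toNCS f) u v

theorem isGrouplike_iff (f : Ser (Fin 2) R) (hf : f [] = 1) :
    IsGrouplike f ↔
      NCS.copHom mSh (toNCS f) = NCS.inl (toNCS f) * NCS.inr (toNCS f) := by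
  rw [IsGrouplike]
  simp only [coprodSh_eq, hf, true_and]
  constructor
  · intro h
    ext u v
    rw [NCS.inl_mul_inr_apply]
    exact h u v
  · intro h u v
    have := congrFun (congrFun h u) v
    rwa [NCS.inl_mul_inr_apply] at this

theorem isLieSeries_iff (h : Ser (Fin 2) R) :
    IsLieSeries h ↔
      NCS.copHom mSh (toNCS h) = NCS.inl (toNCS h) + NCS.inr (toNCS h) := by
  have e : ∀ u v, (NCS.inl (toNCS h) + NCS.inr (toNCS h)) u v =
      h u * Ser.one v + Ser.one u * h v := by
    intro u v
    rw [NCS.add_apply, NCS.add_apply, NCS.inl, NCS.map_apply, NCS.inr]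
    congr 1
    · cases v
      · rw [NCS.const_nil, Ser.one, mul_one, toNCS_apply]
      · rw [NCS.const_cons, Ser.one, mul_zero]
    · cases u
      · rw [NCS.const_nil, Ser.one, one_mul, toNCS_apply]
      · rw [NCS.const_cons, Ser.one, zero_mul, NCS.zero_apply]
  rw [IsLieSeries]
  simp only [coprodSh_eq, ← e]
  exact ⟨fun h => NCS.ext fun u => NCS.ext fun v => h u v,
    fun h u v => congrFun (congrFun h u) v⟩

theorem IsGrouplike.isLieSeries_conjE1 {f : Ser (Fin 2) R} (h : IsGrouplike f) :
    IsLieSeries (conjE1 f) := by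
  have hf := h.1
  rw [isGrouplike_iff f hf] at h
  have h1 := inverse_mul_toNCS f hf
  have h2 := mul_inverse_toNCS f hf
  rw [isLieSeries_iff, toNCS_conjE1]
  set F := toNCS f
  set G := toNCS (Ser.inverse f)
  have hl : NCS.inl G * NCS.inl F = 1 := by rw [← map_mul, h1, map_one]
  have hr : NCS.inr G * NCS.inr F = 1 := by rw [← map_mul, h1, map_one]
  have hl' : NCS.inl F * NCS.inl G = 1 := by rw [← map_mul, h2, map_one]
  have hr' : NCS.inr F * NCS.inr G = 1 := by rw [← map_mul, h2, map_one]
  have hG : NCS.copHom mSh G = NCS.inr G * NCS.inl G := by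
    have e : NCS.copHom mSh G * (NCS.inl F * NCS.inr F) = 1 := by rw [← h, ← map_mul, h1, map_one]
    calc NCS.copHom mSh G = NCS.copHom mSh G * (NCS.inl F * (NCS.inr F * NCS.inr G) * NCS.inl G) := by
          rw [hr', mul_one, hl', mul_one]
      _ = NCS.copHom mSh G * (NCS.inl F * NCS.inr F) * (NCS.inr G * NCS.inl G) := by
          simp only [mul_assoc]
      _ = _ := by rw [e, one_mul]
  rw [map_mul, map_mul, hG, NCS.copHom_e1, h, mul_add, add_mul]
  congr 1
  · calc NCS.inr G * NCS.inl G * NCS.inl NCS.e1 * (NCS.inl F * NCS.inr F)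
        = NCS.inr G * NCS.inl (G * NCS.e1 * F) * NCS.inr F := by simp only [map_mul, mul_assoc]
      _ = NCS.inl (G * NCS.e1 * F) := by rw [NCS.inr_mul_inl, mul_assoc, hr, mul_one]
  · calc NCS.inr G * NCS.inl G * NCS.inr NCS.e1 * (NCS.inl F * NCS.inr F)
        = NCS.inl G * (NCS.inr G * NCS.inr NCS.e1 * NCS.inl F) * NCS.inr F := by
          rw [NCS.inr_mul_inl]; simp only [mul_assoc]
      _ = NCS.inl G * NCS.inl F * (NCS.inr G * NCS.inr NCS.e1 * NCS.inr F) := by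
          rw [← map_mul NCS.inr G, NCS.inr_mul_inl]; simp only [mul_assoc]
      _ = NCS.inr (G * NCS.e1 * F) := by rw [hl, one_mul, ← map_mul, ← map_mul]

/-- With `K = Δ(f) (f ⊗ f)⁻¹`, the Lie property of `f⁻¹ e₁ f` says that `K` commutes with
`e₁ ⊗ 1 + 1 ⊗ e₁`.  Such a series is supported on the `e₁^m ⊗ e₁^n`, and the hypothesis on
`f[e₁^n]` gives `K = 1`. -/
theorem isGrouplike_of_isLieSeries_conjE1 {f : Ser (Fin 2) R} (hf : f [] = 1)
    (hf1 : ∀ n : ℕ, 1 ≤ n → f (List.replicate n 1) = 0) (h : IsLieSeries (conjE1 f)) :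
    IsGrouplike f := by
  rw [isGrouplike_iff f hf]
  rw [isLieSeries_iff] at h
  have h1 := inverse_mul_toNCS f hf
  have h2 := mul_inverse_toNCS f hf
  have hFH : toNCS f * toNCS (conjE1 f) = NCS.e1 * toNCS f := by
    rw [toNCS_conjE1, ← mul_assoc, ← mul_assoc, h2, one_mul]
  set F := toNCS f
  set G := toNCS (Ser.inverse f)
  set H := toNCS (conjE1 f)
  have hl : NCS.inl G * NCS.inl F = 1 := by rw [← map_mul, h1, map_one]
  have hr : NCS.inr G * NCS.inr F = 1 := by rw [← map_mul, h1, map_one]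
  have hl' : NCS.inl F * NCS.inl G = 1 := by rw [← map_mul, h2, map_one]
  have hr' : NCS.inr F * NCS.inr G = 1 := by rw [← map_mul, h2, map_one]
  set X := NCS.copHom mSh F with hX
  set Y := NCS.inl F * NCS.inr F with hY
  set Z := NCS.inr G * NCS.inl G with hZ
  set E : NCS (Fin 2) (NCS (Fin 2) R) := NCS.inl NCS.e1 + NCS.inr NCS.e1 with hE
  have hYZ : Y * Z = 1 := by
    rw [hY, hZ, mul_assoc, ← mul_assoc (NCS.inr F), hr', one_mul, hl']
  have hZY : Z * Y = 1 := by
    rw [hY, hZ, mul_assoc, ← mul_assoc (NCS.inl G), hl, one_mul, hr]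
  have eX : X * (NCS.inl H + NCS.inr H) = E * X := by
    rw [hX, ← h, ← map_mul, hFH, map_mul, NCS.copHom_e1]
  have eY : Y * (NCS.inl H + NCS.inr H) = E * Y := by
    rw [hY, hE, mul_add, add_mul]
    congr 1
    · rw [mul_assoc, NCS.inr_mul_inl, ← mul_assoc, ← map_mul, hFH, map_mul, mul_assoc]
    · rw [mul_assoc, ← map_mul, hFH, map_mul, ← mul_assoc, ← NCS.inr_mul_inl, mul_assoc]
  set K := X * Z with hKdef
  have hKE : E * K = K * E := by
    have : (NCS.inl H + NCS.inr H) * Z = Z * E := by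
      calc _ = Z * (Y * (NCS.inl H + NCS.inr H)) * Z := by rw [← mul_assoc Z, hZY, one_mul]
        _ = Z * E * (Y * Z) := by rw [eY]; simp only [mul_assoc]
        _ = _ := by rw [hYZ, mul_one]
    rw [hKdef, ← mul_assoc, ← eX, mul_assoc, this, ← mul_assoc]
  have hKY : K * Y = X := by rw [hKdef, mul_assoc, hZY, mul_one]
  -- the commutation relation of `K` with `e₁ ⊗ 1 + 1 ⊗ e₁`, coefficient by coefficient
  have hc : ∀ u v, NCS.e1L (NCS.col K v) u + NCS.e1L (K u) v =
      NCS.e1R (NCS.col K v) u + NCS.e1R (K u) v := by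
    intro u v
    have := congrFun (congrFun hKE u) v
    rw [hE, add_mul, mul_add, NCS.inl_e1, NCS.inr] at this
    simp only [NCS.add_apply, NCS.const_mul_apply, NCS.mul_const_apply] at this
    have a1 : NCS.e1L (NCS.col K v) u = NCS.e1L K u v := by
      cases u
      · rw [NCS.e1L_nil, NCS.e1L_nil, NCS.zero_apply]
      · rw [NCS.e1L_cons, NCS.e1L_cons]
        split_ifs
        · rfl
        · rw [NCS.zero_apply]
    have a2 : NCS.e1R (NCS.col K v) u = NCS.e1R K u v := by
      rcases List.eq_nil_or_concat' u with rfl | ⟨u, c, rfl⟩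
      · rw [NCS.e1R_nil, NCS.e1R_nil, NCS.zero_apply]
      · rw [NCS.e1R_append, NCS.e1R_append]
        split_ifs
        · rfl
        · rw [NCS.zero_apply]
    rw [a1, a2]
    exact this
  have hc' : ∀ u v, NCS.e1L (NCS.col (NCS.col K) v) u + NCS.e1L (NCS.col K u) v =
      NCS.e1R (NCS.col (NCS.col K) v) u + NCS.e1R (NCS.col K u) v := by
    intro u v
    rw [add_comm, add_comm (NCS.e1R (NCS.col (NCS.col K) v) u)]
    exact hc v u
  -- at the words `e₁^m ⊗ e₁^n` the series `K` agrees with `Δ(f)`, hence with the unit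
  have hK1 : K = 1 := by
    ext u v
    rcases NCS.exists_eq_append_or_eq_replicate u with ⟨x, b, rfl⟩ | ⟨m, rfl⟩
    · rw [NCS.eq_zero_of_commute K hc]
      cases x <;> rfl
    rcases NCS.exists_eq_append_or_eq_replicate v with ⟨x, b, rfl⟩ | ⟨n, rfl⟩
    · rw [← NCS.col_apply K, NCS.eq_zero_of_commute (NCS.col K) hc' x _ b]
      cases m <;> cases x <;> rfl
    have hY1 : ∀ n, 1 ≤ n → Y (List.replicate n 1) = 0 := by
      intro n hn
      ext v
      rw [hY, NCS.inl_mul_inr_apply, NCS.zero_apply]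
      exact mul_eq_zero_of_left (hf1 n hn) _
    have hY0 : Y [] = F := by
      ext v
      rw [hY, NCS.inl_mul_inr_apply]
      exact (congrArg (· * F v) hf).trans (one_mul _)
    have e1 : X (List.replicate m 1) (List.replicate n 1) =
        K (List.replicate m 1) (List.replicate n 1) := by
      rw [← hKY, NCS.mul_apply_replicate 1 K Y hY1, hY0, NCS.mul_apply_replicate 1 _ F hf1]
      exact (congrArg (_ * ·) hf).trans (mul_one _)
    rw [← e1, hX, NCS.copHom_apply]
    by_cases hmn : m + n = 0
    · obtain rfl : m = 0 := by omega
      obtain rfl : n = 0 := by omega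
      rw [List.replicate_zero, NCS.cop_nil, NCS.one_nil, NCS.one_nil]
      exact hf
    · rw [NCS.cop_mSh_replicate 1 F m n (hf1 _ (by omega))]
      cases m with
      | zero =>
        cases n with
        | zero => simp at hmn
        | succ n => rfl
      | succ m => rfl
  rw [← hKY, hK1, one_mul]

end Grouplike

/-! ### Shuffling with `e₀`, and the antipode -/

section ShuffleAlgebra

theorem sh_comm (x z : Hsh) : sh x z = sh z x := by
  refine bilin_congr (F := sh) (G := sh.flip) (fun u v => ?_) x z
  rw [LinearMap.flip_apply, sh_mono, sh_mono]
  suffices h : ∀ (n : ℕ) (u v : List (Fin 2)), u.length + v.length ≤ n → shWord u v = shWord v u from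
    h _ u v le_rfl
  intro n
  induction n with
  | zero =>
    intro u v h
    obtain rfl : u = [] := List.length_eq_zero_iff.mp (by omega)
    obtain rfl : v = [] := List.length_eq_zero_iff.mp (by omega)
    rfl
  | succ n ih =>
    intro u v h
    rcases u with _ | ⟨a, u⟩ <;> rcases v with _ | ⟨b, v⟩
    · rfl
    · simp [shWord]
    · simp [shWord]
    · simp only [List.length_cons] at h
      rw [shWord, shWord, ih u _ (by simp only [List.length_cons]; omega),
        ih _ v (by simp only [List.length_cons]; omega), add_comm]

/-- The shuffle product with the letter `e₀`. -/
noncomputable def dsh : Hsh →ₗ[ℚ] Hsh := sh (mono [0])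

theorem dsh_one : dsh 1 = mono [0] := sh_one_right _

theorem dsh_letter_mul (b : Fin 2) (z : Hsh) :
    dsh (mono [b] * z) = mono [0] * (mono [b] * z) + mono [b] * dsh z := by
  have := sh_letter_mul 0 b 1 z
  rwa [mul_one, sh_one_left] at this

theorem dsh_mul (x z : Hsh) : dsh (x * z) = dsh x * z + x * dsh z - x * mono [0] * z := by
  refine linMap_congr (F := dsh ∘ₗ LinearMap.mulRight ℚ z)
    (G := LinearMap.mulRight ℚ z ∘ₗ dsh + LinearMap.mulRight ℚ (dsh z) -
      LinearMap.mulRight ℚ z ∘ₗ LinearMap.mulRight ℚ (mono [0])) (fun w => ?_) x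
  simp only [LinearMap.comp_apply, LinearMap.add_apply, LinearMap.sub_apply,
    LinearMap.mulRight_apply]
  induction w with
  | nil => rw [mono_nil, one_mul, dsh_one, one_mul, one_mul]; abel
  | cons a w ih =>
    rw [mono_cons, mul_assoc, dsh_letter_mul, ih, dsh_letter_mul]
    simp only [mul_add, add_mul, mul_sub, mul_assoc]
    abel

/-- Shuffling with `e₀` is a derivation up to a correction term, which disappears when the product
with `e₀` on the right is removed. -/
noncomputable def dshR : Hsh →ₗ[ℚ] Hsh := dsh - LinearMap.mulRight ℚ (mono [0])

theorem dshR_apply (x : Hsh) : dshR x = dsh x - x * mono [0] := rfl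

theorem dshR_mul (x z : Hsh) : dshR (x * z) = dshR x * z + x * dshR z := by
  simp only [dshR_apply, dsh_mul, sub_mul, mul_sub, mul_assoc]
  abel

theorem dsh_sh (x z : Hsh) : dsh (sh x z) = sh (dsh x) z := by
  refine bilin_congr (F := sh.compr₂ dsh) (G := sh ∘ₗ dsh) (fun u v => ?_) x z
  simp only [LinearMap.compr₂_apply, LinearMap.comp_apply]
  suffices h : ∀ (n : ℕ) (u v : List (Fin 2)), u.length + v.length ≤ n →
      dsh (sh (mono u) (mono v)) = sh (dsh (mono u)) (mono v) from h _ u v le_rfl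
  intro n
  induction n with
  | zero =>
    intro u v h
    obtain rfl : v = [] := List.length_eq_zero_iff.mp (by omega)
    rw [mono_nil, sh_one_right, sh_one_right]
  | succ n ih =>
    intro u v h
    rcases u with _ | ⟨a, u⟩
    · rw [mono_nil, sh_one_left, dsh_one, dsh]
    rcases v with _ | ⟨b, v⟩
    · rw [mono_nil, sh_one_right, sh_one_right]
    simp only [List.length_cons] at h
    have h1 := ih u (b :: v) (by simp only [List.length_cons]; omega)
    have h2 := ih (a :: u) v (by simp only [List.length_cons]; omega)
    rw [mono_cons a] at h2 ⊢
    rw [mono_cons b] at h1 ⊢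
    rw [sh_letter_mul, map_add, dsh_letter_mul, dsh_letter_mul, h1, h2, dsh_letter_mul]
    simp only [map_add, LinearMap.add_apply, sh_letter_mul, mul_add]
    abel

theorem dsh_sh_right (x z : Hsh) : dsh (sh x z) = sh x (dsh z) := by
  rw [sh_comm, dsh_sh, sh_comm]

/-- The antipode `e_{i_1} ⋯ e_{i_n} ↦ (-1)^n e_{i_n} ⋯ e_{i_1}`. -/
noncomputable def antipode : Hsh →ₗ[ℚ] Hsh :=
  linExt fun w => (-1 : ℚ) ^ w.length • mono w.reverse

theorem antipode_mono (w : List (Fin 2)) :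
    antipode (mono w) = (-1 : ℚ) ^ w.length • mono w.reverse := linExt_mono _ _

theorem antipode_one : antipode 1 = 1 := by
  rw [← mono_nil, antipode_mono]; simp

theorem antipode_letter_mul (a : Fin 2) (x : Hsh) :
    antipode (mono [a] * x) = -(antipode x * mono [a]) := by
  refine linMap_congr (F := antipode ∘ₗ LinearMap.mulLeft ℚ (mono [a]))
    (G := -(LinearMap.mulRight ℚ (mono [a]) ∘ₗ antipode)) (fun w => ?_) x
  simp [mono_mul_mono, antipode_mono, pow_succ]

theorem antipode_dsh (x : Hsh) : antipode (dsh x) = -dsh (antipode x) := by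
  refine linMap_congr (F := antipode ∘ₗ dsh) (G := -(dsh ∘ₗ antipode)) (fun w => ?_) x
  simp only [LinearMap.comp_apply, LinearMap.neg_apply]
  induction w with
  | nil =>
    have := antipode_letter_mul 0 1
    rw [mul_one, antipode_one, one_mul] at this
    rw [mono_nil, dsh_one, this, antipode_one, dsh_one]
  | cons a w ih =>
    have h : dsh (mono [a]) = mono [0] * mono [a] + mono [a] * mono [0] := by
      have := dsh_letter_mul a 1
      rwa [dsh_one, mul_one] at this
    rw [mono_cons, dsh_letter_mul, map_add, antipode_letter_mul, antipode_letter_mul,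
      antipode_letter_mul, ih, map_neg, dsh_mul, h]
    simp only [mul_add, neg_mul, mul_assoc]
    abel

end ShuffleAlgebra

/-! ### The embedding of the letters `y_s` -/

section Phi

theorem phi_mono (w : List ℕ+) : phi (mono w) = mono (toLetters w) := linExt_mono _ _

theorem phi_one : phi 1 = 1 := phi_mono []

theorem toLetters_cons (s : ℕ+) (w : List ℕ+) :
    toLetters (s :: w) = List.replicate ((s : ℕ) - 1) 0 ++ 1 :: toLetters w := by
  simp [toLetters]

theorem toLetters_append (u v : List ℕ+) : toLetters (u ++ v) = toLetters u ++ toLetters v := by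
  simp [toLetters]

theorem phi_mul (x z : Hst) : phi (x * z) = phi x * phi z := by
  refine bilin_congr (F := (LinearMap.mul ℚ Hst).compr₂ phi)
    (G := (LinearMap.mul ℚ Hsh).compl₁₂ phi phi) (fun u v => ?_) x z
  simp [mono_mul_mono, phi_mono, toLetters_append]

theorem phi_y (s : ℕ+) : phi (y s) = mono (List.replicate ((s : ℕ) - 1) 0) * mono [1] := by
  rw [y, phi_mono, mono_mul_mono]; simp [toLetters]

theorem dshR_one : dshR 1 = 0 := by rw [dshR_apply, dsh_one, one_mul, sub_self]

theorem dshR_e0_pow (n : ℕ) :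
    dshR (mono (List.replicate n 0)) = (n : ℚ) • mono (List.replicate (n + 1) 0) := by
  induction n with
  | zero => rw [List.replicate_zero, mono_nil, dshR_one]; simp
  | succ n ih =>
    have h0 : dshR (mono [0]) = mono [0] * mono [0] := by
      have := dsh_letter_mul 0 1
      rw [dsh_one, mul_one] at this
      rw [dshR_apply, this]; abel
    have e : ∀ n, (mono (0 :: List.replicate n 0) : Hsh) = mono [0] * mono (List.replicate n 0) :=
      fun n => mono_cons _ _
    rw [List.replicate_succ, e, dshR_mul, h0, ih, mul_smul_comm, ← e, mul_assoc, ← e,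
      ← List.replicate_succ, List.replicate_succ (n := n + 1), e, Nat.cast_succ, add_smul, one_smul,
      add_comm]

theorem dshR_e1 : dshR (mono [1]) = mono [0] * mono [1] := by
  have := dsh_letter_mul 1 1
  rw [dsh_one, mul_one] at this
  rw [dshR_apply, this]; abel

theorem e0_pow_succ' (n : ℕ) :
    (mono (List.replicate (n + 1) 0) : Hsh) = mono (List.replicate n 0) * mono [0] := by
  rw [mono_mul_mono, List.replicate_succ']

theorem dshR_e0_pow_e1 (n : ℕ) :
    dshR (mono (List.replicate n 0) * mono [1]) =
      ((n + 1 : ℕ) : ℚ) • (mono (List.replicate (n + 1) 0) * mono [1]) := by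
  rw [dshR_mul, dshR_e0_pow, dshR_e1, ← mul_assoc, ← e0_pow_succ', smul_mul_assoc, Nat.cast_succ,
    add_smul, one_smul]

theorem phi_dst (x : Hst) : phi (dst x) = dshR (phi x) := by
  refine linMap_congr (F := phi ∘ₗ dst) (G := dshR ∘ₗ phi) (fun w => ?_) x
  simp only [LinearMap.comp_apply]
  induction w with
  | nil => rw [mono_nil, dst_one, phi_one, dshR_one, map_zero]
  | cons a w ih =>
    have e : mono (a :: w) = y a * mono w := mono_cons a w
    have h : ((a : ℕ) - 1) + 1 = a := by have := a.pos; omega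
    have h' : ((a + 1 : ℕ+) : ℕ) - 1 = a := by simp
    rw [e, dst_letter_mul, map_add, map_smul, phi_mul, phi_mul, phi_mul, dshR_mul, ih, phi_y, phi_y,
      dshR_e0_pow_e1, h, h', smul_mul_assoc]

theorem dsh_eq (x : Hsh) : dsh x = dshR x + x * mono [0] := by rw [dshR_apply]; abel

theorem dsh_phi_mul_e0_pow (x : Hst) (n : ℕ) :
    dsh (phi x * mono (List.replicate n 0)) = phi (dst x) * mono (List.replicate n 0) +
      ((n + 1 : ℕ) : ℚ) • (phi x * mono (List.replicate (n + 1) 0)) := by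
  rw [dsh_eq, dshR_mul, phi_dst, dshR_e0_pow, mul_assoc, ← e0_pow_succ', mul_smul_comm,
    Nat.cast_succ, add_smul, one_smul, add_assoc]

/-- Every word is `w e₀^n` for a word `w` in the letters `y_s`. -/
theorem exists_eq_toLetters_append (u : List (Fin 2)) :
    ∃ w n, u = toLetters w ++ List.replicate n 0 := by
  induction u with
  | nil => exact ⟨[], 0, rfl⟩
  | cons a u ih =>
    obtain ⟨w, n, rfl⟩ := ih
    fin_cases a
    · rcases w with _ | ⟨s, w⟩
      · exact ⟨[], n + 1, rfl⟩
      · refine ⟨(s + 1) :: w, n, ?_⟩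
        have h : ((s + 1 : ℕ+) : ℕ) - 1 = (s - 1) + 1 := by have := s.pos; simp; omega
        rw [toLetters_cons, toLetters_cons, h, List.replicate_succ]
        rfl
    · exact ⟨1 :: w, n, by rw [toLetters_cons]; rfl⟩

/-- The space `ℚ⟨e₀, e₁⟩` is spanned by the shuffles of powers of `e₀` with words in the `y_s`. -/
theorem span_dpow_dsh_phi :
    Submodule.span ℚ (Set.range fun p : ℕ × Hst => dpow dsh p.1 (phi p.2)) = ⊤ := by
  set Sp := Submodule.span ℚ (Set.range fun p : ℕ × Hst => dpow dsh p.1 (phi p.2)) with hSp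
  have hd : ∀ x ∈ Sp, dsh x ∈ Sp := by
    intro x hx
    induction hx using Submodule.span_induction with
    | mem x h =>
      obtain ⟨⟨n, x⟩, rfl⟩ := h
      rw [← dpow_succ]
      exact Sp.smul_mem _ (Submodule.subset_span ⟨(n + 1, x), rfl⟩)
    | zero => rw [map_zero]; exact Sp.zero_mem
    | add x z _ _ hx hz => rw [map_add]; exact Sp.add_mem hx hz
    | smul c x _ hx => rw [map_smul]; exact Sp.smul_mem _ hx
  have key : ∀ (n : ℕ) (x : Hst), phi x * mono (List.replicate n 0) ∈ Sp := by
    intro n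
    induction n with
    | zero =>
      intro x
      rw [List.replicate_zero, mono_nil, mul_one]
      exact Submodule.subset_span ⟨(0, x), dpow_zero _ _⟩
    | succ n ih =>
      intro x
      have h := dsh_phi_mul_e0_pow x n
      have h0 : ((n + 1 : ℕ) : ℚ) ≠ 0 := by positivity
      rw [← inv_smul_smul₀ h0 (phi x * mono (List.replicate (n + 1) 0)),
        ← sub_eq_iff_eq_add'.mpr h]
      exact Sp.smul_mem _ (Sp.sub_mem (hd _ (ih x)) (ih _))
  rw [eq_top_iff]
  intro x _
  induction x using MonoidAlgebra.induction_linear with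
  | zero => exact Sp.zero_mem
  | add x z hx hz => exact Sp.add_mem (hx trivial) (hz trivial)
  | single w r =>
    have e : (MonoidAlgebra.single w r : Hsh) = r • mono (FreeMonoid.toList w) := by
      simp [mono, MonoidAlgebra.smul_single]
    obtain ⟨u, n, hu⟩ := exists_eq_toLetters_append (FreeMonoid.toList w)
    rw [e, hu, ← mono_mul_mono, ← phi_mono]
    exact Sp.smul_mem _ (key n _)

end Phi

/-! ### The anti-morphism `inv ∘ ι_{*,T}` -/

section Itilde

theorem inv_mono (w : List ℕ+) : inv (mono w) = ((-1 : ℚ) ^ weight w) • mono w.reverse :=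
  linExt_mono _ _

theorem inv_one : inv 1 = 1 := by
  rw [← mono_nil, inv_mono, weight_eq]; simp

theorem inv_mul (x z : Hst) : inv (x * z) = inv z * inv x := by
  refine bilin_congr (F := (LinearMap.mul ℚ Hst).compr₂ inv)
    (G := (LinearMap.mul ℚ Hst).flip.compl₁₂ inv inv) (fun u v => ?_) x z
  simp [mono_mul_mono, inv_mono, weight_eq, smul_smul, pow_add, mul_comm]

theorem inv_y (s : ℕ+) : inv (y s) = (-1 : ℚ) ^ (s : ℕ) • y s := by
  rw [y, inv_mono, weight_eq]; simp

theorem inv_dst (x : Hst) : inv (dst x) = -dst (inv x) := by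
  refine linMap_congr (F := inv ∘ₗ dst) (G := -(dst ∘ₗ inv)) (fun w => ?_) x
  simp only [LinearMap.comp_apply, LinearMap.neg_apply]
  induction w with
  | nil => rw [mono_nil, dst_one, inv_one, dst_one, map_zero, neg_zero]
  | cons a w ih =>
    have e : mono (a :: w) = y a * mono w := mono_cons a w
    rw [e, dst_letter_mul, map_add, map_smul, inv_mul, inv_mul, inv_mul, ih, dst_mul, inv_y, inv_y,
      map_smul, dst_y, PNat.add_coe, PNat.one_coe, pow_succ]
    simp only [mul_smul_comm, smul_smul, neg_mul, mul_neg, mul_one, neg_smul, neg_add, smul_neg]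
    rw [mul_comm, add_comm]

theorem dpow_neg {V : Type*} [AddCommGroup V] [Module ℚ V] (D : V →ₗ[ℚ] V) (n : ℕ) (x : V) :
    dpow (-D) n x = (-1 : ℚ) ^ n • dpow D n x := by
  have h := eq_dpow (-D) (fun n => (-1 : ℚ) ^ n • dpow D n x) (fun n => by
    rw [smul_comm, dpow_succ, pow_succ, LinearMap.neg_apply, map_smul, mul_neg_one, neg_smul]) n
  simpa [dpow_zero] using h.symm

/-- `inv ∘ ι_{*,T} = exp(T D) ∘ inv`. -/
theorem coeff_itilde (x : Hst) (n : ℕ) :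
    PowerSeries.coeff n (itilde x) = dpow dst n (inv x) := by
  rw [itilde, coeff_mapT, coeff_iota, map_smul,
    map_dpow (D' := -dst) inv (fun x => by rw [inv_dst, LinearMap.neg_apply]), dpow_neg, smul_smul,
    ← mul_pow]
  simp

theorem itilde_mul (x z : Hst) : itilde (x * z) = itilde z * itilde x := by
  ext n
  rw [coeff_itilde, inv_mul, PowerSeries.coeff_mul]
  have := dpow_leibniz (LinearMap.mul ℚ Hst) (D₁ := dst) (D₂ := dst) (D₃ := dst)
    (fun x z => by simp only [LinearMap.mul_apply', dst_mul]) n (inv z) (inv x)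
  simp only [LinearMap.mul_apply'] at this
  simp only [this, coeff_itilde]

theorem itilde_one : itilde 1 = 1 := by
  ext n
  have h0 : ∀ n, (dst ^ (n + 1)) 1 = 0 := fun n => by
    rw [pow_succ, Module.End.mul_apply, dst_one, map_zero]
  rw [coeff_itilde, inv_one, PowerSeries.coeff_one]
  cases n with
  | zero => rw [dpow_zero, if_pos rfl]
  | succ n => simp [dpow, h0]

theorem reverse_e1_cons_toLetters (w : List ℕ+) :
    (1 :: toLetters w).reverse = 1 :: toLetters w.reverse := by
  induction w with
  | nil => rfl
  | cons s w ih =>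
    have e : toLetters [s] = List.replicate ((s : ℕ) - 1) 0 ++ [1] := by simp [toLetters]
    rw [toLetters_cons, List.reverse_cons (as := w), toLetters_append, e,
      ← List.cons_append (as := toLetters w.reverse), ← ih]
    simp

theorem length_toLetters (w : List ℕ+) : (toLetters w).length = weight w := by
  rw [weight_eq]
  induction w with
  | nil => rfl
  | cons s w ih =>
    have := s.pos
    rw [toLetters_cons, List.map_cons, List.sum_cons, ← ih]
    simp only [List.length_append, List.length_replicate, List.length_cons]
    omega

theorem e1_mul_phi_inv (x : Hst) : mono [1] * phi (inv x) = antipode (phi x) * mono [1] := by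
  refine linMap_congr (F := LinearMap.mulLeft ℚ (mono [1]) ∘ₗ phi ∘ₗ inv)
    (G := LinearMap.mulRight ℚ (mono [1]) ∘ₗ antipode ∘ₗ phi) (fun w => ?_) x
  simp only [LinearMap.comp_apply, LinearMap.mulLeft_apply, LinearMap.mulRight_apply]
  rw [inv_mono, map_smul, phi_mono, phi_mono, antipode_mono, mul_smul_comm, smul_mul_assoc,
    mono_mul_mono, mono_mul_mono, length_toLetters]
  congr 2
  have := reverse_e1_cons_toLetters w
  rw [List.reverse_cons] at this
  exact this.symm

/-- The coefficient of `T ^ n` in `(1 - T e₀)⁻¹ e₁ ĩ_T(x)`, where `ĩ_T = inv ∘ ι_{*,T}`. -/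
theorem sum_e0_pow_e1_itilde (x : Hst) (n : ℕ) :
    ∑ ij ∈ antidiagonal n, mono (List.replicate ij.1 0) * mono [1] *
        phi (PowerSeries.coeff ij.2 (itilde x)) =
      (-1 : ℚ) ^ n • (antipode (dpow dsh n (phi x)) * mono [1]) := by
  have h1 : ∀ i, mono (List.replicate i 0) * mono [1] = dpow dshR i (mono [1]) := by
    intro i
    refine (eq_dpow dshR (fun i => mono (List.replicate i 0) * mono [1])
      (fun i => (dshR_e0_pow_e1 i).symm) i).trans ?_
    rw [List.replicate_zero, mono_nil, one_mul]
  have h2 : ∀ j, phi (PowerSeries.coeff j (itilde x)) = dpow dshR j (phi (inv x)) := fun j => by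
    rw [coeff_itilde, map_dpow (D' := dshR) phi phi_dst]
  have h3 := dpow_leibniz (LinearMap.mul ℚ Hsh) (D₁ := dshR) (D₂ := dshR) (D₃ := dshR)
    (fun x z => by simp only [LinearMap.mul_apply', dshR_mul]) n (mono [1]) (phi (inv x))
  simp only [LinearMap.mul_apply'] at h3
  have h4 : ∀ P : Hsh, dshR (P * mono [1]) = dsh P * mono [1] := fun P => by
    rw [dshR_mul, dshR_e1, dshR_apply, sub_mul, mul_assoc]; abel
  have h5 := map_dpow (D := dsh) (D' := dshR) (LinearMap.mulRight ℚ (mono [1]))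
    (fun P => (h4 P).symm) n (antipode (phi x))
  simp only [LinearMap.mulRight_apply] at h5
  simp only [h1, h2]
  rw [← h3, e1_mul_phi_inv, ← h5,
    map_dpow (D := dsh) (D' := -dsh) antipode (fun P => by
      rw [antipode_dsh, LinearMap.neg_apply]), dpow_neg, smul_mul_assoc, smul_smul, ← mul_pow]
  simp

end Itilde

/-! ### The conditions a), b) and c) -/

section Conditions

variable {R : Type*} [CommRing R] [Algebra ℚ R]

/-- The linear form `P ↦ ℓ(e₀^n e₁ P)`, the coefficient of `T ^ n` in `ℓ(ȷ_T(P))`. -/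
noncomputable def lam (ℓ : Hsh →ₗ[ℚ] R) (n : ℕ) : Hsh →ₗ[ℚ] R :=
  ℓ ∘ₗ LinearMap.mulLeft ℚ (mono (List.replicate n 0) * mono [1])

theorem lam_apply (ℓ : Hsh →ₗ[ℚ] R) (n : ℕ) (P : Hsh) :
    lam ℓ n P = ℓ (mono (List.replicate n 0) * mono [1] * P) := rfl

theorem coeff_evalT_jLie (h : Ser (Fin 2) R) (P : PowerSeries Hsh) (n : ℕ) :
    PowerSeries.coeff n (evalT h (jLie P)) =
      ∑ ij ∈ antidiagonal n, lam (linExt h) ij.1 (PowerSeries.coeff ij.2 P) := by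
  rw [coeff_evalT, jLie, PowerSeries.coeff_mul, map_sum]
  simp only [PowerSeries.coeff_mul_C, PowerSeries.coeff_mk, lam_apply]

/-- `∑_{i+j=n} a_i(P_j)`, for a sequence of linear forms `a_i` and a power series `P`. -/
noncomputable def conv {A : Type*} [Ring A] [Module ℚ A] (a : ℕ → A →ₗ[ℚ] R) (P : PowerSeries A)
    (n : ℕ) : R :=
  ∑ ij ∈ antidiagonal n, a ij.1 (PowerSeries.coeff ij.2 P)

theorem conv_C {A : Type*} [Ring A] [Module ℚ A] (a : ℕ → A →ₗ[ℚ] R) (x : A) (n : ℕ) :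
    conv a (PowerSeries.C x) n = a n x := by
  rw [conv, Finset.sum_eq_single (n, 0)]
  · simp
  · rintro ⟨i, j⟩ hij hne
    rw [PowerSeries.coeff_C, if_neg, map_zero]
    rintro rfl
    exact hne (by simpa using hij)
  · simp

theorem sum_antidiagonal_assoc {M : Type*} [AddCommMonoid M] (n : ℕ) (F : ℕ → ℕ → ℕ → M) :
    ∑ ij ∈ antidiagonal n, ∑ kl ∈ antidiagonal ij.1, F kl.1 kl.2 ij.2 =
      ∑ ij ∈ antidiagonal n, ∑ kl ∈ antidiagonal ij.2, F ij.1 kl.1 kl.2 := by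
  simp only [Finset.sum_sigma']
  apply Finset.sum_nbij' (fun x => ⟨(x.2.1, x.2.2 + x.1.2), (x.2.2, x.1.2)⟩)
    (fun x => ⟨(x.1.1 + x.2.1, x.2.2), (x.1.1, x.2.1)⟩)
  · rintro ⟨⟨i, j⟩, ⟨k, l⟩⟩ h
    simp only [mem_sigma, HasAntidiagonal.mem_antidiagonal] at h ⊢
    obtain ⟨rfl, rfl⟩ := h
    exact ⟨by ring, trivial⟩
  · rintro ⟨⟨i, j⟩, ⟨k, l⟩⟩ h
    simp only [mem_sigma, HasAntidiagonal.mem_antidiagonal] at h ⊢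
    obtain ⟨rfl, rfl⟩ := h
    exact ⟨by ring, trivial⟩
  · rintro ⟨⟨i, j⟩, ⟨k, l⟩⟩ h
    simp only [mem_sigma, HasAntidiagonal.mem_antidiagonal] at h
    obtain ⟨rfl, rfl⟩ := h
    rfl
  · rintro ⟨⟨i, j⟩, ⟨k, l⟩⟩ h
    simp only [mem_sigma, HasAntidiagonal.mem_antidiagonal] at h
    obtain ⟨rfl, rfl⟩ := h
    rfl
  · intros; rfl

/-- A relation between the values of two sequences of linear forms at constant series extends
`T`-linearly to all series. -/
theorem conv_eq_of_conv_C {A : Type*} [Ring A] [Algebra ℚ A] {a b : ℕ → A →ₗ[ℚ] R}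
    {X : PowerSeries A}
    (h : ∀ x n, conv a (PowerSeries.C x) n = conv b (X * PowerSeries.C x) n) (P : PowerSeries A)
    (n : ℕ) : conv a P n = conv b (X * P) n := by
  have e : ∀ i x, a i x = ∑ kl ∈ antidiagonal i, b kl.1 (PowerSeries.coeff kl.2 X * x) := by
    intro i x
    rw [← conv_C a x i, h, conv]
    simp only [PowerSeries.coeff_mul_C]
  simp only [conv, e, PowerSeries.coeff_mul, map_sum]
  exact sum_antidiagonal_assoc n fun k l j =>
    b k (PowerSeries.coeff l X * PowerSeries.coeff j P)

/-- The linear form `z ↦ ℓ(e₀^n e₁ (w ⧢ z))` on `ℚ⟨y⟩`. -/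
noncomputable def lamSh (ℓ : Hsh →ₗ[ℚ] R) (w : Hst) (n : ℕ) : Hst →ₗ[ℚ] R :=
  lam ℓ n ∘ₗ sh (phi w) ∘ₗ phi

theorem lamSh_apply (ℓ : Hsh →ₗ[ℚ] R) (w : Hst) (n : ℕ) (z : Hst) :
    lamSh ℓ w n z = lam ℓ n (sh (phi w) (phi z)) := rfl

/-- The instance of condition b) with first argument `u`, and with second argument `w`. -/
def RelB (ℓ : Hsh →ₗ[ℚ] R) (u w : Hst) : Prop :=
  ∀ z n, conv (lamSh ℓ (u * w)) (PowerSeries.C z) n =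
    conv (lamSh ℓ w) (itilde u * PowerSeries.C z) n

theorem relB_iff (h : Ser (Fin 2) R) (u w : Hst) :
    RelB (linExt h) u w ↔ ∀ w₂, evalT h (jLie (PowerSeries.C (sh (phi (u * w)) (phi w₂)) -
      mapT (sh (phi w)) (mapT phi (itilde u * PowerSeries.C w₂)))) = 0 := by
  refine forall_congr' fun z => ?_
  rw [PowerSeries.ext_iff]
  refine forall_congr' fun n => ?_
  rw [coeff_evalT_jLie, map_zero]
  simp only [map_sub, Finset.sum_sub_distrib, coeff_mapT]
  rw [sub_eq_zero, conv_C]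
  have := conv_C (lam (linExt h)) (sh (phi (u * w)) (phi z)) n
  rw [conv] at this
  rw [this]
  rfl

theorem condA_iff (h : Ser (Fin 2) R) : CondA h ↔ ∀ s w, RelB (linExt h) (y s) w := by
  simp only [relB_iff]; rfl

theorem condB_iff (h : Ser (Fin 2) R) : CondB h ↔ ∀ u w, RelB (linExt h) u w := by
  simp only [relB_iff]; rfl

theorem condC_iff (h : Ser (Fin 2) R) : CondC h ↔ ∀ u, RelB (linExt h) u 1 := by
  have e : mapT (sh (1 : Hsh)) = id := by
    funext P; ext n; rw [coeff_mapT, sh_one_left, id]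
  simp only [relB_iff, mul_one, phi_one, e, id]; rfl

theorem relB_of_condA {ℓ : Hsh →ₗ[ℚ] R} (h : ∀ s w, RelB ℓ (y s) w) (u w : Hst) :
    RelB ℓ u w := by
  intro z n
  have e : ∀ n, ∀ x : Hst, conv (lamSh ℓ w) (itilde x * PowerSeries.C z) n =
      ∑ ij ∈ antidiagonal n, lamSh ℓ w ij.1 (dpow dst ij.2 (inv x) * z) := fun n x => by
    simp only [conv, PowerSeries.coeff_mul_C, coeff_itilde]
  rw [e, conv_C]
  have key := linMap_congr
    (F := (lam ℓ n ∘ₗ sh.flip (phi z)) ∘ₗ phi ∘ₗ LinearMap.mulRight ℚ w)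
    (G := ∑ ij ∈ antidiagonal n,
      lamSh ℓ w ij.1 ∘ₗ LinearMap.mulRight ℚ z ∘ₗ dpow dst ij.2 ∘ₗ inv) (fun u => ?_) u
  · simpa [lamSh_apply] using key
  suffices H : ∀ z n, conv (lamSh ℓ (mono u * w)) (PowerSeries.C z) n =
      conv (lamSh ℓ w) (itilde (mono u) * PowerSeries.C z) n by
    have := H z n
    rw [e, conv_C, lamSh_apply] at this
    simpa using this
  induction u with
  | nil => intro z n; rw [mono_nil, one_mul, itilde_one, one_mul]
  | cons s u ih =>
    intro z n
    have e : mono (s :: u) = y s * mono u := mono_cons s u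
    rw [e, mul_assoc, h s (mono u * w) z n, conv_eq_of_conv_C ih, ← mul_assoc, ← itilde_mul]

theorem relB_of_condC {ℓ : Hsh →ₗ[ℚ] R} (h : ∀ u, RelB ℓ u 1) (u w : Hst) : RelB ℓ u w := by
  intro z n
  have e := fun x : Hst => conv_eq_of_conv_C (h x)
  have h1 := h (u * w) z n
  rw [mul_one, itilde_mul, mul_assoc, ← e w] at h1
  rw [h1, mul_one]

theorem condABC_tfae (h : Ser (Fin 2) R) : List.TFAE [CondA h, CondB h, CondC h] := by
  rw [condA_iff, condB_iff, condC_iff]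
  tfae_have 1 → 2 := relB_of_condA
  tfae_have 2 → 3 := fun H u => H u 1
  tfae_have 3 → 2 := relB_of_condC
  tfae_have 2 → 1 := fun H s w => H (y s) w
  tfae_finish

end Conditions

/-! ### Lie series and condition c) -/

section LieSeries

variable {R : Type*} [CommRing R] [Algebra ℚ R]

theorem IsLieSeries.sh_letter_mul {h : Ser (Fin 2) R} (hh : IsLieSeries h) (a b : Fin 2)
    (x z : Hsh) : linExt h (sh (mono [a] * x) (mono [b] * z)) = 0 := by
  refine bilin_congr (F := (sh.compl₁₂ (LinearMap.mulLeft ℚ (mono [a]))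
    (LinearMap.mulLeft ℚ (mono [b]))).compr₂ (linExt h)) (G := 0) (fun u v => ?_) x z
  have := hh (a :: u) (b :: v)
  rw [Ser.one, Ser.one, mul_zero, zero_mul, add_zero, coprodSh] at this
  simpa [mono_mul_mono] using this

theorem isLieSeries_of_sh_letter_mul {h : Ser (Fin 2) R} (h0 : h [] = 0)
    (hh : ∀ (a b : Fin 2) (u v : List (Fin 2)),
      linExt h (sh (mono (a :: u)) (mono (b :: v))) = 0) : IsLieSeries h := by
  intro u v
  rcases u with _ | ⟨a, u⟩
  · rw [coprodSh, mono_nil, sh_one_left, linExt_mono, h0, zero_mul, zero_add, Ser.one, one_mul]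
  rcases v with _ | ⟨b, v⟩
  · rw [coprodSh, mono_nil, sh_one_right, linExt_mono, h0, mul_zero, add_zero, Ser.one, mul_one]
  rw [coprodSh, hh, Ser.one, Ser.one, mul_zero, zero_mul, add_zero]

theorem IsLieSeries.dsh_eq_zero {h : Ser (Fin 2) R} (hh : IsLieSeries h) (a : Fin 2) (x : Hsh) :
    linExt h (dsh (mono [a] * x)) = 0 := by
  have := hh.sh_letter_mul 0 a 1 x
  rwa [mul_one] at this

theorem IsLieSeries.dsh_mul_e1_mul {h : Ser (Fin 2) R} (hh : IsLieSeries h) (x z : Hsh) :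
    linExt h (dsh (x * mono [1] * z)) = 0 := by
  refine linMap_congr (F := linExt h ∘ₗ dsh ∘ₗ LinearMap.mulRight ℚ z ∘ₗ
    LinearMap.mulRight ℚ (mono [1])) (G := 0) (fun u => ?_) x
  simp only [LinearMap.comp_apply, LinearMap.mulRight_apply, LinearMap.zero_apply]
  rcases u with _ | ⟨a, u⟩
  · rw [mono_nil, one_mul]; exact hh.dsh_eq_zero _ _
  · rw [mono_cons, mul_assoc, mul_assoc]; exact hh.dsh_eq_zero _ _

/-- For a Lie series `h`, a letter `a` and `x`, `z`: `h[a (x ⧢ z)] = h[S(x) a z]`. -/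
theorem IsLieSeries.letter_mul_sh {h : Ser (Fin 2) R} (hh : IsLieSeries h) (a : Fin 2)
    (x z : Hsh) : linExt h (mono [a] * sh x z) = linExt h (antipode x * mono [a] * z) := by
  refine linMap_congr (F := linExt h ∘ₗ LinearMap.mulLeft ℚ (mono [a]) ∘ₗ sh.flip z)
    (G := linExt h ∘ₗ LinearMap.mulRight ℚ z ∘ₗ LinearMap.mulRight ℚ (mono [a]) ∘ₗ antipode)
    (fun u => ?_) x
  simp only [LinearMap.comp_apply, LinearMap.mulRight_apply, LinearMap.mulLeft_apply,
    LinearMap.flip_apply]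
  induction u generalizing a z with
  | nil => rw [mono_nil, sh_one_left, antipode_one, one_mul]
  | cons b u ih =>
    have h1 := hh.sh_letter_mul b a (mono u) z
    rw [DShuffle.sh_letter_mul, map_add, ih] at h1
    rw [mono_cons b u, antipode_letter_mul, eq_neg_of_add_eq_zero_right h1, neg_mul, neg_mul, map_neg]
    simp only [mul_assoc]

/-- The defect `ℓ(e₁ (x ⧢ z)) - ℓ(S(x) e₁ z)`, as a bilinear form. -/
noncomputable def defect (ℓ : Hsh →ₗ[ℚ] R) : Hsh →ₗ[ℚ] Hsh →ₗ[ℚ] R :=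
  sh.compr₂ (ℓ ∘ₗ LinearMap.mulLeft ℚ (mono [1])) -
    ((LinearMap.mul ℚ Hsh) ∘ₗ LinearMap.mulRight ℚ (mono [1]) ∘ₗ antipode).compr₂ ℓ

theorem defect_apply (ℓ : Hsh →ₗ[ℚ] R) (x z : Hsh) :
    defect ℓ x z = ℓ (mono [1] * sh x z) - ℓ (antipode x * mono [1] * z) := rfl

variable {ℓ : Hsh →ₗ[ℚ] R}

/-- Moving the powers of `e₀` in front of `e₁` into the argument, by the vanishing on shuffles
with `e₀`. -/
theorem lam_eq (hℓ : ∀ x z, ℓ (dsh (x * mono [1] * z)) = 0) (n : ℕ) (x : Hsh) :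
    lam ℓ n x = (-1 : ℚ) ^ n • ℓ (mono [1] * dpow dsh n x) := by
  induction n generalizing x with
  | zero => rw [lam_apply, dpow_zero, List.replicate_zero, mono_nil, one_mul, pow_zero, one_smul]
  | succ n ih =>
    have h := hℓ (mono (List.replicate n 0)) x
    have e : dsh (mono (List.replicate n 0) * mono [1] * x) =
        ((n + 1 : ℕ) : ℚ) • (mono (List.replicate (n + 1) 0) * mono [1] * x) +
          mono (List.replicate n 0) * mono [1] * dsh x := by
      rw [dsh_mul, dsh_eq (mono (List.replicate n 0) * mono [1]), dshR_e0_pow_e1, add_mul,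
        smul_mul_assoc]
      abel
    rw [e, map_add, map_smul, ← lam_apply, ← lam_apply, ih, ← dpow_succ', mul_smul_comm, map_smul,
      smul_comm, ← smul_add] at h
    have h0 : ((n + 1 : ℕ) : ℚ) ≠ 0 := by positivity
    rw [eq_neg_of_add_eq_zero_left ((smul_eq_zero_iff_right h0).mp h), pow_succ, mul_neg_one,
      neg_smul]

/-- Shuffling with `e₀` is self-adjoint for the defect. -/
theorem defect_dsh (hℓ : ∀ x z, ℓ (dsh (x * mono [1] * z)) = 0) (x z : Hsh) :
    defect ℓ (dsh x) z = defect ℓ x (dsh z) := by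
  have h := hℓ (antipode x) z
  have e : dsh (antipode x * mono [1] * z) =
      dsh (antipode x) * mono [1] * z + antipode x * mono [1] * dsh z := by
    rw [dsh_mul, dsh_eq (antipode x * mono [1]), dshR_mul, dshR_e1, dshR_apply]
    simp only [add_mul, sub_mul, mul_assoc]
    abel
  rw [e, map_add] at h
  rw [defect_apply, defect_apply, ← dsh_sh, ← dsh_sh_right, antipode_dsh, neg_mul, neg_mul, map_neg,
    eq_neg_of_add_eq_zero_left h, neg_neg]

/-- Modulo shuffles with `e₀`, condition c) says that the defect vanishes. -/
theorem relB_one_iff_defect (hℓ : ∀ x z, ℓ (dsh (x * mono [1] * z)) = 0) :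
    (∀ u, RelB ℓ u 1) ↔ defect ℓ = 0 := by
  have e : ∀ u z n, conv (lamSh ℓ (u * 1)) (PowerSeries.C z) n -
      conv (lamSh ℓ 1) (itilde u * PowerSeries.C z) n =
        (-1 : ℚ) ^ n • defect ℓ (dpow dsh n (phi u)) (phi z) := by
    intro u z n
    have h1 : conv (lamSh ℓ 1) (itilde u * PowerSeries.C z) n =
        ℓ ((∑ ij ∈ antidiagonal n, mono (List.replicate ij.1 0) * mono [1] *
        phi (PowerSeries.coeff ij.2 (itilde u))) * phi z) := by
      rw [Finset.sum_mul, map_sum, conv]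
      refine Finset.sum_congr rfl fun ij _ => ?_
      rw [lamSh_apply, phi_one, sh_one_left, lam_apply, PowerSeries.coeff_mul_C, phi_mul,
        mul_assoc _ (phi _) (phi z)]
    have h2 := map_dpow (D := dsh) (D' := dsh) (sh.flip (phi z))
      (fun x => (dsh_sh x (phi z)).symm) n (phi u)
    simp only [LinearMap.flip_apply] at h2
    rw [h1, sum_e0_pow_e1_itilde, conv_C, lamSh_apply, lam_eq hℓ, mul_one, ← h2, smul_mul_assoc,
      map_smul, defect_apply, smul_sub]
  have e' : (∀ u, RelB ℓ u 1) ↔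
      ∀ u z n, defect ℓ (dpow dsh n (phi u)) (phi z) = 0 := by
    refine forall_congr' fun u => forall_congr' fun z => forall_congr' fun n => ?_
    rw [← sub_eq_zero, e, smul_eq_zero_iff_right (pow_ne_zero n (by norm_num))]
  rw [e']
  constructor
  · intro h
    -- every word is a combination of iterated shuffles of `e₀` with words in the letters `y_s`,
    -- and the shuffles in the second argument can be moved to the first one
    have h' : ∀ m n u z, defect ℓ (dpow dsh n (phi u)) (dpow dsh m (phi z)) = 0 := by
      intro m
      induction m with
      | zero => intro n u z; rw [dpow_zero, h]
      | succ m ih =>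
        intro n u z
        have h0 : ((m + 1 : ℕ) : ℚ) ≠ 0 := by positivity
        refine (smul_eq_zero_iff_right h0).mp ?_
        rw [← map_smul, dpow_succ, ← defect_dsh hℓ, ← dpow_succ, map_smul, LinearMap.smul_apply, ih,
          smul_zero]
    refine LinearMap.ext_on_range span_dpow_dsh_phi fun p => ?_
    exact LinearMap.ext_on_range span_dpow_dsh_phi fun q => h' q.1 p.1 p.2 q.2
  · intro h u z n
    rw [h]; rfl

theorem IsLieSeries.relB {h : Ser (Fin 2) R} (hh : IsLieSeries h) (u : Hst) :
    RelB (linExt h) u 1 := by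
  refine (relB_one_iff_defect hh.dsh_mul_e1_mul).mpr ?_ u
  refine LinearMap.ext fun x => LinearMap.ext fun z => ?_
  rw [defect_apply, hh.letter_mul_sh, sub_self]
  rfl

theorem IsLieSeries.condC {h : Ser (Fin 2) R} (hh : IsLieSeries h) : CondC h :=
  (condC_iff h).mpr hh.relB

/-- The reflection symmetry of Lie series: both sides are `h[ȷ_T(w ⧢ w₂)]`. -/
theorem IsLieSeries.evalT_jLie_itilde_comm {h : Ser (Fin 2) R} (hh : IsLieSeries h) (w w₂ : Hst) :
    evalT h (jLie (mapT phi (itilde w₂ * PowerSeries.C w))) =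
      evalT h (jLie (mapT phi (itilde w * PowerSeries.C w₂))) := by
  have key : ∀ w w₂ : Hst, ∀ n, PowerSeries.coeff n
      (evalT h (jLie (mapT phi (itilde w * PowerSeries.C w₂)))) =
      lam (linExt h) n (sh (phi w) (phi w₂)) := by
    intro w w₂ n
    have h1 := hh.relB w w₂ n
    rw [conv_C, mul_one, lamSh_apply] at h1
    rw [h1, coeff_evalT_jLie, conv]
    refine Finset.sum_congr rfl fun ij _ => ?_
    rw [lamSh_apply, phi_one, sh_one_left, coeff_mapT]
  ext n
  rw [key, key, sh_comm]

/-- A series without constant term that vanishes on shuffles with `e₀` and satisfies condition c)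
is a Lie series. -/
theorem isLieSeries_of_relB {h : Ser (Fin 2) R} (h0 : h [] = 0)
    (hd : ∀ x, linExt h (dsh x) = 0) (hB : ∀ u, RelB (linExt h) u 1) : IsLieSeries h := by
  have hM := (relB_one_iff_defect fun x z => hd (x * mono [1] * z)).mp hB
  have hdef : ∀ x z, linExt h (mono [1] * sh x z) = linExt h (antipode x * mono [1] * z) := by
    intro x z
    have := LinearMap.congr_fun (LinearMap.congr_fun hM x) z
    rw [defect_apply] at this
    exact sub_eq_zero.mp this
  -- the two terms of the recursion of the shuffle product cancel, as `S(e₁ x) = -S(x) e₁`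
  have base : ∀ x z, linExt h (sh (mono [1] * x) (mono [1] * z)) = 0 := by
    intro x z
    rw [sh_letter_mul, map_add, hdef, hdef, antipode_letter_mul, neg_mul, neg_mul, map_neg,
      mul_assoc _ (mono [1]) (mono [1] * z), mul_assoc _ (mono [1]) z, mul_assoc (antipode x),
      add_neg_cancel]
  -- `(n+1) e₀^{n+1} e₁ x = e₀ ⧢ (e₀^n e₁ x) - e₀^n e₁ (e₀ ⧢ x)`, and `h` vanishes on
  -- `e₀ ⧢ V ⧢ W` for all `V` and `W`
  have raise : ∀ (W : Hsh), (∀ x, linExt h (sh (mono [1] * x) W) = 0) →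
      ∀ n x, linExt h (sh (mono (List.replicate n 0) * mono [1] * x) W) = 0 := by
    intro W hW n
    induction n with
    | zero => intro x; rw [List.replicate_zero, mono_nil, one_mul]; exact hW x
    | succ n ih =>
      intro x
      have e : dsh (mono (List.replicate n 0) * mono [1] * x) =
          ((n + 1 : ℕ) : ℚ) • (mono (List.replicate (n + 1) 0) * mono [1] * x) +
            mono (List.replicate n 0) * mono [1] * dsh x := by
        rw [dsh_mul, dsh_eq (mono (List.replicate n 0) * mono [1]), dshR_e0_pow_e1, add_mul,
          smul_mul_assoc]
        abel
      have h1 := hd (sh (mono (List.replicate n 0) * mono [1] * x) W)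
      rw [dsh_sh, e, map_add, LinearMap.add_apply, map_add, ih, add_zero, map_smul,
        LinearMap.smul_apply, map_smul] at h1
      have h0 : ((n + 1 : ℕ) : ℚ) ≠ 0 := by positivity
      exact (smul_eq_zero_iff_right h0).mp h1
  have e0pow : ∀ n (W : Hsh), linExt h (sh (mono (List.replicate (n + 1) 0)) W) = 0 := by
    intro n W
    have e : dsh (mono (List.replicate n 0)) =
        ((n + 1 : ℕ) : ℚ) • mono (List.replicate (n + 1) 0) := by
      rw [dsh_eq, dshR_e0_pow, ← e0_pow_succ', Nat.cast_succ, add_smul, one_smul]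
    have h1 := hd (sh (mono (List.replicate n 0)) W)
    rw [dsh_sh, e, map_smul, LinearMap.smul_apply, map_smul] at h1
    have h0 : ((n + 1 : ℕ) : ℚ) ≠ 0 := by positivity
    exact (smul_eq_zero_iff_right h0).mp h1
  have full : ∀ m n x z, linExt h (sh (mono (List.replicate m 0) * mono [1] * x)
      (mono (List.replicate n 0) * mono [1] * z)) = 0 := by
    intro m n x z
    refine raise _ (fun x => ?_) m x
    rw [sh_comm]
    exact raise _ (fun z => by rw [sh_comm]; exact base x z) n z
  have shape : ∀ (a : Fin 2) (u : List (Fin 2)), (∃ n, a :: u = List.replicate (n + 1) 0) ∨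
      ∃ n v, mono (a :: u) = mono (List.replicate n 0) * mono [1] * mono v := by
    intro a u
    induction u generalizing a with
    | nil =>
      fin_cases a
      · exact Or.inl ⟨0, rfl⟩
      · exact Or.inr ⟨0, [], by rw [List.replicate_zero, mono_nil, one_mul, mul_one]; rfl⟩
    | cons b u ih =>
      fin_cases a
      · rcases ih b with ⟨n, hn⟩ | ⟨n, v, hn⟩
        · exact Or.inl ⟨n + 1, by rw [hn]; rfl⟩
        · refine Or.inr ⟨n + 1, v, ?_⟩
          rw [mono_cons _ (b :: u), hn, List.replicate_succ, mono_cons 0 (List.replicate n 0)]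
          simp only [mul_assoc]
          rfl
      · exact Or.inr ⟨0, b :: u, by rw [List.replicate_zero, mono_nil, one_mul, mono_cons _ (b :: u)]; rfl⟩
  refine isLieSeries_of_sh_letter_mul h0 fun a b u v => ?_
  rcases shape a u with ⟨m, hm⟩ | ⟨m, u', hm⟩
  · rw [hm]; exact e0pow _ _
  rcases shape b v with ⟨n, hn⟩ | ⟨n, v', hn⟩
  · rw [hn, sh_comm]; exact e0pow _ _
  rw [hm, hn]
  exact full _ _ _ _

end LieSeries

/-! ### The regularization with respect to the letter e₀ -/

section Regularization

variable {R : Type*} [CommRing R] [Algebra ℚ R]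

/-- Vanishing on shuffles with `e₀` expresses the values of `h` at all words through its values at
the words in the letters `y_s`: the words ending with `e₀` are removed by `exp(-T D)`. -/
theorem forall_dsh_eq_zero_iff (h : Ser (Fin 2) R) :
    (∀ v, linExt h (dsh v) = 0) ↔ ∀ (x : Hst) (n : ℕ),
      linExt h (phi x * mono (List.replicate n 0)) =
        linExt h (phi (PowerSeries.coeff n (iota x))) := by
  have hn : ∀ n : ℕ, ((n + 1 : ℕ) : ℚ) ≠ 0 := fun n => by positivity
  constructor
  · intro hZ x n
    rw [coeff_iota]
    induction n generalizing x with
    | zero => rw [List.replicate_zero, mono_nil, mul_one, pow_zero, one_smul, dpow_zero]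
    | succ n ih =>
      have h1 := hZ (phi x * mono (List.replicate n 0))
      rw [dsh_phi_mul_e0_pow, map_add, ih, ← dpow_succ', map_smul] at h1
      refine smul_right_injective R (hn n) ?_
      simp only [map_smul, pow_succ] at h1 ⊢
      linear_combination (norm := module) h1
  · intro hS
    refine fun v => linMap_congr (F := linExt h ∘ₗ dsh) (G := 0) (fun u => ?_) v
    obtain ⟨w, n, rfl⟩ := exists_eq_toLetters_append u
    rw [LinearMap.comp_apply, ← mono_mul_mono, ← phi_mono, dsh_phi_mul_e0_pow, map_add, map_smul,
      hS, hS, coeff_iota, coeff_iota, ← dpow_succ']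
    simp only [map_smul, pow_succ, LinearMap.zero_apply]
    module

/-- The multi-degrees that involve only the variables `U_i` and `T`. -/
theorem eq_single_add_single_iff {d : ℕ} (i : Fin d) (m : Option (Fin d) →₀ ℕ) :
    (∀ j, j ≠ i → m (some j) = 0) ↔
      m = Finsupp.single (some i) (m (some i)) + Finsupp.single none (m none) := by
  constructor
  · intro h
    ext j
    rcases j with _ | j
    · simp
    · by_cases hj : j = i
      · subst hj; simp
      · simp [h j hj, Ne.symm hj]
  · intro h j hj
    rw [h]
    simp [Ne.symm hj]

theorem single_add_single_eq_iff {d : ℕ} (i : Fin d) (m : Option (Fin d) →₀ ℕ) (a b : ℕ) :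
    m = Finsupp.single (some i) a + Finsupp.single none b ↔
      (∀ j, j ≠ i → m (some j) = 0) ∧ m (some i) = a ∧ m none = b := by
  constructor
  · rintro rfl
    refine ⟨fun j hj => by simp [Ne.symm hj], by simp, by simp⟩
  · rintro ⟨h, rfl, rfl⟩
    exact (eq_single_add_single_iff i m).mp h

theorem degree_eq_of_forall {d : ℕ} {i : Fin d} {m : Option (Fin d) →₀ ℕ}
    (h : ∀ j, j ≠ i → m (some j) = 0) : m.degree = m (some i) + m none := by
  conv_lhs => rw [(eq_single_add_single_iff i m).mp h]
  rw [map_add, Finsupp.degree_single, Finsupp.degree_single]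

/-- The factor of the products in the regularization relation attached to the variable `U_i`, in
terms of the series `κ s` in `T` obtained at `U_i = 0`. -/
def IsFactor {d : ℕ} (κ : ℕ+ → PowerSeries Hst) (s : ℕ+) (i : Fin d)
    (g : MvPowerSeries (Option (Fin d)) Hsh) : Prop :=
  ∀ m, MvPowerSeries.coeff m g = if ∀ j, j ≠ i → m (some j) = 0 then
    (Nat.choose (m (some i) + s - 1) (m (some i)) : ℚ) •
      phi (PowerSeries.coeff (m none) (κ (shiftIdx s (m (some i))))) else 0

theorem isFactor_X {d : ℕ} (s : ℕ+) (i : Fin d) :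
    IsFactor (fun s => PowerSeries.C (y s)) s i
      (frac s (MvPowerSeries.X (some i)) * MvPowerSeries.C (mono [1])) := by
  classical
  intro m
  rw [MvPowerSeries.coeff_mul_C]
  change (∑ l ∈ range (m.degree + 1), _) * _ = _
  split_ifs with h
  · rw [PowerSeries.coeff_C]
    split_ifs with h0
    · rw [Finset.sum_eq_single (m (some i))]
      · rw [MvPowerSeries.coeff_X_pow, if_pos, mul_one, phi_y, smul_mul_assoc]
        · congr 4
          simp only [shiftIdx, PNat.mk_coe]
          have := s.pos
          omega
        · conv_lhs => rw [(eq_single_add_single_iff i m).mp h, h0]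
          simp
      · intro l _ hl
        rw [MvPowerSeries.coeff_X_pow, if_neg, mul_zero, zero_smul]
        intro e
        exact hl (by rw [e]; simp)
      · intro hm
        rw [degree_eq_of_forall h] at hm
        simp at hm
    · rw [map_zero, smul_zero, Finset.sum_eq_zero, zero_mul]
      intro l _
      rw [MvPowerSeries.coeff_X_pow, if_neg, mul_zero, zero_smul]
      intro e
      exact h0 (by rw [e]; simp)
  · rw [Finset.sum_eq_zero, zero_mul]
    intro l _
    rw [MvPowerSeries.coeff_X_pow, if_neg, mul_zero, zero_smul]
    intro e
    refine h fun j hj => ?_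
    rw [e]
    simp [Ne.symm hj]

theorem coeff_X_sub_X_pow {d : ℕ} (i : Fin d) (l : ℕ) (m : Option (Fin d) →₀ ℕ) :
    MvPowerSeries.coeff m ((MvPowerSeries.X (some i) -
      MvPowerSeries.X (none : Option (Fin d)) : MvPowerSeries (Option (Fin d)) ℚ) ^ l) =
      if (∀ j, j ≠ i → m (some j) = 0) ∧ m (some i) + m none = l then
        (-1 : ℚ) ^ m none * (Nat.choose l (m (some i)) : ℚ) else 0 := by
  classical
  have e : ∀ k q : ℕ, MvPowerSeries.coeff m ((MvPowerSeries.X (some i) :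
      MvPowerSeries (Option (Fin d)) ℚ) ^ k * (-MvPowerSeries.X none) ^ q * ((Nat.choose l k : ℕ) : MvPowerSeries (Option (Fin d)) ℚ)) =
      if (∀ j, j ≠ i → m (some j) = 0) ∧ m (some i) = k ∧ m none = q then
        (-1 : ℚ) ^ q * (Nat.choose l k : ℚ) else 0 := by
    intro k q
    have e1 : (MvPowerSeries.X (some i) : MvPowerSeries (Option (Fin d)) ℚ) ^ k *
        (-MvPowerSeries.X none) ^ q * ((Nat.choose l k : ℕ) : MvPowerSeries (Option (Fin d)) ℚ) =
        MvPowerSeries.monomial (Finsupp.single (some i) k + Finsupp.single none q)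
          ((-1 : ℚ) ^ q * (Nat.choose l k : ℚ)) := by
      have e2 : MvPowerSeries.monomial
          (Finsupp.single (some i) k + Finsupp.single (none : Option (Fin d)) q)
            ((-1 : ℚ) ^ q * (Nat.choose l k : ℚ)) =
          MvPowerSeries.C ((-1 : ℚ) ^ q * (Nat.choose l k : ℚ)) *
            (MvPowerSeries.X (some i) ^ k * MvPowerSeries.X none ^ q) := by
        rw [MvPowerSeries.X_pow_eq, MvPowerSeries.X_pow_eq, MvPowerSeries.monomial_mul_monomial,
          ← MvPowerSeries.smul_eq_C_mul, ← map_smul, smul_eq_mul, one_mul, mul_one]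
      rw [e2, neg_pow, map_mul, map_pow, map_neg, map_one, map_natCast]
      ring
    rw [e1, MvPowerSeries.coeff_monomial, if_congr (single_add_single_eq_iff i m k q) rfl rfl]
  rw [sub_eq_add_neg, add_pow, map_sum]
  simp only [e]
  split_ifs with h
  · rw [Finset.sum_eq_single (m (some i))]
    · rw [if_pos ⟨h.1, rfl, by omega⟩]
      congr 2
      omega
    · intro k _ hk
      rw [if_neg]
      exact fun h' => hk h'.2.1.symm
    · intro hm
      rw [Finset.mem_range] at hm
      omega
  · refine Finset.sum_eq_zero fun k hk => if_neg fun h' => h ⟨h'.1, ?_⟩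
    rw [Finset.mem_range] at hk
    omega

theorem isFactor_X_sub_X {d : ℕ} (s : ℕ+) (i : Fin d) :
    IsFactor iotaLetter s i
      (frac s (MvPowerSeries.X (some i) - MvPowerSeries.X (none : Option (Fin d))) *
        MvPowerSeries.C (mono [1])) := by
  intro m
  rw [MvPowerSeries.coeff_mul_C]
  change (∑ l ∈ range (m.degree + 1), _) * _ = _
  split_ifs with h
  · rw [degree_eq_of_forall h, Finset.sum_range_succ, Finset.sum_eq_zero, zero_add,
      coeff_X_sub_X_pow, if_pos ⟨h, rfl⟩, coeff_iotaLetter, dpow_dst_y, map_smul, map_smul, phi_y,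
      smul_smul, smul_smul, smul_mul_assoc]
    · set a := m (some i)
      set b := m none
      obtain ⟨t, ht⟩ : ∃ t : ℕ, (s : ℕ) = t + 1 := ⟨s - 1, by have := s.pos; omega⟩
      have e : ((shiftIdx (shiftIdx s a) b : ℕ+) : ℕ) - 1 = s - 1 + (a + b) := by
        simp only [shiftIdx, PNat.mk_coe]
        omega
      have e2 : ((shiftIdx s a : ℕ+) : ℕ) = s + a := rfl
      rw [e, e2, ht]
      congr 1
      have k1 : Nat.choose (a + b + (t + 1) - 1) (a + b) * Nat.choose (a + b) a =
          Nat.choose (a + (t + 1) - 1) a * Nat.choose (b + (t + 1 + a) - 1) (t + 1 + a - 1) := by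
        rw [show a + b + (t + 1) - 1 = a + b + t by omega, show a + (t + 1) - 1 = a + t by omega,
          show b + (t + 1 + a) - 1 = a + b + t by omega, show t + 1 + a - 1 = a + t by omega,
          Nat.choose_mul, mul_comm (Nat.choose (a + t) a),
          Nat.choose_mul (n := a + b + t) (k := a + t) (s := a),
          show a + b + t - a = b + t by omega, show a + b - a = b by omega,
          show a + t - a = t by omega, Nat.choose_symm_add] <;> omega
      have k2 := congrArg (Nat.cast : ℕ → ℚ) k1
      push_cast at k2 ⊢
      linear_combination (-1 : ℚ) ^ b * k2
    · intro l hl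
      rw [coeff_X_sub_X_pow, if_neg, mul_zero, zero_smul]
      rintro ⟨-, e⟩
      rw [Finset.mem_range] at hl
      omega
  · rw [Finset.sum_eq_zero, zero_mul]
    intro l _
    rw [coeff_X_sub_X_pow, if_neg fun h' => h h'.1, mul_zero, zero_smul]

/-- The coefficients of a product of factors attached to distinct variables. -/
theorem coeff_prod_isFactor {d : ℕ} {κ : ℕ+ → PowerSeries Hst} {s : Fin d → ℕ+}
    {g : Fin d → MvPowerSeries (Option (Fin d)) Hsh} (hg : ∀ i, IsFactor κ (s i) i (g i))
    {l : List (Fin d)} (hl : l.Nodup) (m : Option (Fin d) →₀ ℕ) :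
    MvPowerSeries.coeff m (l.map g).prod = if ∀ j, j ∉ l → m (some j) = 0 then
      (l.map fun i => (Nat.choose (m (some i) + s i - 1) (m (some i)) : ℚ)).prod •
        phi (PowerSeries.coeff (m none)
          (l.map fun i => κ (shiftIdx (s i) (m (some i)))).prod) else 0 := by
  classical
  induction l generalizing m with
  | nil =>
    rw [List.map_nil, List.prod_nil, MvPowerSeries.coeff_one]
    simp only [List.map_nil, List.prod_nil, one_smul, PowerSeries.coeff_one]
    by_cases h : m = 0
    · subst h; simp [phi_one]
    · rw [if_neg h]
      split_ifs with h1 h2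
      · exact absurd (Finsupp.ext fun j => by rcases j with _ | j <;> simp [h1, h2]) h
      · rw [map_zero]
      · rfl
  | cons i l ih =>
    have hi : i ∉ l := (List.nodup_cons.mp hl).1
    have ih := ih (List.nodup_cons.mp hl).2
    rw [List.map_cons, List.prod_cons, MvPowerSeries.coeff_mul]
    split_ifs with h
    · set a : ℕ → Option (Fin d) →₀ ℕ := fun p =>
        Finsupp.single (some i) (m (some i)) + Finsupp.single none p with ha
      have hai : ∀ p, a p (some i) = m (some i) := fun p => by simp [ha]
      have haj : ∀ p j, j ≠ i → a p (some j) = 0 := fun p j hj => by simp [ha, Ne.symm hj]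
      have han : ∀ p, a p none = p := fun p => by simp [ha]
      have hb : ∀ p q, p + q = m none → a p + (m - a p) = m := by
        intro p q hpq
        refine add_tsub_cancel_of_le fun j => ?_
        rcases j with _ | j
        · rw [han]; omega
        · by_cases hj : j = i
          · rw [hj, hai]
          · rw [haj _ _ hj]; exact Nat.zero_le _
      simp only [List.map_cons, List.prod_cons]
      rw [PowerSeries.coeff_mul, map_sum, Finset.smul_sum]
      symm
      refine Finset.sum_of_injOn (fun pq => (a pq.1, m - a pq.1)) ?_ ?_ ?_ ?_
      · rintro ⟨p, q⟩ hp ⟨p', q'⟩ hp' e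
        simp only [Finset.mem_coe, HasAntidiagonal.mem_antidiagonal] at hp hp'
        have e' := DFunLike.congr_fun (Prod.ext_iff.mp e).1 none
        simp only [han] at e'
        ext <;> simp only <;> omega
      · rintro ⟨p, q⟩ hp
        simp only [Finset.mem_coe, HasAntidiagonal.mem_antidiagonal] at hp ⊢
        exact hb p q hp
      · rintro ⟨b, c⟩ hbc hne
        rw [HasAntidiagonal.mem_antidiagonal] at hbc
        simp only at hbc ⊢
        rw [hg, ih]
        by_cases hb1 : ∀ j, j ≠ i → b (some j) = 0
        · by_cases hc1 : ∀ j, j ∉ l → c (some j) = 0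
          · refine absurd ⟨(b none, c none), ?_, ?_⟩ hne
            · simp only [Finset.mem_coe, HasAntidiagonal.mem_antidiagonal]
              rw [← hbc]; rfl
            · have hbi : b (some i) = m (some i) := by
                rw [← hbc, Finsupp.add_apply, hc1 i hi, add_zero]
              have hba : a (b none) = b := by
                rw [ha]; dsimp only; rw [← hbi]
                exact ((eq_single_add_single_iff i b).mp hb1).symm
              simp only [hba, Prod.mk.injEq, true_and]
              rw [← hbc, add_tsub_cancel_left]
          · rw [if_neg hc1, mul_zero]
        · rw [if_neg hb1, zero_mul]
      · rintro ⟨p, q⟩ hp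
        rw [HasAntidiagonal.mem_antidiagonal] at hp
        simp only at hp ⊢
        have hm := hb p q hp
        have hcj : ∀ j, j ≠ i → (m - a p) (some j) = m (some j) := fun j hj => by
          rw [Finsupp.tsub_apply, haj p j hj, Nat.sub_zero]
        have hcn : (m - a p) none = q := by
          rw [Finsupp.tsub_apply, han]; omega
        rw [hg, ih, if_pos (haj p), if_pos, hai, han, hcn, smul_mul_smul_comm, ← phi_mul]
        · congr 2
          · refine congrArg List.prod (List.map_congr_left fun j hj => ?_)
            rw [hcj j (fun e => hi (e ▸ hj))]
          · congr 3
            refine List.map_congr_left fun j hj => ?_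
            rw [hcj j (fun e => hi (e ▸ hj))]
        · intro j hj
          by_cases hji : j = i
          · rw [hji, Finsupp.tsub_apply, hai, Nat.sub_self]
          · rw [hcj j hji]
            exact h j (by simp [hji, hj])
    · refine Finset.sum_eq_zero fun bc hbc => ?_
      rw [HasAntidiagonal.mem_antidiagonal] at hbc
      rw [hg, ih]
      by_cases hb1 : ∀ j, j ≠ i → bc.1 (some j) = 0
      · by_cases hc1 : ∀ j, j ∉ l → bc.2 (some j) = 0
        · refine absurd (fun j hj => ?_) h
          rw [List.mem_cons, not_or] at hj
          rw [← hbc, Finsupp.add_apply, hb1 j hj.1, hc1 j hj.2]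
        · rw [if_neg hc1, mul_zero]
      · rw [if_neg hb1, zero_mul]

theorem coeff_frac_one_X {d : ℕ} (m : Option (Fin d) →₀ ℕ) :
    MvPowerSeries.coeff m (frac 1 (MvPowerSeries.X (none : Option (Fin d)))) =
      if ∀ j, m (some j) = 0 then mono (List.replicate (m none) 0) else 0 := by
  classical
  change ∑ l ∈ range (m.degree + 1), _ = _
  split_ifs with h
  · have hm : m = Finsupp.single none (m none) := by
      ext j
      rcases j with _ | j <;> simp [h]
    have hd : m.degree = m none := by
      conv_lhs => rw [hm]
      exact Finsupp.degree_single _ _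
    rw [hd, Finset.sum_range_succ, Finset.sum_eq_zero, zero_add, MvPowerSeries.coeff_X_pow,
      if_pos hm]
    · simp
    · intro l hl
      rw [MvPowerSeries.coeff_X_pow, if_neg, mul_zero, zero_smul]
      intro e
      rw [Finset.mem_range] at hl
      rw [e] at hl
      simp at hl
  · refine Finset.sum_eq_zero fun l _ => ?_
    rw [MvPowerSeries.coeff_X_pow, if_neg, mul_zero, zero_smul]
    intro e
    exact h fun j => by rw [e]; simp

theorem expT_zero {d : ℕ} : (expT (0 : R) : MvPowerSeries (Option (Fin d)) R) = 1 := by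
  classical
  ext m
  rw [MvPowerSeries.coeff_one]
  change (if m = Finsupp.single none (m none) then _ else _) = _
  by_cases h : m = 0
  · subst h; simp
  · rw [if_neg h]
    split_ifs with h1
    · rw [zero_pow, smul_zero]
      intro h2
      exact h (by rw [h1, h2]; simp)
    · rfl

theorem list_prod_map_C_y (w : List ℕ+) :
    (w.map fun s => (PowerSeries.C (y s) : PowerSeries Hst)).prod = PowerSeries.C (mono w) := by
  induction w with
  | nil => simp [mono_nil]
  | cons s w ih => rw [List.map_cons, List.prod_cons, ih, ← map_mul, y, mono_mul_mono]; rfl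

/-- For a series with `h[e₀] = 0`, the regularization relation is the vanishing on shuffles
with `e₀`. -/
theorem e0Reg_iff {h : Ser (Fin 2) R} (h0 : h [0] = 0) :
    E0Reg h ↔ ∀ v, linExt h (dsh v) = 0 := by
  classical
  rw [forall_dsh_eq_zero_iff]
  have hofFn : ∀ {d : ℕ} {A : Type} (g : Fin d → A), List.ofFn g = (List.finRange d).map g :=
    fun g => List.ofFn_eq_map
  -- the factors of the left-hand side do not involve `T`, so that the power of `T` comes from
  -- `(1 - T e₀)⁻¹`
  have left : ∀ (d : ℕ) (s : Fin d → ℕ+) (m : Option (Fin d) →₀ ℕ),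
      MvPowerSeries.coeff m ((List.ofFn fun i : Fin d =>
          frac (s i) (MvPowerSeries.X (some i)) * MvPowerSeries.C (mono [1])).prod *
        frac 1 (MvPowerSeries.X (none : Option (Fin d)))) =
      ((List.finRange d).map fun i =>
        (Nat.choose (m (some i) + s i - 1) (m (some i)) : ℚ)).prod •
        (phi (mono ((List.finRange d).map fun i => shiftIdx (s i) (m (some i)))) *
          mono (List.replicate (m none) 0)) := by
    intro d s m
    rw [hofFn, MvPowerSeries.coeff_mul,
      Finset.sum_eq_single (m.erase none, Finsupp.single none (m none))]
    · rw [coeff_prod_isFactor (fun i => isFactor_X (s i) i) (List.nodup_finRange d),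
        if_pos (by simp), coeff_frac_one_X, if_pos (by simp)]
      have := list_prod_map_C_y ((List.finRange d).map fun i => shiftIdx (s i) (m (some i)))
      rw [List.map_map] at this
      simp only [Finsupp.erase_ne (Option.some_ne_none _), Finsupp.erase_same,
        Finsupp.single_eq_same]
      rw [smul_mul_assoc]
      congr 3
      exact (congrArg (PowerSeries.coeff 0) this).trans (PowerSeries.coeff_zero_C _)
    · rintro ⟨b, c⟩ hbc hne
      rw [HasAntidiagonal.mem_antidiagonal] at hbc
      simp only at hbc ⊢
      rw [coeff_prod_isFactor (fun i => isFactor_X (s i) i) (List.nodup_finRange d),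
        if_pos (by simp), coeff_frac_one_X]
      split_ifs with hc
      · have := list_prod_map_C_y ((List.finRange d).map fun i => shiftIdx (s i) (b (some i)))
        rw [List.map_map] at this
        have hb : b none ≠ 0 := by
          intro hb
          have hc' : c = Finsupp.single none (m none) := by
            ext j
            rcases j with _ | j
            · rw [← hbc, Finsupp.add_apply, hb, zero_add, Finsupp.single_eq_same]
            · simp [hc]
          refine hne (Prod.ext ?_ hc')
          ext j
          rcases j with _ | j
          · simp [hb]
          · simp [← hbc, hc]
        have e := congrArg (PowerSeries.coeff (b none)) this
        rw [PowerSeries.coeff_C, if_neg hb] at e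
        erw [e]
        rw [map_zero, smul_zero, zero_mul]
      · rw [mul_zero]
    · intro hm
      refine absurd ?_ hm
      rw [HasAntidiagonal.mem_antidiagonal]
      exact Finsupp.erase_add_single _ _
  -- the coefficient of the monomial with exponents `m` has the same binomial factors as in `left`
  have right : ∀ (d : ℕ) (s : Fin d → ℕ+) (m : Option (Fin d) →₀ ℕ),
      MvPowerSeries.coeff m (List.ofFn fun i : Fin d =>
          frac (s i) (MvPowerSeries.X (some i) - MvPowerSeries.X (none : Option (Fin d))) *
            MvPowerSeries.C (mono [1])).prod =
      ((List.finRange d).map fun i =>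
        (Nat.choose (m (some i) + s i - 1) (m (some i)) : ℚ)).prod •
        phi (PowerSeries.coeff (m none)
          (iota (mono ((List.finRange d).map fun i => shiftIdx (s i) (m (some i)))))) := by
    intro d s m
    rw [hofFn, coeff_prod_isFactor (fun i => isFactor_X_sub_X (s i) i) (List.nodup_finRange d),
      if_pos (by simp), iota_mono, List.map_map]
    rfl
  unfold E0Reg
  constructor
  · intro hE x n
    refine linMap_congr (F := linExt h ∘ₗ LinearMap.mulRight ℚ (mono (List.replicate n 0)) ∘ₗ phi)
      (G := linExt h ∘ₗ phi ∘ₗ coeffL n ∘ₗ iota) (fun w => ?_) x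
    -- the terms without `U_1, …, U_d` give the value on the word with exponents `s` itself
    have e := congrArg (MvPowerSeries.coeff (Finsupp.single none n)) (hE w.length w.get)
    rw [h0, expT_zero, mul_one] at e
    change linExt h (MvPowerSeries.coeff _ _) = linExt h (MvPowerSeries.coeff _ _) at e
    rw [left, right] at e
    have hw : ((List.finRange w.length).map fun i => shiftIdx (w.get i) 0) = w := by
      conv_rhs => rw [← List.map_get_finRange w]
      rfl
    simp only [Finsupp.single_eq_same, Finsupp.single_apply, reduceCtorEq, if_false, hw] at e
    simpa [coeffL_apply] using e
  · intro hS d s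
    rw [h0, expT_zero, mul_one]
    ext m
    change linExt h (MvPowerSeries.coeff _ _) = linExt h (MvPowerSeries.coeff _ _)
    rw [left, right, map_smul, map_smul, hS]

theorem conjE1_nil (f : Ser (Fin 2) R) : conjE1 f [] = 0 := by
  simp [conjE1, Ser.mul, serE1]

theorem conjE1_e0 (f : Ser (Fin 2) R) : conjE1 f [0] = 0 := by
  simp [conjE1, Ser.mul, serE1, Finset.sum_range_succ]

theorem conjE1_tfae {f : Ser (Fin 2) R} (hf : f [] = 1)
    (hf1 : ∀ n : ℕ, 1 ≤ n → f (List.replicate n 1) = 0) :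
    List.TFAE [IsGrouplike f, IsLieSeries (conjE1 f), E0Reg (conjE1 f) ∧ CondA (conjE1 f),
      E0Reg (conjE1 f) ∧ CondB (conjE1 f), E0Reg (conjE1 f) ∧ CondC (conjE1 f)] := by
  have hABC := condABC_tfae (conjE1 f)
  have h0 := conjE1_e0 f
  tfae_have 1 → 2 := IsGrouplike.isLieSeries_conjE1
  tfae_have 2 → 1 := isGrouplike_of_isLieSeries_conjE1 hf hf1
  tfae_have 2 → 5 := by
    intro h
    refine ⟨(e0Reg_iff h0).mpr fun v => linMap_congr (F := linExt (conjE1 f) ∘ₗ dsh) (G := 0)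
      (fun u => ?_) v, h.condC⟩
    rcases u with _ | ⟨a, u⟩
    · rw [LinearMap.comp_apply, mono_nil, dsh_one, linExt_mono, h0]; rfl
    · rw [LinearMap.comp_apply, mono_cons, h.dsh_eq_zero]; rfl
  tfae_have 5 → 2 := fun h =>
    isLieSeries_of_relB (conjE1_nil f) ((e0Reg_iff h0).mp h.1) ((condC_iff _).mp h.2)
  tfae_have 3 ↔ 4 := and_congr_right fun _ => hABC.out 0 1
  tfae_have 4 ↔ 5 := and_congr_right fun _ => hABC.out 1 2
  tfae_finish

end Regularization

/-! ### Truncated multiple harmonic sums -/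

section Harmonic

theorem weight_cons (s : ℕ+) (w : List ℕ+) : weight (s :: w) = s + weight w := by
  rw [weight_eq, weight_eq, List.map_cons, List.sum_cons]

theorem weight_nil : weight [] = 0 := rfl

/-- The linear form `w ↦ c^{weight w} H_N(w)`. -/
noncomputable def hz (c : ℚ) (N : ℕ) : Hst →ₗ[ℚ] ℚ := linExt fun w => c ^ weight w * harm w N

theorem hz_mono (c : ℚ) (N : ℕ) (w : List ℕ+) : hz c N (mono w) = c ^ weight w * harm w N :=
  linExt_mono _ _

theorem hz_one (c : ℚ) (N : ℕ) : hz c N 1 = 1 := by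
  rw [← mono_nil, hz_mono, weight_nil, harm, pow_zero, mul_one]

theorem hz_y_mul (c : ℚ) (N : ℕ) (s : ℕ+) (x : Hst) :
    hz c N (y s * x) = ∑ n ∈ Ico 1 N, (c / n) ^ (s : ℕ) * hz c n x := by
  have e := linMap_congr (F := hz c N ∘ₗ LinearMap.mulLeft ℚ (y s))
    (G := ∑ n ∈ Ico 1 N, (c / n) ^ (s : ℕ) • hz c n) (fun w => ?_) x
  · simpa [LinearMap.sum_apply] using e
  · simp only [LinearMap.comp_apply, LinearMap.mulLeft_apply, LinearMap.sum_apply,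
      LinearMap.smul_apply, hz_mono, y, mono_mul_mono, List.singleton_append, weight_cons, harm,
      Finset.mul_sum, smul_eq_mul]
    refine Finset.sum_congr rfl fun n _ => ?_
    rw [div_pow, pow_add]
    ring

theorem sum_Ico_mul_sum_Ico (A B : ℕ → ℚ) (N : ℕ) :
    (∑ n ∈ Ico 1 N, A n) * ∑ n ∈ Ico 1 N, B n =
      ∑ n ∈ Ico 1 N, A n * ∑ m ∈ Ico 1 n, B m + ∑ n ∈ Ico 1 N, B n * ∑ m ∈ Ico 1 n, A m +
        ∑ n ∈ Ico 1 N, A n * B n := by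
  induction N with
  | zero => simp
  | succ N ih =>
    rcases Nat.eq_zero_or_pos N with rfl | hN
    · simp
    · simp only [Finset.sum_Ico_succ_top hN]
      linear_combination ih

theorem hz_st (c : ℚ) (N : ℕ) (x z : Hst) : hz c N (st x z) = hz c N x * hz c N z := by
  have words : ∀ (u v : List ℕ+) (N : ℕ),
      hz c N (st (mono u) (mono v)) = hz c N (mono u) * hz c N (mono v) := by
    intro u
    induction u with
    | nil => intro v N; rw [mono_nil, st_one_left, hz_one, one_mul]
    | cons a u ihu =>
      intro v
      induction v with
      | nil => intro N; rw [mono_nil, st_one_right, hz_one, mul_one]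
      | cons b v ihv =>
        intro N
        have ea : mono (a :: u) = y a * mono u := mono_cons a u
        have eb : mono (b :: v) = y b * mono v := mono_cons b v
        have h1 : ∀ n, hz c n (st (mono u) (y b * mono v)) =
            hz c n (mono u) * hz c n (y b * mono v) := fun n => by rw [← eb, ihu]
        have h2 : ∀ n, hz c n (st (y a * mono u) (mono v)) =
            hz c n (y a * mono u) * hz c n (mono v) := fun n => by rw [← ea, ihv]
        rw [ea, eb, st_letter_mul, map_add, map_add, hz_y_mul c N a (st _ _), hz_y_mul c N b (st _ _),
          hz_y_mul c N (a + b)]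
        simp only [h1, h2, ihu]
        simp only [hz_y_mul]
        rw [sum_Ico_mul_sum_Ico]
        congr 1
        · congr 1 <;> refine Finset.sum_congr rfl fun n _ => ?_ <;> ring
        · refine Finset.sum_congr rfl fun n _ => ?_
          rw [PNat.add_coe, pow_add]; ring
  exact bilin_congr (F := st.compr₂ (hz c N))
    (G := (LinearMap.mul ℚ ℚ).compl₁₂ (hz c N) (hz c N)) (fun u v => words u v N) x z

theorem linExt_zetaF (k : ℕ) (x : Hst) (p : Nat.Primes) :
    linExt (zetaF k) x p = ((hz (((p : ℕ) ^ k : ℕ) : ℚ) ((p : ℕ) ^ k) x : ℚ) : ℚ_[(p : ℕ)]) := by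
  refine linMap_congr (F := LinearMap.proj p ∘ₗ linExt (zetaF k))
    (G := Algebra.linearMap ℚ ℚ_[(p : ℕ)] ∘ₗ hz (((p : ℕ) ^ k : ℕ) : ℚ) ((p : ℕ) ^ k))
    (fun w => ?_) x
  rw [LinearMap.comp_apply, LinearMap.comp_apply, linExt_mono, hz_mono]
  simp [zetaF]

theorem stuffleRel_zetaF (k : ℕ) : StuffleRel (zetaF k) := by
  intro u v
  funext p
  rw [Pi.mul_apply, linExt_zetaF, linExt_zetaF, linExt_zetaF, hz_st, Rat.cast_mul]

theorem coeff_Li_replicate_append (n j : ℕ) (w : List ℕ+)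
    (hw : ∀ n, 1 ≤ n → ∑ m ∈ range n, PowerSeries.coeff m (Li (toLetters w)) = harm w n) :
    PowerSeries.coeff n (Li (List.replicate j 0 ++ 1 :: toLetters w)) =
      if n = 0 then 0 else harm w n / (n : ℚ) ^ (j + 1) := by
  induction j with
  | zero =>
    rw [List.replicate_zero, List.nil_append, Li, PowerSeries.coeff_mk]
    split_ifs with h1 h2
    · exact absurd h1 (by decide)
    · exact absurd h1 (by decide)
    · simp [*]
    · rw [hw n (by omega), zero_add, pow_one]
  | succ j ih =>
    rw [List.replicate_succ, List.cons_append, Li, PowerSeries.coeff_mk, if_pos rfl, ih]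
    split_ifs with h
    · simp
    · rw [div_div, ← pow_succ]

/-- The truncated iterated integrals are the truncated iterated sums. -/
theorem sum_coeff_Li (w : List ℕ+) : ∀ N, 1 ≤ N →
    ∑ n ∈ range N, PowerSeries.coeff n (Li (toLetters w)) = harm w N := by
  induction w with
  | nil =>
    intro N hN
    change ∑ n ∈ range N, PowerSeries.coeff n (1 : PowerSeries ℚ) = 1
    simp only [PowerSeries.coeff_one, Finset.sum_ite_eq', Finset.mem_range]
    rw [if_pos (by omega)]
  | cons s w ih =>
    intro N hN
    rw [toLetters_cons, harm, Finset.range_eq_Ico, Finset.sum_eq_sum_Ico_succ_bot (by omega)]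
    simp only [coeff_Li_replicate_append _ _ w ih, if_true, zero_add]
    refine Finset.sum_congr rfl fun n hn => ?_
    rw [Finset.mem_Ico] at hn
    have := s.pos
    rw [if_neg (by omega), Nat.sub_add_cancel this]

end Harmonic

/-! ### The shuffle product of iterated integrals -/

section IteratedIntegrals

/-- The Euler operator `z d/dz`. -/
noncomputable def euler : PowerSeries ℚ →ₗ[ℚ] PowerSeries ℚ where
  toFun f := PowerSeries.mk fun n => n * PowerSeries.coeff n f
  map_add' f g := by ext n; simp [mul_add]
  map_smul' r f := by ext n; simp [mul_left_comm]

theorem coeff_euler (f : PowerSeries ℚ) (n : ℕ) :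
    PowerSeries.coeff n (euler f) = n * PowerSeries.coeff n f := by
  change PowerSeries.coeff n (PowerSeries.mk fun n => (n : ℚ) * PowerSeries.coeff n f) = _
  rw [PowerSeries.coeff_mk]

theorem euler_mul (f g : PowerSeries ℚ) : euler (f * g) = euler f * g + f * euler g := by
  ext n
  rw [coeff_euler, map_add, PowerSeries.coeff_mul, PowerSeries.coeff_mul, PowerSeries.coeff_mul,
    Finset.mul_sum, ← Finset.sum_add_distrib]
  refine Finset.sum_congr rfl fun ij hij => ?_
  rw [coeff_euler, coeff_euler, ← HasAntidiagonal.mem_antidiagonal.mp hij]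
  push_cast
  ring

theorem eq_of_euler_eq {f g : PowerSeries ℚ} (h0 : PowerSeries.coeff 0 f = PowerSeries.coeff 0 g)
    (h : euler f = euler g) : f = g := by
  ext n
  rcases Nat.eq_zero_or_pos n with rfl | hn
  · exact h0
  · have h1 := congrArg (PowerSeries.coeff n) h
    rw [coeff_euler, coeff_euler] at h1
    exact mul_left_cancel₀ (by positivity) h1

/-- The linear extension of `u ↦ c^{length u} Li_u`; the words ending with `e₀` are sent to `0`. -/
noncomputable def liSeries (c : ℚ) : Hsh →ₗ[ℚ] PowerSeries ℚ :=
  linExt fun u => if u.getLast? = some 0 then 0 else c ^ u.length • Li u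

theorem liSeries_mono (c : ℚ) (u : List (Fin 2)) :
    liSeries c (mono u) = if u.getLast? = some 0 then 0 else c ^ u.length • Li u :=
  linExt_mono _ _

theorem liSeries_one (c : ℚ) : liSeries c 1 = 1 := by
  rw [← mono_nil, liSeries_mono]
  simp [Li]

theorem coeff_zero_liSeries_letter_mul (c : ℚ) (a : Fin 2) (x : Hsh) :
    PowerSeries.coeff 0 (liSeries c (mono [a] * x)) = 0 := by
  refine linMap_congr (F := coeffL 0 ∘ₗ liSeries c ∘ₗ LinearMap.mulLeft ℚ (mono [a])) (G := 0)
    (fun u => ?_) x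
  rw [LinearMap.comp_apply, LinearMap.comp_apply, LinearMap.mulLeft_apply, ← mono_cons, coeffL_apply,
    liSeries_mono]
  split_ifs
  · simp
  · simp [Li]

theorem euler_liSeries_e0_mul (c : ℚ) (x : Hsh) :
    euler (liSeries c (mono [0] * x)) =
      c • (liSeries c x - PowerSeries.C (PowerSeries.coeff 0 (liSeries c x))) := by
  ext n
  refine linMap_congr (F := coeffL n ∘ₗ euler ∘ₗ liSeries c ∘ₗ LinearMap.mulLeft ℚ (mono [0]))
    (G := c • (coeffL n ∘ₗ liSeries c - (if n = 0 then 1 else 0 : ℚ) • coeffL 0 ∘ₗ liSeries c))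
    (fun u => ?_) x |>.trans ?_
  · simp only [LinearMap.comp_apply, LinearMap.mulLeft_apply, ← mono_cons, coeffL_apply,
      LinearMap.smul_apply, LinearMap.sub_apply, coeff_euler, liSeries_mono]
    rcases u with _ | ⟨b, u⟩
    · rcases n with _ | n <;> simp [Li, PowerSeries.coeff_one]
    · rw [List.getLast?_cons_cons]
      split_ifs with h hn hn
      · simp
      · simp
      · subst hn; simp
      · have : (n : ℚ) ≠ 0 := by positivity
        rw [Li]
        simp only [List.length_cons, map_smul, smul_eq_mul, PowerSeries.coeff_mk, if_true, zero_mul,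
          sub_zero, pow_succ]
        field_simp
  · simp only [LinearMap.comp_apply, coeffL_apply, LinearMap.smul_apply, LinearMap.sub_apply,
      map_smul, map_sub, PowerSeries.coeff_C]
    split_ifs <;> simp

theorem euler_liSeries_e1_mul (c : ℚ) (x : Hsh) :
    euler (liSeries c (mono [1] * x)) =
      c • (liSeries c x * PowerSeries.mk 1 * PowerSeries.X) := by
  ext n
  refine linMap_congr (F := coeffL n ∘ₗ euler ∘ₗ liSeries c ∘ₗ LinearMap.mulLeft ℚ (mono [1]))
    (G := c • coeffL n ∘ₗ LinearMap.mulRight ℚ (PowerSeries.mk 1 * PowerSeries.X) ∘ₗ liSeries c)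
    (fun u => ?_) x |>.trans ?_
  · simp only [LinearMap.comp_apply, LinearMap.mulLeft_apply, ← mono_cons, coeffL_apply,
      LinearMap.smul_apply, LinearMap.mulRight_apply, coeff_euler, liSeries_mono, ← mul_assoc]
    have e : (1 :: u : List (Fin 2)).getLast? = some 0 ↔ u.getLast? = some 0 := by
      rcases u with _ | ⟨b, u⟩
      · simp
      · rw [List.getLast?_cons_cons]
    simp only [e]
    split_ifs with h
    · simp
    · rcases n with _ | n
      · simp
      · have : ((n + 1 : ℕ) : ℚ) ≠ 0 := by positivity
        rw [PowerSeries.coeff_succ_mul_X, PowerSeries.coeff_mul,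
          Finset.Nat.sum_antidiagonal_eq_sum_range_succ_mk, Li]
        simp only [List.length_cons, map_smul, smul_eq_mul, PowerSeries.coeff_mk, one_ne_zero,
          if_false, pow_succ, Pi.one_apply, mul_one, ← Finset.mul_sum]
        field_simp
  · simp only [LinearMap.comp_apply, coeffL_apply, LinearMap.smul_apply, LinearMap.mulRight_apply,
      map_smul, mul_assoc]

theorem euler_liSeries_letter_mul (c : ℚ) {a : Fin 2} {u : List (Fin 2)}
    (hu : (a :: u).getLast? ≠ some 0) {x : Hsh} {g : PowerSeries ℚ}
    (hx : liSeries c x = liSeries c (mono u) * g) :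
    euler (liSeries c (mono [a] * x)) = euler (liSeries c (mono (a :: u))) * g := by
  rw [mono_cons a u]
  fin_cases a
  · rcases u with _ | ⟨b, u⟩
    · simp at hu
    · have h1 := coeff_zero_liSeries_letter_mul c b (mono u)
      rw [← mono_cons] at h1
      change euler (liSeries c (mono [0] * x)) = euler (liSeries c (mono [0] * _)) * g
      rw [euler_liSeries_e0_mul, euler_liSeries_e0_mul, hx, h1, PowerSeries.coeff_zero_eq_constantCoeff_apply,
        map_mul, ← PowerSeries.coeff_zero_eq_constantCoeff_apply, h1, zero_mul, map_zero, sub_zero,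
        sub_zero, smul_mul_assoc]
  · change euler (liSeries c (mono [1] * x)) = euler (liSeries c (mono [1] * _)) * g
    rw [euler_liSeries_e1_mul, euler_liSeries_e1_mul, hx, smul_mul_assoc]
    congr 1
    ring

/-- Iterated integrals satisfy the shuffle relations. -/
theorem liSeries_sh (c : ℚ) (u v : List (Fin 2)) (hu : u.getLast? ≠ some 0)
    (hv : v.getLast? ≠ some 0) :
    liSeries c (sh (mono u) (mono v)) = liSeries c (mono u) * liSeries c (mono v) := by
  have tail_ne : ∀ {a : Fin 2} {u : List (Fin 2)}, (a :: u).getLast? ≠ some 0 →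
      u.getLast? ≠ some 0 := by
    intro a u h
    rcases u with _ | ⟨b, u⟩
    · simp
    · rwa [List.getLast?_cons_cons] at h
  induction u generalizing v with
  | nil => rw [mono_nil, sh_one_left, liSeries_one, one_mul]
  | cons a u ihu =>
    induction v with
    | nil => rw [mono_nil, sh_one_right, liSeries_one, mul_one]
    | cons b v ihv =>
      have ha : PowerSeries.coeff 0 (liSeries c (mono (a :: u))) = 0 := by
        rw [mono_cons]; exact coeff_zero_liSeries_letter_mul c a _
      have h1 := ihu (b :: v) (tail_ne hu) hv
      have h2 := ihv (tail_ne hv)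
      rw [mul_comm] at h2
      have e : sh (mono (a :: u)) (mono (b :: v)) =
          mono [a] * sh (mono u) (mono (b :: v)) + mono [b] * sh (mono (a :: u)) (mono v) := by
        rw [mono_cons a u, mono_cons b v, sh_letter_mul]
      -- both sides vanish at `0`, and the Euler operator turns the claim into the shorter cases
      apply eq_of_euler_eq
      · rw [e, map_add, map_add, coeff_zero_liSeries_letter_mul, coeff_zero_liSeries_letter_mul,
          PowerSeries.coeff_zero_eq_constantCoeff_apply, map_mul,
          ← PowerSeries.coeff_zero_eq_constantCoeff_apply, ha, zero_mul, add_zero]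
      · rw [e, map_add, map_add, euler_liSeries_letter_mul c hu h1,
          euler_liSeries_letter_mul c hv h2, euler_mul]
        ring

theorem getLast?_toLetters (w : List ℕ+) : (toLetters w).getLast? ≠ some 0 := by
  induction w with
  | nil => simp [toLetters]
  | cons s w ih =>
    rw [toLetters_cons, List.getLast?_append, List.getLast?_cons]
    rcases h : (toLetters w).getLast? with _ | a
    · simp
    · rw [h] at ih
      simpa using ih

theorem decode_append_e0 (u : List (Fin 2)) (k : ℕ) : decode k (u ++ [0]) = none := by
  induction u generalizing k with
  | nil => simp [decode]
  | cons a u ih => simp [decode, ih]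

theorem piY_mono_toLetters (w : List ℕ+) : piY (mono (toLetters w)) = mono w := by
  rw [piY, linExt_mono, decode_toLetters]; rfl

theorem sum_coeff_liSeries (c : ℚ) {N : ℕ} (hN : 1 ≤ N) (x : Hsh) :
    ∑ n ∈ range N, PowerSeries.coeff n (liSeries c x) = hz c N (piY x) := by
  have key := linMap_congr (F := ∑ n ∈ range N, coeffL n ∘ₗ liSeries c) (G := hz c N ∘ₗ piY)
    (fun u => ?_) x
  · simpa [LinearMap.sum_apply, coeffL_apply] using key
  · simp only [LinearMap.sum_apply, LinearMap.comp_apply, coeffL_apply]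
    obtain ⟨w, n, rfl⟩ := exists_eq_toLetters_append u
    rcases n with _ | n
    · rw [List.replicate_zero, List.append_nil, piY_mono_toLetters, hz_mono, liSeries_mono,
        if_neg (getLast?_toLetters w), ← sum_coeff_Li w N hN, Finset.mul_sum, length_toLetters]
      simp
    · rw [List.replicate_succ', ← List.append_assoc, liSeries_mono, if_pos (by simp), piY, linExt_mono,
        decode_append_e0]
      simp

theorem coeff_liSeries_toLetters_cons (c : ℚ) (s : ℕ+) (w : List ℕ+) (n : ℕ) :
    PowerSeries.coeff n (liSeries c (mono (toLetters (s :: w)))) =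
      (c / n) ^ (s : ℕ) * hz c n (mono w) := by
  have hs := s.pos
  rw [liSeries_mono, if_neg (getLast?_toLetters _), length_toLetters, toLetters_cons, map_smul,
    coeff_Li_replicate_append _ _ w (sum_coeff_Li w), hz_mono, Nat.sub_add_cancel hs, weight_cons]
  split_ifs with h
  · subst h
    simp [zero_pow s.ne_zero]
  · rw [div_pow, pow_add, smul_eq_mul]
    ring

theorem sum_range_coeff_mul (f g : PowerSeries ℚ) (N : ℕ) :
    ∑ n ∈ range N, PowerSeries.coeff n (f * g) =
      ∑ i ∈ range N, PowerSeries.coeff i f * ∑ j ∈ range (N - i), PowerSeries.coeff j g := by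
  simp only [PowerSeries.coeff_mul, Finset.mul_sum]
  rw [Finset.sum_sigma', Finset.sum_sigma']
  refine Finset.sum_nbij' (fun x => ⟨x.2.1, x.2.2⟩) (fun x => ⟨x.1 + x.2, (x.1, x.2)⟩) ?_ ?_ ?_ ?_ ?_
  · rintro ⟨n, i, j⟩ h
    simp only [Finset.mem_sigma, Finset.mem_range, HasAntidiagonal.mem_antidiagonal] at h ⊢
    omega
  · rintro ⟨i, j⟩ h
    simp only [Finset.mem_sigma, Finset.mem_range, HasAntidiagonal.mem_antidiagonal] at h ⊢
    exact ⟨by omega, trivial⟩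
  · rintro ⟨n, i, j⟩ h
    simp only [Finset.mem_sigma, Finset.mem_range, HasAntidiagonal.mem_antidiagonal] at h
    obtain ⟨-, rfl⟩ := h
    rfl
  · rintro ⟨i, j⟩ _; rfl
  · rintro ⟨n, i, j⟩ _; rfl

/-- The truncation of the shuffle product of two iterated integrals. -/
theorem hz_piY_sh (c : ℚ) (N : ℕ) (hN : 1 ≤ N) (s : ℕ+) (u : List ℕ+) (x : Hst) :
    hz c N (piY (sh (phi x) (phi (mono (s :: u))))) =
      ∑ n ∈ Ico 1 N, (c / n) ^ (s : ℕ) * hz c n (mono u) * hz c (N - n) x := by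
  have key := linMap_congr
    (F := hz c N ∘ₗ piY ∘ₗ sh.flip (phi (mono (s :: u))) ∘ₗ phi)
    (G := ∑ n ∈ Ico 1 N, ((c / n) ^ (s : ℕ) * hz c n (mono u)) • hz c (N - n))
    (fun w => ?_) x
  · simpa [LinearMap.sum_apply] using key
  · simp only [LinearMap.sum_apply, LinearMap.comp_apply, LinearMap.flip_apply,
      LinearMap.smul_apply]
    rw [← sum_coeff_liSeries c hN, phi_mono, phi_mono,
      liSeries_sh c _ _ (getLast?_toLetters _) (getLast?_toLetters _), mul_comm,
      sum_range_coeff_mul, Finset.range_eq_Ico, Finset.sum_eq_sum_Ico_succ_bot (by omega)]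
    simp only [coeff_liSeries_toLetters_cons, Nat.cast_zero, div_zero, zero_pow s.ne_zero, zero_mul,
      zero_add]
    refine Finset.sum_congr rfl fun n hn => ?_
    rw [Finset.mem_Ico] at hn
    rw [sum_coeff_liSeries c (by omega), piY_mono_toLetters, smul_eq_mul]

end IteratedIntegrals

/-! ### Convergence of the specialization T = 1 in p-adic fields -/

section Padic

variable (p : ℕ) [hp : Fact p.Prime]

/-- The `p`-adic size of `p^k / m` for `0 < m < p^k`, on which all convergence rests. -/
theorem norm_natCast_div_lt_one {k m : ℕ} (h1 : 1 ≤ m) (h2 : m < p ^ k) :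
    ‖((((p ^ k : ℕ) : ℚ) / m : ℚ) : ℚ_[p])‖ < 1 := by
  have hm : ¬ (p : ℤ) ^ k ∣ (m : ℤ) := by
    intro h
    have := Nat.le_of_dvd h1 (by exact_mod_cast h)
    omega
  rw [← Padic.norm_int_le_pow_iff_dvd, not_le, ← Padic.norm_p_pow] at hm
  push_cast at hm ⊢
  rw [norm_div]
  exact (div_lt_one ((norm_nonneg _).trans_lt hm)).mpr hm

/-- The power series `∑_l (-1)^s binom(l+s-1, s-1) r^{s+l}` is the expansion of `(r/(r-1))^s`. -/
theorem hasSum_itilde_letter (s : ℕ+) {r : ℚ_[p]} (hr : ‖r‖ < 1) :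
    Summable (fun l : ℕ => ‖(-1 : ℚ_[p]) ^ (s : ℕ) * (Nat.choose (l + s - 1) (s - 1) : ℚ_[p]) *
        r ^ ((s : ℕ) + l)‖) ∧
      HasSum (fun l : ℕ => (-1 : ℚ_[p]) ^ (s : ℕ) * (Nat.choose (l + s - 1) (s - 1) : ℚ_[p]) *
        r ^ ((s : ℕ) + l)) ((r / (r - 1)) ^ (s : ℕ)) := by
  obtain ⟨t, ht⟩ : ∃ t : ℕ, (s : ℕ) = t + 1 := ⟨s - 1, by have := s.pos; omega⟩
  rw [ht]
  constructor
  · refine Summable.of_nonneg_of_le (fun _ => norm_nonneg _) (fun l => ?_)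
      (summable_geometric_of_lt_one (norm_nonneg r) hr)
    rw [norm_mul, norm_mul, norm_pow, norm_pow, norm_neg, norm_one, one_pow, one_mul, pow_add,
      mul_comm (‖r‖ ^ (t + 1)), ← mul_assoc]
    have h1 : ‖((l + (t + 1) - 1).choose (t + 1 - 1) : ℚ_[p])‖ ≤ 1 := by
      exact_mod_cast Padic.norm_int_le_one (p := p) (((l + (t + 1) - 1).choose (t + 1 - 1) : ℕ) : ℤ)
    have h2 : ‖r‖ ^ (t + 1) ≤ 1 := pow_le_one₀ (norm_nonneg _) hr.le
    have h3 : 0 ≤ ‖r‖ ^ l := by positivity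
    have h4 : 0 ≤ ‖r‖ ^ (t + 1) := by positivity
    calc _ ≤ 1 * ‖r‖ ^ l * 1 := by gcongr
      _ = _ := by ring
  · have h := (hasSum_choose_mul_geometric_of_norm_lt_one t hr).mul_left
      ((-1) ^ (t + 1) * r ^ (t + 1))
    have hne : (1 : ℚ_[p]) - r ≠ 0 := by
      intro h0
      rw [← sub_eq_zero.mp h0, norm_one] at hr
      exact lt_irrefl _ hr
    have e1 : (fun l : ℕ => (-1 : ℚ_[p]) ^ (t + 1) *
        (Nat.choose (l + (t + 1) - 1) (t + 1 - 1) : ℚ_[p]) * r ^ (t + 1 + l)) =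
        fun l => (-1) ^ (t + 1) * r ^ (t + 1) * (((l + t).choose t : ℚ_[p]) * r ^ l) := by
      funext l
      rw [show l + (t + 1) - 1 = l + t by omega, show t + 1 - 1 = t by omega, pow_add]
      ring
    have e2 : (r / (r - 1)) ^ (t + 1) = (-1) ^ (t + 1) * r ^ (t + 1) * (1 / (1 - r) ^ (t + 1)) := by
      rw [mul_one_div, ← mul_pow, ← div_pow, neg_one_mul, ← neg_div_neg_eq, neg_sub]
    rw [e1, e2]
    exact h

/-- The values of `P` under `w ↦ c^{weight w} H_m(w)` have absolutely convergent sum `x` in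
`ℚ_p`. -/
def HasHarmValue (c : ℚ) (m : ℕ) (P : PowerSeries Hst) (x : ℚ) : Prop :=
  Summable (fun n => ‖((hz c m (PowerSeries.coeff n P) : ℚ) : ℚ_[p])‖) ∧
    HasSum (fun n => ((hz c m (PowerSeries.coeff n P) : ℚ) : ℚ_[p])) (x : ℚ_[p])

theorem hasHarmValue_C (c : ℚ) (m : ℕ) (x : Hst) :
    HasHarmValue p c m (PowerSeries.C x) (hz c m x) := by
  have h0 : ∀ n, n ≠ 0 → ((hz c m (PowerSeries.coeff n (PowerSeries.C x)) : ℚ) : ℚ_[p]) = 0 := by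
    intro n hn
    rw [PowerSeries.coeff_C, if_neg hn, map_zero, Rat.cast_zero]
  constructor
  · exact (hasSum_single 0 fun n hn => by rw [h0 n hn, norm_zero]).summable
  · have := hasSum_single (f := fun n =>
      ((hz c m (PowerSeries.coeff n (PowerSeries.C x)) : ℚ) : ℚ_[p])) 0 h0
    simpa using this

theorem coeff_itilde_y (s : ℕ+) (l : ℕ) : PowerSeries.coeff l (itilde (y s)) =
    ((-1 : ℚ) ^ (s : ℕ) * (Nat.choose (l + s - 1) (s - 1) : ℚ)) • y (shiftIdx s l) := by
  rw [coeff_itilde, inv_y, map_smul, dpow_dst_y, smul_smul]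

variable {p}

/-- Multiplication by the image of a letter reverses the summation index: the sum over `l` turns
`(c/m)^{s+l}` into `(c/(c-m))^s`. -/
theorem HasHarmValue.itilde_y_mul {c : ℚ} {N : ℕ}
    (hc : ∀ m : ℕ, 1 ≤ m → m < N → ‖((c / m : ℚ) : ℚ_[p])‖ < 1)
    {P : PowerSeries Hst} {φ : ℕ → ℚ} (hP : ∀ m, m < N → HasHarmValue p c m P (φ m)) (s : ℕ+) :
    HasHarmValue p c N (itilde (y s) * P) (∑ m ∈ Ico 1 N, (c / (c - m)) ^ (s : ℕ) * φ m) := by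
  set g : ℕ → ℕ → ℚ_[p] := fun m l => (-1 : ℚ_[p]) ^ (s : ℕ) *
    (Nat.choose (l + s - 1) (s - 1) : ℚ_[p]) * ((c / m : ℚ) : ℚ_[p]) ^ ((s : ℕ) + l) with hg
  set b : ℕ → ℕ → ℚ_[p] := fun m n => ((hz c m (PowerSeries.coeff n P) : ℚ) : ℚ_[p]) with hb
  have e : ∀ n, ((hz c N (PowerSeries.coeff n (itilde (y s) * P)) : ℚ) : ℚ_[p]) =
      ∑ m ∈ Ico 1 N, ∑ ij ∈ antidiagonal n, g m ij.1 * b m ij.2 := by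
    intro n
    rw [PowerSeries.coeff_mul, map_sum, Finset.sum_comm, Rat.cast_sum]
    refine Finset.sum_congr rfl fun ij _ => ?_
    rw [coeff_itilde_y, smul_mul_assoc, map_smul, hz_y_mul, smul_eq_mul, Finset.mul_sum,
      Rat.cast_sum]
    refine Finset.sum_congr rfl fun m _ => ?_
    have : ((shiftIdx s ij.1 : ℕ+) : ℕ) = s + ij.1 := rfl
    rw [this, hg, hb]
    push_cast
    ring
  have key : ∀ m ∈ Ico 1 N, Summable (fun n => ‖∑ ij ∈ antidiagonal n, g m ij.1 * b m ij.2‖) ∧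
      HasSum (fun n => ∑ ij ∈ antidiagonal n, g m ij.1 * b m ij.2)
        (((c / (c - m)) ^ (s : ℕ) * φ m : ℚ) : ℚ_[p]) := by
    intro m hm
    rw [Finset.mem_Ico] at hm
    have hr := hc m hm.1 hm.2
    have h1 := hasSum_itilde_letter p s hr
    have h2 := hP m hm.2
    have h3 := summable_norm_sum_mul_antidiagonal_of_summable_norm h1.1 h2.1
    refine ⟨h3, ?_⟩
    have h4 := tsum_mul_tsum_eq_tsum_sum_antidiagonal_of_summable_norm h1.1 h2.1
    rw [h1.2.tsum_eq, h2.2.tsum_eq] at h4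
    have h5 : (((c / (c - m)) ^ (s : ℕ) * φ m : ℚ) : ℚ_[p]) =
        (((c / m : ℚ) : ℚ_[p]) / (((c / m : ℚ) : ℚ_[p]) - 1)) ^ (s : ℕ) * (φ m : ℚ_[p]) := by
      have hm0 : (m : ℚ) ≠ 0 := by
        have := hm.1
        positivity
      have h6 : c / (c - m) = c / m / (c / m - 1) := by
        rw [div_sub_one hm0, div_div_div_cancel_right₀ hm0]
      rw [h6]
      push_cast
      rfl
    rw [h5, h4]
    exact h3.of_norm.hasSum
  constructor
  · simp only [e]
    refine Summable.of_nonneg_of_le (fun _ => norm_nonneg _) (fun n => norm_sum_le _ _) ?_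
    exact summable_sum fun m hm => (key m hm).1
  · simp only [e]
    rw [Rat.cast_sum]
    exact hasSum_sum fun m hm => (key m hm).2

theorem sum_Ico_mul_sum_Ico_sub (A B : ℕ → ℚ) (N : ℕ) :
    ∑ n ∈ Ico 1 N, A n * ∑ m ∈ Ico 1 (N - n), B m =
      ∑ n ∈ Ico 1 N, (∑ m ∈ Ico 1 n, A m) * B (N - n) := by
  have e : ∀ n, ∑ m ∈ Ico 1 (N - n), B m = ∑ m ∈ Ico (n + 1) N, B (N - m) := by
    intro n
    rw [Finset.sum_Ico_reflect B (n + 1) (Nat.le_succ N), Nat.add_sub_cancel_left,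
      Nat.add_sub_add_right]
  simp only [e, Finset.mul_sum, Finset.sum_mul]
  refine Finset.sum_comm' fun n m => ?_
  simp only [Finset.mem_Ico]
  omega

/-- The change of variables `n ↦ N - n` in the indices of the first word. -/
theorem HasHarmValue.itilde_mul {N : ℕ}
    (hc : ∀ m : ℕ, 1 ≤ m → m < N → ‖(((N : ℚ) / m : ℚ) : ℚ_[p])‖ < 1) (u : List ℕ+) (s : ℕ+)
    {P : PowerSeries Hst} {φ : ℕ → ℚ} (hP : ∀ m, m < N → HasHarmValue p N m P (φ m)) :
    HasHarmValue p N N (itilde (mono (s :: u)) * P)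
      (∑ n ∈ Ico 1 N, ((N : ℚ) / n) ^ (s : ℕ) * hz N n (mono u) * φ (N - n)) := by
  have hN : ∀ n ∈ Ico 1 N, (N : ℚ) - ((N - n : ℕ) : ℚ) = n := by
    intro n hn
    rw [Finset.mem_Ico] at hn
    rw [Nat.cast_sub hn.2.le]
    ring
  induction u generalizing s P φ with
  | nil =>
    have h := HasHarmValue.itilde_y_mul hc hP s
    have e := Finset.sum_Ico_reflect (fun m => ((N : ℚ) / (N - m)) ^ (s : ℕ) * φ m) 1
      (Nat.le_succ N)
    rw [Nat.add_sub_cancel_left, Nat.add_sub_cancel] at e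
    rw [← e] at h
    have e1 : (mono [s] : Hst) = y s := rfl
    rw [e1]
    convert h using 1
    refine Finset.sum_congr rfl fun n hn => ?_
    rw [hN n hn, mono_nil, hz_one, mul_one]
  | cons t u ih =>
    have e : itilde (mono (s :: t :: u)) * P = itilde (mono (t :: u)) * (itilde (y s) * P) := by
      rw [mono_cons, DShuffle.itilde_mul, mul_assoc]; rfl
    have h := ih t fun M hM => HasHarmValue.itilde_y_mul
      (fun m h1 h2 => hc m h1 (h2.trans hM)) (fun m hm => hP m (hm.trans hM)) s
    rw [e]
    convert h using 1
    rw [sum_Ico_mul_sum_Ico_sub]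
    refine Finset.sum_congr rfl fun n hn => ?_
    have e2 : (mono (t :: u) : Hst) = y t * mono u := mono_cons t u
    rw [hN n hn, e2, hz_y_mul]
    ring

end Padic

section FiniteValues

variable {k : ℕ}

theorem hasZetaValue_of_hasHarmValue {P : PowerSeries Hst} {x : Nat.Primes → ℚ}
    (h : ∀ p : Nat.Primes,
      HasHarmValue p (((p : ℕ) ^ k : ℕ) : ℚ) ((p : ℕ) ^ k) P (x p)) :
    HasZetaValue k P fun p => (x p : ℚ_[(p : ℕ)]) := by
  refine Pi.hasSum.mpr fun p => ?_
  simp only [linExt_zetaF]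
  exact (h p).2

theorem hasZetaValue_itilde_cons_mul (s : ℕ+) (u : List ℕ+) (x : Hst) :
    HasZetaValue k (itilde (mono (s :: u)) * PowerSeries.C x) fun p =>
      ((∑ n ∈ Ico 1 ((p : ℕ) ^ k), ((((p : ℕ) ^ k : ℕ) : ℚ) / n) ^ (s : ℕ) *
        hz (((p : ℕ) ^ k : ℕ) : ℚ) n (mono u) *
          hz (((p : ℕ) ^ k : ℕ) : ℚ) ((p : ℕ) ^ k - n) x : ℚ) : ℚ_[(p : ℕ)]) :=
  hasZetaValue_of_hasHarmValue fun p => HasHarmValue.itilde_mul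
    (fun _ h1 h2 => norm_natCast_div_lt_one p h1 h2) u s fun m _ => hasHarmValue_C p _ m x

theorem hasZetaValue_itilde_nil_mul (x : Hst) :
    HasZetaValue k (itilde (mono []) * PowerSeries.C x) fun p =>
      ((hz (((p : ℕ) ^ k : ℕ) : ℚ) ((p : ℕ) ^ k) x : ℚ) : ℚ_[(p : ℕ)]) := by
  rw [mono_nil, itilde_one, one_mul]
  exact hasZetaValue_of_hasHarmValue fun p => hasHarmValue_C p _ _ x

theorem itilde_add (x z : Hst) : itilde (x + z) = itilde x + itilde z := by
  ext n
  simp only [coeff_itilde, map_add]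

theorem itilde_smul (r : ℚ) (x : Hst) : itilde (r • x) = r • itilde x := by
  ext n
  simp only [coeff_itilde, map_smul, PowerSeries.coeff_smul]

/-- The integral shuffle relation. -/
theorem hasZetaValue_sh (x z : Hst) : HasZetaValue k (itilde z * PowerSeries.C x)
    (linExt (zetaF k) (piY (sh (phi x) (phi z)))) := by
  induction z using word_induction with
  | hmono w =>
    rcases w with _ | ⟨s, u⟩
    · convert hasZetaValue_itilde_nil_mul x using 1
      funext p
      rw [linExt_zetaF, mono_nil, phi_one, sh_one_right]
      refine congrArg _ (linMap_congr (F := hz _ _ ∘ₗ piY ∘ₗ phi) (fun w => ?_) x)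
      rw [LinearMap.comp_apply, LinearMap.comp_apply, phi_mono, piY_mono_toLetters]
    · convert hasZetaValue_itilde_cons_mul s u x using 1
      funext p
      rw [linExt_zetaF, hz_piY_sh _ _ (Nat.one_le_pow _ _ p.2.pos)]
  | hadd z z' h h' =>
    rw [itilde_add, add_mul]
    simp only [map_add, HasZetaValue] at h h' ⊢
    exact h.add h'
  | hsmul r z h =>
    rw [itilde_smul, smul_mul_assoc]
    simp only [map_smul, HasZetaValue, PowerSeries.coeff_smul] at h ⊢
    exact h.const_smul r

theorem zetaF_eq_sum_coeff_Li (w : List ℕ+) : zetaF k w = fun p : Nat.Primes =>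
    (((((p : ℕ) : ℚ) ^ k) ^ weight w *
      ∑ n ∈ Finset.range ((p : ℕ) ^ k), PowerSeries.coeff n (Li (toLetters w)) : ℚ) :
        ℚ_[(p : ℕ)]) := by
  funext p
  rw [sum_coeff_Li w _ (Nat.one_le_pow _ _ p.2.pos)]
  rfl

theorem hasZetaValue_first (s : ℕ+) (u w₂ : List ℕ+) :
    HasZetaValue k (itilde (mono (s :: u)) * PowerSeries.C (mono w₂))
      (fun p : Nat.Primes =>
        (((((p : ℕ) : ℚ) ^ k) ^ (weight (s :: u) + weight w₂) *
          ∑ n ∈ Finset.Ico 1 ((p : ℕ) ^ k),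
            harm u n / (n : ℚ) ^ (s : ℕ) * harm w₂ ((p : ℕ) ^ k - n) : ℚ) :
          ℚ_[(p : ℕ)])) := by
  convert hasZetaValue_itilde_cons_mul s u (mono w₂) using 3 with p
  rw [Finset.mul_sum]
  refine Finset.sum_congr rfl fun n _ => ?_
  rw [hz_mono, hz_mono, weight_cons, div_pow, pow_add, pow_add, Nat.cast_pow]
  ring

theorem hasZetaValue_second (w : List ℕ+) (t : ℕ+) (v : List ℕ+) :
    HasZetaValue k (itilde (mono w) * PowerSeries.C (mono (t :: v)))
      (fun p : Nat.Primes =>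
        (((((p : ℕ) : ℚ) ^ k) ^ (weight w + weight (t :: v)) *
          ∑ n ∈ Finset.Ico 1 ((p : ℕ) ^ k),
            harm w n * (harm v ((p : ℕ) ^ k - n) /
              (((p : ℕ) ^ k - n : ℕ) : ℚ) ^ (t : ℕ)) : ℚ) :
          ℚ_[(p : ℕ)])) := by
  rcases w with _ | ⟨s, u⟩
  · convert hasZetaValue_itilde_nil_mul (mono (t :: v)) using 3 with p
    rw [hz_mono, weight_nil, zero_add, harm, Nat.cast_pow]
    have e := Finset.sum_Ico_reflect (fun m => harm v m / (m : ℚ) ^ (t : ℕ)) 1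
      (Nat.le_succ ((p : ℕ) ^ k))
    rw [Nat.add_sub_cancel_left, Nat.add_sub_cancel] at e
    rw [← e]
    simp only [harm, one_mul]
  · convert hasZetaValue_first s u (t :: v) using 3 with p
    simp only [harm]
    rw [sum_Ico_mul_sum_Ico_sub (fun n => harm u n / (n : ℚ) ^ (s : ℕ))
      (fun m => harm v m / (m : ℚ) ^ (t : ℕ))]

end FiniteValues

/-! ### The inverse of a grouplike series -/

section Inverse

variable {R : Type*} [CommRing R] [Algebra ℚ R] {f : Ser (Fin 2) R}

theorem IsGrouplike.linExt_sh (hf : IsGrouplike f) (x z : Hsh) :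
    linExt f (sh x z) = linExt f x * linExt f z := by
  refine bilin_congr (F := sh.compr₂ (linExt f))
    (G := (LinearMap.mul ℚ R).compl₁₂ (linExt f) (linExt f)) (fun u v => ?_) x z
  simpa [linExt_mono, coprodSh] using hf.2 u v

/-- The series `w ↦ (-1)^{length w} f[w' p]`, where `w'` is the reversed word of `w`. -/
def revAppend (f : Ser (Fin 2) R) (p : List (Fin 2)) : Ser (Fin 2) R :=
  fun w => (-1) ^ w.length * f (w.reverse ++ p)

theorem tail_revAppend (f : Ser (Fin 2) R) (p : List (Fin 2)) (c : Fin 2) :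
    NCS.tail c (toNCS (revAppend f p)) = -toNCS (revAppend f (c :: p)) := by
  ext w
  rw [NCS.tail_apply, NCS.neg_apply, toNCS_apply, toNCS_apply, revAppend, revAppend, List.length_cons,
    List.reverse_cons, List.append_assoc, pow_succ]
  simp

/-- The partial antipode sums telescope: the recursion of the shuffle product removes one letter
after the other. -/
theorem IsGrouplike.revAppend_mul (hf : IsGrouplike f) (a : Fin 2) (p w : List (Fin 2)) :
    (toNCS (revAppend f (a :: p)) * toNCS f) w =
      linExt f (mono [a] * sh (mono p) (mono w)) := by
  have h0 : ∀ p, toNCS (revAppend f p) [] = f p := fun p => by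
    rw [toNCS_apply, revAppend]; simp
  induction w generalizing a p with
  | nil =>
    rw [NCS.mul_nil, h0, toNCS_apply, hf.1, mul_one, mono_nil, sh_one_right, ← mono_cons, linExt_mono]
  | cons c w ih =>
    rw [NCS.mul_cons, h0, tail_revAppend, neg_mul, NCS.neg_apply, ih, toNCS_apply,
      ← linExt_mono f (a :: p), ← linExt_mono f (c :: w), ← hf.linExt_sh, mono_cons a p, mono_cons c w,
      sh_letter_mul, map_add, add_neg_cancel_right]

/-- The antipode: the inverse of a grouplike series is obtained by reversing the words. -/
theorem IsGrouplike.inverse_apply (hf : IsGrouplike f) (w : List (Fin 2)) :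
    Ser.inverse f w = (-1) ^ w.length * f w.reverse := by
  have h1 : toNCS (revAppend f []) * toNCS f = 1 := by
    ext w
    cases w with
    | nil =>
      rw [NCS.mul_nil, toNCS_apply, toNCS_apply, revAppend, NCS.one_nil]
      simp [hf.1]
    | cons c w =>
      rw [NCS.mul_cons, tail_revAppend, neg_mul, NCS.neg_apply, hf.revAppend_mul, NCS.one_cons,
        mono_nil, sh_one_left, ← mono_cons, linExt_mono, toNCS_apply, toNCS_apply, revAppend]
      simp [hf.1]
  have h2 : toNCS (Ser.inverse f) = toNCS (revAppend f []) := by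
    rw [← one_mul (toNCS (Ser.inverse f)), ← h1, mul_assoc, mul_inverse_toNCS f hf.1, mul_one]
  have h3 := congrFun h2 w
  rw [toNCS_apply, toNCS_apply, revAppend, List.append_nil] at h3
  exact h3

theorem IsGrouplike.linExt_dsh (hf : IsGrouplike f) (h0 : f [0] = 0) (x : Hsh) :
    linExt f (dsh x) = 0 := by
  rw [dsh, hf.linExt_sh, linExt_mono, h0, zero_mul]

theorem sh_letter_replicate (a : Fin 2) (n : ℕ) :
    sh (mono [a]) (mono (List.replicate n a)) =
      ((n + 1 : ℕ) : ℚ) • mono (List.replicate (n + 1) a) := by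
  induction n with
  | zero => simp [mono_nil, sh_one_right]
  | succ n ih =>
    have h := sh_letter_mul a a 1 (mono (List.replicate n a))
    rw [mul_one, sh_one_left, ih, ← mono_cons] at h
    rw [List.replicate_succ, h]
    simp only [mul_smul_comm, ← mono_cons, ← List.replicate_succ]
    push_cast
    module

theorem IsGrouplike.replicate_eq_zero (hf : IsGrouplike f) {a : Fin 2} (ha : f [a] = 0) {n : ℕ}
    (hn : 1 ≤ n) : f (List.replicate n a) = 0 := by
  obtain ⟨n, rfl⟩ : ∃ m, n = m + 1 := ⟨n - 1, by omega⟩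
  have h := hf.linExt_sh (mono [a]) (mono (List.replicate n a))
  have h0 : ((n + 1 : ℕ) : ℚ) ≠ 0 := by positivity
  rw [sh_letter_replicate, map_smul, linExt_mono, linExt_mono, ha, zero_mul] at h
  exact (smul_eq_zero_iff_right h0).mp h

end Inverse

/-! ### The values of f⁻¹ e₁ f -/

section Conjugate

variable {R : Type*} [CommRing R]

/-- The restriction of a series to the words in the letters `y_s`. -/
def toY (f : Ser (Fin 2) R) : Ser ℕ+ R := fun w => f (toLetters w)

/-- The series `∑_w K[p w] w`. -/
def NCS.dropPrefix (p : List (Fin 2)) (K : NCS (Fin 2) R) : NCS (Fin 2) R := fun w => K (p ++ w)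

/-- The series in the letters `y_s` whose value on a word is the value of `K` on the same word
deprived of its last letter `e₁`. -/
def NCS.dropE1 (K : NCS (Fin 2) R) : NCS ℕ+ R :=
  fun w => if w = [] then 0 else K (toLetters w).dropLast

theorem NCS.dropE1_nil (K : NCS (Fin 2) R) : NCS.dropE1 K [] = 0 := if_pos rfl

theorem NCS.dropE1_append (K : NCS (Fin 2) R) (w : List ℕ+) (s : ℕ+) :
    NCS.dropE1 K (w ++ [s]) = K (toLetters w ++ List.replicate ((s : ℕ) - 1) 0) := by
  rw [NCS.dropE1, if_neg (by simp), toLetters_append, toLetters_cons]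
  simp [toLetters, ← List.append_assoc]

theorem mul_e1_mul_replicate (K g : NCS (Fin 2) R) (n : ℕ) (v : List (Fin 2)) :
    (K * NCS.e1L g) (List.replicate n 0 ++ 1 :: v) = K (List.replicate n 0) * g v +
      (NCS.dropPrefix (List.replicate n 0 ++ [1]) K * NCS.e1L g) v := by
  induction n generalizing K with
  | zero =>
    rw [List.replicate_zero, List.nil_append, NCS.mul_cons, NCS.e1L_cons, if_pos rfl]
    rfl
  | succ n ih =>
    rw [List.replicate_succ, List.cons_append, NCS.mul_cons, NCS.e1L_cons, if_neg (by decide),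
      mul_zero, zero_add, ih]
    rfl

theorem mul_e1_mul_toLetters (K : NCS (Fin 2) R) (g : Ser (Fin 2) R) (w : List ℕ+) :
    (K * NCS.e1L (toNCS g)) (toLetters w) = (NCS.dropE1 K * toNCS (toY g)) w := by
  induction w generalizing K with
  | nil =>
    have e : toLetters [] = [] := rfl
    rw [e, NCS.mul_nil, NCS.mul_nil, NCS.dropE1_nil, zero_mul, NCS.e1L_nil, mul_zero]
  | cons s w ih =>
    have e : NCS.tail s (NCS.dropE1 K) =
        NCS.const (K (List.replicate ((s : ℕ) - 1) 0)) +
          NCS.dropE1 (NCS.dropPrefix (List.replicate ((s : ℕ) - 1) 0 ++ [1]) K) := by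
      ext u
      rw [NCS.tail_apply, NCS.add_apply, ← List.singleton_append]
      rcases List.eq_nil_or_concat u with rfl | ⟨v, t, rfl⟩
      · have := NCS.dropE1_append K [] s
        rw [List.nil_append] at this
        rw [List.append_nil, this, NCS.dropE1_nil, NCS.const_nil, add_zero]
        rfl
      · rw [List.concat_eq_append, ← List.append_assoc, NCS.dropE1_append, NCS.dropE1_append,
          NCS.dropPrefix, List.singleton_append, toLetters_cons]
        have : (NCS.const (K (List.replicate ((s : ℕ) - 1) 0)) : NCS ℕ+ R) (v ++ [t]) = 0 := by
          cases v <;> rfl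
        rw [this, zero_add]
        simp
    rw [toLetters_cons, mul_e1_mul_replicate, ih, NCS.mul_cons, NCS.dropE1_nil, zero_mul, zero_add, e,
      add_mul, NCS.add_apply, NCS.const_mul_apply]
    rfl

variable [Algebra ℚ R] {f : Ser (Fin 2) R}

theorem linExt_invSer (g : Ser ℕ+ R) (x : Hst) : linExt (invSer g) x = linExt g (inv x) := by
  refine linMap_congr (F := linExt (invSer g)) (G := linExt g ∘ₗ inv) (fun w => ?_) x
  rw [linExt_mono]; rfl

theorem linExt_toY (f : Ser (Fin 2) R) (x : Hst) : linExt (toY f) x = linExt f (phi x) := by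
  refine linMap_congr (F := linExt (toY f)) (G := linExt f ∘ₗ phi) (fun w => ?_) x
  rw [linExt_mono, LinearMap.comp_apply, phi_mono, linExt_mono]; rfl

theorem coeff_iotaSer_invSer (g : Ser ℕ+ R) (w : List ℕ+) (n : ℕ) :
    PowerSeries.coeff n (iotaSer (invSer g) w) =
      linExt g (PowerSeries.coeff n (itilde (mono w))) := by
  rw [iotaSer, coeff_evalT, linExt_invSer, itilde, coeff_mapT]

/-- The values of `f⁻¹ e₁ f` at the words `e₀^n e₁ w` are given by the symmetrization of the
restriction of `f` to the words in the letters `y_s`. -/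
theorem IsGrouplike.conjE1_apply (hf : IsGrouplike f) (h0 : f [0] = 0) (n : ℕ) (w : List ℕ+) :
    conjE1 f (List.replicate n 0 ++ 1 :: toLetters w) =
      PowerSeries.coeff n (symStuffle (toY f) w) := by
  have e1 : ((NCS.const (Ser.inverse f (List.replicate n 0)) : NCS ℕ+ R) +
      NCS.dropE1 (NCS.dropPrefix (List.replicate n 0 ++ [1]) (toNCS (Ser.inverse f)))) =
      fun u => PowerSeries.coeff n (iotaSer (invSer (toY f)) u) := by
    ext u
    rw [NCS.add_apply, coeff_iotaSer_invSer]
    rcases List.eq_nil_or_concat u with rfl | ⟨v, t, rfl⟩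
    · rw [NCS.const_nil, NCS.dropE1_nil, add_zero, hf.inverse_apply, List.reverse_replicate,
        mono_nil, itilde_one, PowerSeries.coeff_one]
      split_ifs with hn
      · subst hn
        rw [← mono_nil, linExt_mono, toY, toLetters]
        simp
      · rw [hf.replicate_eq_zero h0 (by omega), mul_zero, map_zero]
    · have e : (NCS.const (Ser.inverse f (List.replicate n 0)) : NCS ℕ+ R) (v ++ [t]) = 0 := by
        cases v <;> rfl
      have h2 := (forall_dsh_eq_zero_iff f).mp (hf.linExt_dsh h0) (mono (t :: v.reverse)) n
      have ht := t.pos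
      rw [coeff_iota, phi_mono, mono_mul_mono, linExt_mono] at h2
      rw [List.concat_eq_append, e, zero_add, NCS.dropE1_append, NCS.dropPrefix, toNCS_apply,
        hf.inverse_apply, coeff_itilde, inv_mono, map_smul, map_smul, linExt_toY,
        List.reverse_append (as := v), List.reverse_singleton, List.singleton_append]
      have h3 : linExt f (phi (dpow dst n (mono (t :: v.reverse)))) =
          (-1 : ℚ) ^ n • f (toLetters (t :: v.reverse) ++ List.replicate n 0) := by
        rw [h2, map_smul, map_smul, smul_smul, ← mul_pow]
        simp
      have h4 : (List.replicate n 0 ++ [1] ++ (toLetters v ++ List.replicate ((t : ℕ) - 1) 0)).reverse =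
          toLetters (t :: v.reverse) ++ List.replicate n 0 := by
        have := reverse_e1_cons_toLetters v
        rw [List.append_assoc, ← List.append_assoc [1], List.singleton_append, List.reverse_append,
          List.reverse_append, this, toLetters_cons, List.reverse_replicate, List.reverse_replicate]
      have h5 : (List.replicate n 0 ++ [1] ++
          (toLetters v ++ List.replicate ((t : ℕ) - 1) (0 : Fin 2))).length =
          n + weight (v ++ [t]) := by
        have := length_toLetters v
        rw [weight_eq] at this
        simp only [List.length_append, List.length_replicate, List.length_singleton, weight_eq,
          List.map_append, List.sum_append, this, List.map_singleton, List.sum_singleton]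
        omega
      rw [h3, h4, h5, smul_smul, ← pow_add, add_comm (weight _), Algebra.smul_def, map_pow, map_neg,
        map_one]
  have e2 : toNCS (conjE1 f) = toNCS (Ser.inverse f) * NCS.e1L (toNCS f) := by
    rw [toNCS_conjE1, mul_assoc]; rfl
  have e3 : PowerSeries.coeff n (symStuffle (toY f) w) =
      (toNCS (fun u => PowerSeries.coeff n (iotaSer (invSer (toY f)) u)) * toNCS (toY f)) w := by
    rw [symStuffle_eq, Ser.mul, map_sum, NCS.mul_apply]
    simp only [PowerSeries.coeff_mul_C]
    rfl
  have e4 := congrFun e2 (List.replicate n 0 ++ 1 :: toLetters w)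
  rw [toNCS_apply] at e4
  rw [e4, mul_e1_mul_replicate, mul_e1_mul_toLetters, e3, ← NCS.const_mul_apply]
  have e5 : toNCS (fun u => PowerSeries.coeff n (iotaSer (invSer (toY f)) u)) = _ := e1.symm
  rw [e5, add_mul, NCS.add_apply, NCS.const_mul_apply, NCS.const_mul_apply]
  rfl

end Conjugate

/-! ### Multiplicativity of the symmetrization -/

section Multiplicativity

variable {R : Type*} [CommRing R] [Algebra ℚ R]

theorem invSer_mul (f g : Ser ℕ+ R) : invSer (Ser.mul f g) = Ser.mul (invSer g) (invSer f) := by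
  funext w
  rw [invSer_apply, Ser.mul, Ser.mul, Finset.mul_sum, List.length_reverse,
    ← Finset.sum_range_reflect]
  refine Finset.sum_congr rfl fun i hi => ?_
  have hi' : i ≤ w.length := by
    rw [Finset.mem_range] at hi; omega
  have hw : weight w = weight (w.take i) + weight (w.drop i) := by
    conv_lhs => rw [← List.take_append_drop i w]
    simp only [weight_eq, List.map_append, List.sum_append]
  rw [invSer_apply, invSer_apply, show w.length + 1 - 1 - i = w.length - i by omega,
    List.take_reverse, List.drop_reverse, show w.length - (w.length - i) = i by omega, hw, pow_add]
  ring

/-- The derivation of the ring of series in the letters `y_s` that is adjoint to `D`. -/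
noncomputable def dstAdj : Ser ℕ+ R →ₗ[ℚ] Ser ℕ+ R where
  toFun f w := linExt f (dst (mono w))
  map_add' f g := funext fun w => linExt_add_fun f g _
  map_smul' r f := funext fun w =>
    linMap_congr (F := linExt (r • f)) (G := r • linExt f)
      (fun w => by rw [LinearMap.smul_apply, linExt_mono, linExt_mono]; rfl) _

theorem dstAdj_apply (f : Ser ℕ+ R) (w : List ℕ+) : dstAdj f w = linExt f (dst (mono w)) := rfl

theorem dstAdj_nil (f : Ser ℕ+ R) : dstAdj f [] = 0 := by
  rw [dstAdj_apply, mono_nil, dst_one, map_zero]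

theorem dstAdj_cons (f : Ser ℕ+ R) (s : ℕ+) (w : List ℕ+) :
    dstAdj f (s :: w) = ((s : ℕ) : ℚ) • f ((s + 1) :: w) + dstAdj (fun u => f (s :: u)) w := by
  have e : (mono (s :: w) : Hst) = y s * mono w := mono_cons s w
  rw [dstAdj_apply, e, dst_letter_mul, map_add, map_smul, y, y, mono_mul_mono, linExt_mono]
  congr 1
  exact linExt_letter_mul (toNCS f) s _

theorem mul_cons_apply (f g : Ser ℕ+ R) (s : ℕ+) (w : List ℕ+) :
    Ser.mul f g (s :: w) = f [] * g (s :: w) + Ser.mul (fun u => f (s :: u)) g w :=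
  NCS.mul_cons (toNCS f) (toNCS g) s w

theorem dstAdj_mul (f g : Ser ℕ+ R) :
    dstAdj (Ser.mul f g) = Ser.mul (dstAdj f) g + Ser.mul f (dstAdj g) := by
  funext w
  rw [Pi.add_apply]
  induction w generalizing f with
  | nil => simp [dstAdj_nil, Ser.mul]
  | cons s w ih =>
    have e1 : (fun u => Ser.mul f g (s :: u)) =
        f [] • (fun u => g (s :: u)) + Ser.mul (fun u => f (s :: u)) g :=
      funext fun u => mul_cons_apply f g s u
    have e2 : dstAdj (f [] • fun u => g (s :: u)) w = f [] * dstAdj (fun u => g (s :: u)) w :=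
      linMap_congr (F := linExt (f [] • fun u => g (s :: u)))
        (G := LinearMap.mulLeft ℚ (f []) ∘ₗ linExt (fun u => g (s :: u)))
        (fun u => by
          rw [LinearMap.comp_apply, linExt_mono, linExt_mono]; rfl) _
    have e3 : (fun u => dstAdj f (s :: u)) =
        ((s : ℕ) : ℚ) • (fun u => f ((s + 1) :: u)) + dstAdj (fun u => f (s :: u)) :=
      funext fun u => dstAdj_cons f s u
    have e4 : Ser.mul (((s : ℕ) : ℚ) • (fun u => f ((s + 1) :: u)) + dstAdj (fun u => f (s :: u))) g
        w = ((s : ℕ) : ℚ) • Ser.mul (fun u => f ((s + 1) :: u)) g w +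
          Ser.mul (dstAdj fun u => f (s :: u)) g w := by
      simp only [Ser.mul, Pi.add_apply, Pi.smul_apply, add_mul, Finset.sum_add_distrib,
        smul_mul_assoc, Finset.smul_sum]
    rw [dstAdj_cons, e1, map_add, Pi.add_apply, e2, ih, mul_cons_apply, mul_cons_apply, mul_cons_apply,
      dstAdj_nil, zero_mul, zero_add, dstAdj_cons, e3, e4, mul_add, mul_smul_comm, smul_add]
    ring

theorem dpow_dstAdj (f : Ser ℕ+ R) (n : ℕ) (w : List ℕ+) :
    dpow dstAdj n f w = linExt f (dpow dst n (mono w)) := by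
  have e : ∀ n x, linExt (fun w => linExt f (dpow dst n (mono w))) x = linExt f (dpow dst n x) := by
    intro n x
    exact linMap_congr (F := linExt (fun w => linExt f (dpow dst n (mono w))))
      (G := linExt f ∘ₗ dpow dst n) (fun w => by rw [linExt_mono]; rfl) x
  have h := eq_dpow dstAdj (fun n w => linExt f (dpow dst n (mono w))) (fun n => by
    funext w
    rw [dstAdj_apply, e, ← dpow_succ', map_smul]
    rfl) n
  have h0 : (fun w => linExt f (dpow dst 0 (mono w))) = f := by
    funext w; rw [dpow_zero, linExt_mono]
  rw [h0] at h
  exact (congrFun h w).symm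

theorem coeff_iotaSer (f : Ser ℕ+ R) (w : List ℕ+) (n : ℕ) :
    PowerSeries.coeff n (iotaSer f w) = (-1 : ℚ) ^ n • dpow dstAdj n f w := by
  rw [iotaSer, coeff_evalT, coeff_iota, map_smul, dpow_dstAdj]

theorem iotaSer_mul (f g : Ser ℕ+ R) :
    iotaSer (Ser.mul f g) = Ser.mul (iotaSer f) (iotaSer g) := by
  have hB := dpow_leibniz (LinearMap.mk₂ ℚ (Ser.mul : Ser ℕ+ R → Ser ℕ+ R → Ser ℕ+ R)
    (fun f f' g => by funext w; simp [Ser.mul, add_mul, Finset.sum_add_distrib])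
    (fun r f g => by funext w; simp [Ser.mul, Finset.smul_sum])
    (fun f g g' => by funext w; simp [Ser.mul, mul_add, Finset.sum_add_distrib])
    (fun r f g => by funext w; simp [Ser.mul, Finset.smul_sum]))
    (D₁ := dstAdj) (D₂ := dstAdj) (D₃ := dstAdj) (fun f g => dstAdj_mul f g)
  funext w
  ext n
  have h := congrFun (hB n f g) w
  simp only [LinearMap.mk₂_apply, Finset.sum_apply] at h
  rw [coeff_iotaSer, h, Ser.mul, map_sum, Finset.smul_sum]
  simp only [PowerSeries.coeff_mul, Ser.mul, Finset.smul_sum]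
  rw [Finset.sum_comm]
  refine Finset.sum_congr rfl fun i _ => Finset.sum_congr rfl fun ij hij => ?_
  rw [coeff_iotaSer, coeff_iotaSer, smul_mul_smul_comm, ← pow_add,
    HasAntidiagonal.mem_antidiagonal.mp hij]

/-! ### Series supported on the powers of the letter y₁ -/

/-- The series `∑_n c_n y_1^n`. -/
def onesSer {S : Type*} [Zero S] (c : ℕ → S) : Ser ℕ+ S := fun w =>
  if ∀ a ∈ w, a = 1 then c w.length else 0

theorem onesSer_nil {S : Type*} [Zero S] (c : ℕ → S) : onesSer c [] = c 0 := by simp [onesSer]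

theorem onesSer_cons {S : Type*} [Zero S] (c : ℕ → S) (s : ℕ+) :
    (fun w => onesSer c (s :: w)) = if s = 1 then onesSer fun n => c (n + 1) else 0 := by
  funext w
  split_ifs with hs
  · subst hs; simp [onesSer]
  · simp [onesSer, hs]

theorem dstAdj_onesSer (c : ℕ → R) : dstAdj (onesSer c) = 0 := by
  funext w
  induction w generalizing c with
  | nil => rw [dstAdj_nil]; rfl
  | cons s w ih =>
    have e : onesSer c ((s + 1) :: w) = 0 := by
      rw [onesSer, if_neg]
      intro h
      have h1 := congrArg PNat.val (h (s + 1) List.mem_cons_self)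
      have := s.pos
      rw [PNat.val_ofNat, PNat.add_coe] at h1
      simp at h1
    rw [dstAdj_cons, e, smul_zero, zero_add, onesSer_cons]
    split_ifs
    · exact ih _
    · rw [map_zero]; rfl

theorem iotaSer_onesSer (c : ℕ → R) : iotaSer (onesSer c) = fun w => PowerSeries.C (onesSer c w) := by
  funext w
  ext n
  rw [coeff_iotaSer, PowerSeries.coeff_C]
  split_ifs with hn
  · subst hn; rw [dpow_zero, pow_zero, one_smul]
  · obtain ⟨m, rfl⟩ : ∃ m, n = m + 1 := ⟨n - 1, by omega⟩
    have h0 : ((m + 1 : ℕ) : ℚ) ≠ 0 := by positivity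
    have h : dpow dstAdj (m + 1) (onesSer c) = 0 := by
      refine (smul_eq_zero_iff_right h0).mp ?_
      rw [dpow_succ', dstAdj_onesSer, map_zero]
    rw [h, Pi.zero_apply, smul_zero]

theorem invSer_onesSer (c : ℕ → R) : invSer (onesSer c) = onesSer fun n => (-1) ^ n * c n := by
  funext w
  rw [invSer_apply, onesSer, onesSer, List.length_reverse]
  simp only [List.mem_reverse]
  split_ifs with h
  · have e : weight w = w.length := by
      rw [weight_eq, List.eq_replicate_of_mem h]; simp
    rw [e]
  · rw [mul_zero]

theorem onesSer_mul_onesSer (c d : ℕ → R) : Ser.mul (onesSer c) (onesSer d) =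
    onesSer fun n => ∑ ij ∈ antidiagonal n, c ij.1 * d ij.2 := by
  funext w
  induction w generalizing c with
  | nil => rw [onesSer_nil]; simp [Ser.mul, onesSer_nil]
  | cons s w ih =>
    rw [mul_cons_apply, onesSer_cons, onesSer_nil]
    split_ifs with hs
    · rw [ih]
      subst hs
      simp only [onesSer, List.mem_cons, forall_eq_or_imp, true_and, List.length_cons]
      split_ifs
      · rw [Finset.Nat.sum_antidiagonal_succ]
      · rw [mul_zero, add_zero]
    · have e : Ser.mul (0 : Ser ℕ+ R) (onesSer d) w = 0 := by simp [Ser.mul]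
      rw [e]
      simp [onesSer, hs]

/-- The value of a product `(∑_n c_n y_1^n) g` at `y_1^n v`, if `v` does not start with `y_1`. -/
theorem onesSer_mul_replicate_append (c : ℕ → R) (g : Ser ℕ+ R) (n : ℕ) (v : List ℕ+)
    (hv : ∀ s u, v = s :: u → s ≠ 1) :
    Ser.mul (onesSer c) g (List.replicate n 1 ++ v) =
      ∑ ij ∈ antidiagonal n, c ij.1 * g (List.replicate ij.2 1 ++ v) := by
  induction n generalizing c with
  | zero =>
    rcases v with _ | ⟨s, u⟩
    · simp [Ser.mul, onesSer_nil]
    · have e : Ser.mul (0 : Ser ℕ+ R) g u = 0 := by simp [Ser.mul]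
      rw [List.replicate_zero, List.nil_append, mul_cons_apply, onesSer_cons, if_neg (hv s u rfl), e,
        onesSer_nil]
      simp
  | succ n ih =>
    rw [List.replicate_succ, List.cons_append, mul_cons_apply, onesSer_cons, if_pos rfl, ih,
      Finset.Nat.sum_antidiagonal_succ, onesSer_nil]
    rfl

/-- The symmetrization of `(∑_n c_n y_1^n) g`. -/
theorem symStuffle_onesSer_mul (c : ℕ → R) (g : Ser ℕ+ R) :
    symStuffle (Ser.mul (onesSer c) g) = Ser.mul (iotaSer (invSer g)) (Ser.mul
      (fun w => PowerSeries.C (onesSer (fun n => ∑ ij ∈ antidiagonal n,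
        (-1) ^ ij.1 * c ij.1 * c ij.2) w)) (fun w => PowerSeries.C (g w))) := by
  have hC : ∀ f g : Ser ℕ+ R, (fun w => PowerSeries.C (Ser.mul f g w)) =
      Ser.mul (fun w => (PowerSeries.C (f w) : PowerSeries R)) (fun w => PowerSeries.C (g w)) := by
    intro f g
    funext w
    simp only [Ser.mul, map_sum, map_mul]
  have hassoc : ∀ f g h : Ser ℕ+ (PowerSeries R),
      Ser.mul (Ser.mul f g) h = Ser.mul f (Ser.mul g h) := fun f g h =>
    mul_assoc (toNCS f) (toNCS g) (toNCS h)
  rw [symStuffle_eq, invSer_mul, iotaSer_mul, invSer_onesSer, iotaSer_onesSer, hC, hassoc,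
    ← hassoc (fun w => PowerSeries.C (onesSer _ w)), ← hC, onesSer_mul_onesSer]

end Multiplicativity

/-! ### The comparison of the two regularizations -/

section Comparison

/-- The part of `y_1^j * y_s x` that starts with `y_s` or `y_{s+1}`. -/
noncomputable def stTail (s : ℕ+) (x : Hst) : ℕ → Hst
  | 0 => y s * x
  | j + 1 => y s * st (y 1 ^ (j + 1)) x + y (s + 1) * st (y 1 ^ j) x

theorem st_y_one_pow (n : ℕ) (s : ℕ+) (x : Hst) :
    st (y 1 ^ n) (y s * x) = ∑ ij ∈ antidiagonal n, y 1 ^ ij.1 * stTail s x ij.2 := by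
  induction n with
  | zero => simp [st_one_left, stTail]
  | succ n ih =>
    rw [Finset.Nat.sum_antidiagonal_succ, pow_succ', st_letter_mul, ih, ← pow_succ', add_assoc,
      add_comm, add_comm 1 s, pow_zero, one_mul, stTail, Finset.mul_sum]
    simp only [pow_succ', mul_assoc]

variable {R : Type*} [CommRing R] [Algebra ℚ R] {fst : Ser ℕ+ R} {fsh : Ser (Fin 2) R}

theorem mono_replicate_one (n : ℕ) : (mono (List.replicate n 1) : Hst) = y 1 ^ n := by
  induction n with
  | zero => rw [pow_zero, List.replicate_zero, mono_nil]
  | succ n ih => rw [pow_succ', List.replicate_succ, mono_cons, ih]; rfl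

theorem toLetters_replicate_one (n : ℕ) :
    toLetters (List.replicate n 1) = List.replicate n 1 := by
  induction n with
  | zero => rfl
  | succ n ih => rw [List.replicate_succ, toLetters_cons, ih]; rfl

theorem two_le_of_ne_one {s : ℕ+} (hs : s ≠ 1) : 2 ≤ s := by
  have h1 := s.pos
  have h2 : (s : ℕ) ≠ 1 := fun h => hs (PNat.eq h)
  change 2 ≤ (s : ℕ)
  omega

theorem RegDoubleShuffle.linExt_y_mul (h : RegDoubleShuffle fst fsh) {s : ℕ+} (hs : 2 ≤ s)
    (x : Hst) : linExt fst (y s * x) = linExt (toY fsh) (y s * x) := by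
  refine linMap_congr (F := linExt fst ∘ₗ LinearMap.mulLeft ℚ (y s))
    (G := linExt (toY fsh) ∘ₗ LinearMap.mulLeft ℚ (y s)) (fun w => ?_) x
  rw [LinearMap.comp_apply, LinearMap.comp_apply, LinearMap.mulLeft_apply, y, mono_mul_mono,
    linExt_mono, linExt_mono]
  exact h.agree s w hs

theorem RegDoubleShuffle.linExt_st (h : RegDoubleShuffle fst fsh) (x : Hst) {s : ℕ+} (hs : 2 ≤ s)
    (z : Hst) : linExt (toY fsh) (st x (y s * z)) =
      linExt (toY fsh) x * linExt (toY fsh) (y s * z) := by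
  rw [linExt_toY, linExt_toY, linExt_toY, ← h.shuffle.linExt_sh]
  refine bilin_congr (F := (st.compl₂ (LinearMap.mulLeft ℚ (y s))).compr₂ (linExt fsh ∘ₗ phi))
    (G := (sh.compl₁₂ phi (phi ∘ₗ LinearMap.mulLeft ℚ (y s))).compr₂ (linExt fsh))
    (fun u v => ?_) x z
  have h1 := h.reg u s v hs
  rw [map_sub, sub_eq_zero] at h1
  have e : (mono (s :: v) : Hst) = y s * mono v := mono_cons s v
  rw [e] at h1
  exact h1.symm

theorem RegDoubleShuffle.toY_one_pow (h : RegDoubleShuffle fst fsh) {n : ℕ} (hn : 1 ≤ n) :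
    toY fsh (List.replicate n 1) = 0 := by
  rw [toY, toLetters_replicate_one]
  exact h.shuffle.replicate_eq_zero h.sh_e1 hn

theorem RegDoubleShuffle.linExt_one_pow_mul (h : RegDoubleShuffle fst fsh) (n : ℕ) {s : ℕ+}
    (hs : 2 ≤ s) (x : Hst) : linExt fst (y 1 ^ n * (y s * x)) =
      ∑ ij ∈ antidiagonal n, fst (List.replicate ij.1 1) *
        linExt (toY fsh) (y 1 ^ ij.2 * (y s * x)) := by
  induction n using Nat.strong_induction_on generalizing s x with
  | _ n ih =>
  have hs1 : 2 ≤ s + 1 := hs.trans (PNat.lt_add_right s 1).le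
  -- the defect of the formula at `y_1^i c_j`, where `c_j` is the tail of `y_1^j * y_s x`
  set δ : ℕ → Hst → R := fun i z => linExt fst (y 1 ^ i * z) -
    ∑ kl ∈ antidiagonal i, fst (List.replicate kl.1 1) * linExt (toY fsh) (y 1 ^ kl.2 * z) with hδ
  have hadd : ∀ i z z', δ i (z + z') = δ i z + δ i z' := by
    intro i z z'
    simp only [hδ, mul_add, map_add, Finset.sum_add_distrib]
    ring
  have hz : ∀ i < n, ∀ j, δ i (stTail s x j) = 0 := by
    intro i hi j
    rcases j with _ | j
    · rw [stTail]; exact sub_eq_zero.mpr (ih i hi hs x)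
    · have h1 := sub_eq_zero.mpr (ih i hi hs (st (y 1 ^ (j + 1)) x))
      have h2 := sub_eq_zero.mpr (ih i hi hs1 (st (y 1 ^ j) x))
      rw [stTail, hadd]
      exact (congrArg₂ (· + ·) h1 h2).trans (add_zero 0)
  have hst : ∑ ij ∈ antidiagonal n, linExt fst (y 1 ^ ij.1 * stTail s x ij.2) =
      fst (List.replicate n 1) * linExt (toY fsh) (y s * x) := by
    rw [← map_sum, ← st_y_one_pow, h.stuffle, h.linExt_y_mul hs, ← mono_replicate_one, linExt_mono]
  have hsh : ∀ m, ∑ ij ∈ antidiagonal m, linExt (toY fsh) (y 1 ^ ij.1 * stTail s x ij.2) =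
      if m = 0 then linExt (toY fsh) (y s * x) else 0 := by
    intro m
    rw [← map_sum, ← st_y_one_pow, h.linExt_st _ hs, ← mono_replicate_one, linExt_mono]
    split_ifs with hm
    · subst hm
      rw [toY, toLetters_replicate_one, List.replicate_zero, h.shuffle.1, one_mul]
    · rw [h.toY_one_pow (by omega), zero_mul]
  have hsum : ∑ ij ∈ antidiagonal n, δ ij.1 (stTail s x ij.2) = 0 := by
    have e := sum_antidiagonal_assoc n fun k l j =>
      fst (List.replicate k 1) * linExt (toY fsh) (y 1 ^ l * stTail s x j)
    simp only [hδ, Finset.sum_sub_distrib, hst]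
    rw [e]
    simp only [← Finset.mul_sum, hsh]
    rw [Finset.sum_eq_single (n, 0)]
    · simp
    · rintro ⟨i, j⟩ hij hne
      rw [HasAntidiagonal.mem_antidiagonal] at hij
      rw [if_neg, mul_zero]
      rintro rfl
      exact hne (by simpa using hij)
    · simp
  rw [Finset.sum_eq_single (n, 0)] at hsum
  · rw [stTail] at hsum
    exact sub_eq_zero.mp hsum
  · rintro ⟨i, j⟩ hij hne
    rw [HasAntidiagonal.mem_antidiagonal] at hij
    refine hz i ?_ j
    rcases Nat.eq_zero_or_pos j with rfl | hj
    · exact absurd (by simpa using hij) hne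
    · simp only at hij; omega
  · simp

theorem exists_eq_replicate_one_append (w : List ℕ+) :
    ∃ n v, w = List.replicate n 1 ++ v ∧ ∀ s u, v = s :: u → s ≠ 1 := by
  induction w with
  | nil => exact ⟨0, [], rfl, fun _ _ h => by cases h⟩
  | cons a w ih =>
    by_cases ha : a = 1
    · obtain ⟨n, v, rfl, hv⟩ := ih
      exact ⟨n + 1, v, by rw [ha, List.replicate_succ, List.cons_append], hv⟩
    · refine ⟨0, a :: w, rfl, fun s u h => ?_⟩
      rw [List.cons.injEq] at h
      exact h.1 ▸ ha

/-- The two regularizations differ by a series in `y_1`. -/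
theorem RegDoubleShuffle.eq_onesSer_mul (h : RegDoubleShuffle fst fsh) :
    fst = Ser.mul (onesSer fun n => fst (List.replicate n 1)) (toY fsh) := by
  funext w
  obtain ⟨n, v, rfl, hv⟩ := exists_eq_replicate_one_append w
  rw [onesSer_mul_replicate_append _ _ _ _ hv]
  rcases v with _ | ⟨s, u⟩
  · simp only [List.append_nil]
    rw [Finset.sum_eq_single (n, 0)]
    · rw [toY, toLetters_replicate_one, List.replicate_zero, h.shuffle.1, mul_one]
    · rintro ⟨i, j⟩ hij hne
      rw [HasAntidiagonal.mem_antidiagonal] at hij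
      rw [h.toY_one_pow, mul_zero]
      rcases Nat.eq_zero_or_pos j with rfl | hj
      · exact absurd (by simpa using hij) hne
      · exact hj
    · simp
  · have e : ∀ j, (mono (List.replicate j 1 ++ s :: u) : Hst) = y 1 ^ j * (y s * mono u) := by
      intro j
      rw [← mono_mul_mono, mono_replicate_one, mono_cons]; rfl
    have := h.linExt_one_pow_mul n (two_le_of_ne_one (hv s u rfl)) (mono u)
    simp only [← e, linExt_mono] at this
    exact this

end Comparison

/-! ### The values at the words y_n and y₁ⁿ -/

section Newton

/-- The sum of the words with `m` letters `y_1` and one letter `y_i`. -/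
noncomputable def insertY (i : ℕ+) : ℕ → Hst
  | 0 => y i
  | m + 1 => y i * y 1 ^ (m + 1) + y 1 * insertY i m

theorem st_y_one_pow_succ (i : ℕ+) (m : ℕ) :
    st (y i) (y 1 ^ (m + 1)) = insertY i (m + 1) + insertY (i + 1) m := by
  have hst : ∀ m, st (y i) (y 1 ^ (m + 1)) =
      y i * y 1 ^ (m + 1) + y 1 * st (y i) (y 1 ^ m) + y (i + 1) * y 1 ^ m := by
    intro m
    have h := st_letter_mul i 1 1 (y 1 ^ m)
    rwa [mul_one, st_one_left, st_one_left, ← pow_succ'] at h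
  induction m with
  | zero =>
    rw [hst, pow_zero, st_one_right, insertY, insertY, insertY, mul_one]
  | succ m ih =>
    rw [hst, ih, insertY, insertY, insertY, insertY, mul_add]
    abel

theorem insertY_one (m : ℕ) : insertY 1 m = ((m + 1 : ℕ) : ℚ) • y 1 ^ (m + 1) := by
  induction m with
  | zero => simp [insertY]
  | succ m ih =>
    rw [insertY, ih, mul_smul_comm, ← pow_succ']
    push_cast
    module

variable {R : Type*} [CommRing R] [Algebra ℚ R]

/-- Newton's identities. -/
theorem StuffleRel.newton {f : Ser ℕ+ R} (hf : StuffleRel f) (hf1 : f [] = 1) (m : ℕ) :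
    ((m + 1 : ℕ) : ℚ) • f (List.replicate (m + 1) 1) =
      ∑ ij ∈ antidiagonal m, (-1) ^ ij.1 * f [Nat.succPNat ij.1] * f (List.replicate ij.2 1) := by
  have key : ∀ m i, linExt f (insertY (Nat.succPNat i) m) = ∑ ab ∈ antidiagonal m,
      (-1) ^ ab.1 * f [Nat.succPNat (i + ab.1)] * f (List.replicate ab.2 1) := by
    intro m
    induction m with
    | zero => intro i; simp [insertY, y, linExt_mono, hf1]
    | succ m ih =>
      intro i
      have h1 := hf (y (Nat.succPNat i)) (y 1 ^ (m + 1))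
      have e : Nat.succPNat i + 1 = Nat.succPNat (i + 1) := rfl
      rw [st_y_one_pow_succ, map_add, e, ih, y, linExt_mono, ← mono_replicate_one, linExt_mono] at h1
      rw [eq_sub_of_add_eq h1, Finset.Nat.sum_antidiagonal_succ, sub_eq_add_neg, ← Finset.sum_neg_distrib,
        pow_zero, one_mul, add_zero]
      congr 1
      refine Finset.sum_congr rfl fun ab _ => ?_
      rw [pow_succ, show i + (ab.1 + 1) = i + 1 + ab.1 by ring]
      ring
  have h := key m 0
  have e : Nat.succPNat 0 = 1 := rfl
  rw [e, insertY_one, map_smul, ← mono_replicate_one, linExt_mono] at h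
  simpa using h

/-- The word `e₀^i e₁`, that is, the letter `y_{i+1}`. -/
noncomputable def eWord (i : ℕ) : Hsh := mono (List.replicate i 0) * mono [1]

theorem eWord_zero : eWord 0 = mono [1] := by rw [eWord, List.replicate_zero, mono_nil, one_mul]

theorem eWord_succ (i : ℕ) : eWord (i + 1) = mono [0] * eWord i := by
  rw [eWord, eWord, List.replicate_succ, mono_cons 0 (List.replicate i 0), mul_assoc]

theorem phi_y_succPNat (i : ℕ) : phi (y (Nat.succPNat i)) = eWord i := by
  rw [phi_y, eWord]; rfl

theorem sh_eWord_zero_zero : sh (eWord 0) (eWord 0) = (2 : ℚ) • (mono [1] * eWord 0) := by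
  have h := sh_letter_mul 1 1 1 1
  rw [mul_one, sh_one_left, sh_one_right] at h
  rw [eWord_zero, h, two_smul]

theorem sh_eWord_zero_succ (j : ℕ) : sh (eWord 0) (eWord (j + 1)) =
    mono [1] * eWord (j + 1) + mono [0] * sh (eWord 0) (eWord j) := by
  have h := sh_letter_mul 1 0 1 (eWord j)
  rw [mul_one, sh_one_left, ← eWord_succ] at h
  rw [eWord_zero, h]

theorem sh_eWord_succ_zero (i : ℕ) : sh (eWord (i + 1)) (eWord 0) =
    mono [0] * sh (eWord i) (eWord 0) + mono [1] * eWord (i + 1) := by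
  have h := sh_letter_mul 0 1 (eWord i) 1
  rw [mul_one, sh_one_right, ← eWord_succ] at h
  rw [eWord_zero, h]

theorem sh_eWord_succ_succ (i j : ℕ) : sh (eWord (i + 1)) (eWord (j + 1)) =
    mono [0] * sh (eWord i) (eWord (j + 1)) + mono [0] * sh (eWord (i + 1)) (eWord j) := by
  rw [eWord_succ, eWord_succ, sh_letter_mul]

/-- The part of `e₀^i e₁ ⧢ e₀^j e₁` whose first letter comes from the first word. -/
noncomputable def shLeft : ℕ → ℕ → Hsh
  | 0, j => mono [1] * eWord j
  | i + 1, j => mono [0] * sh (eWord i) (eWord j)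

theorem sh_eWord (i j : ℕ) : sh (eWord i) (eWord j) = shLeft i j + shLeft j i := by
  rcases i with _ | i <;> rcases j with _ | j
  · rw [sh_eWord_zero_zero, shLeft, two_smul]
  · rw [sh_eWord_zero_succ, shLeft, shLeft, sh_comm (eWord j)]
  · rw [sh_eWord_succ_zero, shLeft, shLeft]
  · rw [sh_eWord_succ_succ, shLeft, shLeft, sh_comm (eWord j)]

theorem sum_sh_eWord (m : ℕ) :
    ∑ ij ∈ antidiagonal m, (-1 : ℚ) ^ ij.1 • sh (eWord ij.1) (eWord ij.2) =
      (1 + (-1 : ℚ) ^ m) • (mono [1] * eWord m) := by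
  rcases m with _ | m
  · simp [sh_eWord_zero_zero]; norm_num
  · simp only [sh_eWord, smul_add, Finset.sum_add_distrib]
    rw [Finset.Nat.sum_antidiagonal_succ, Finset.Nat.sum_antidiagonal_succ' (n := m)]
    simp only [shLeft]
    have e : ∑ ij ∈ antidiagonal m, (-1 : ℚ) ^ (ij.1 + 1) • (mono [0] * sh (eWord ij.1) (eWord ij.2)) =
        -∑ ij ∈ antidiagonal m, (-1 : ℚ) ^ ij.1 • (mono [0] * sh (eWord ij.2) (eWord ij.1)) := by
      rw [← Finset.sum_neg_distrib]
      refine Finset.sum_congr rfl fun ij _ => ?_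
      rw [pow_succ, sh_comm (eWord ij.2)]
      module
    rw [e]
    module

theorem sh_eWord_zero (m : ℕ) : sh (eWord 0) (eWord m) =
    ∑ ij ∈ antidiagonal m, eWord ij.1 * eWord ij.2 + eWord m * eWord 0 := by
  induction m with
  | zero =>
    rw [sh_eWord_zero_zero, two_smul, eWord_zero, Finset.Nat.antidiagonal_zero, Finset.sum_singleton,
      eWord_zero]
  | succ m ih =>
    rw [sh_eWord_zero_succ, ih, Finset.Nat.sum_antidiagonal_succ, mul_add, Finset.mul_sum]
    simp only [eWord_succ, eWord_zero, mul_assoc, add_assoc]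

variable {fst : Ser ℕ+ R} {fsh : Ser (Fin 2) R}

/-- The double shuffle relations in depth two. -/
theorem RegDoubleShuffle.depth_two (h : RegDoubleShuffle fst fsh) (i j : ℕ) (hj : 1 ≤ j) :
    linExt fsh (eWord i) * linExt fsh (eWord j) = linExt fsh (eWord i * eWord j) +
      linExt fsh (eWord j * eWord i) + linExt fsh (eWord (i + j + 1)) := by
  have hs : 2 ≤ Nat.succPNat j := by
    change 2 ≤ j + 1
    omega
  have h1 := h.linExt_st (y (Nat.succPNat i)) hs 1
  have h2 := st_letter_mul (Nat.succPNat i) (Nat.succPNat j) 1 1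
  have e : Nat.succPNat i + Nat.succPNat j = Nat.succPNat (i + j + 1) := by
    apply PNat.eq
    simp only [PNat.add_coe, Nat.succPNat_coe]
    omega
  rw [mul_one, mul_one, st_one_left, st_one_right, st_one_left, mul_one, e] at h2
  rw [mul_one, h2, linExt_toY, linExt_toY, linExt_toY, map_add, map_add, map_add, map_add,
    phi_mul, phi_mul, phi_y_succPNat, phi_y_succPNat, phi_y_succPNat] at h1
  exact h1.symm

/-- The values at the words `y_{2n}` are multiples of the value at `y_2`. -/
theorem RegDoubleShuffle.even_mem (h : RegDoubleShuffle fst fsh) (n : ℕ) :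
    linExt fsh (eWord (2 * n + 1)) ∈ Ideal.span {fsh [0, 1]} := by
  induction n using Nat.strong_induction_on with
  | _ n ih =>
  rcases Nat.eq_zero_or_pos n with rfl | hn
  · have e : eWord 1 = mono [0, 1] := by rw [eWord_succ, eWord_zero, mono_mul_mono]; rfl
    rw [mul_zero, zero_add, e, linExt_mono]
    exact Ideal.mem_span_singleton_self _
  -- with `a_i` the value at `y_{i+1}` and `b_{ij}` that at `y_{i+1} y_{j+1}`: the alternating sum
  -- of the `a_i a_j` with `i + j = 2n` is `2 b_{0,2n}` by the shuffle product, and their sum is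
  -- `2 ∑ b_{ij} + (2n+1) a_{2n+1}` by the stuffle product; the relations for `y_1` and `y_{2n+1}`
  -- eliminate the `b_{ij}`, and only the `a_i a_j` with `i` and `j` odd remain
  set a : ℕ → R := fun i => linExt fsh (eWord i) with ha
  set b : ℕ → ℕ → R := fun i j => linExt fsh (eWord i * eWord j) with hb
  have a0 : a 0 = 0 := by rw [ha]; dsimp only; rw [eWord_zero, linExt_mono, h.sh_e1]
  have hst : ∀ ij ∈ antidiagonal (2 * n), a ij.1 * a ij.2 = b ij.1 ij.2 + b ij.2 ij.1 + a (2 * n + 1) := by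
    rintro ⟨i, j⟩ hij
    rw [HasAntidiagonal.mem_antidiagonal] at hij
    simp only at hij ⊢
    rw [← hij]
    rcases Nat.eq_zero_or_pos j with rfl | hj
    · have := h.depth_two 0 i (by omega)
      rw [mul_comm (a i), add_comm (b i 0), add_zero]
      rwa [zero_add] at this
    · exact h.depth_two i j hj
  have h1 : ∑ ij ∈ antidiagonal (2 * n), (-1) ^ ij.1 * (a ij.1 * a ij.2) = 2 * b 0 (2 * n) := by
    have := congrArg (linExt fsh) (sum_sh_eWord (2 * n))
    rw [map_sum, map_smul, ← eWord_zero] at this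
    simp only [map_smul, h.shuffle.linExt_sh] at this
    rw [pow_mul, neg_one_sq, one_pow, one_add_one_eq_two, Algebra.smul_def, map_ofNat] at this
    rw [← this]
    refine Finset.sum_congr rfl fun ij _ => ?_
    rw [Algebra.smul_def, map_pow, map_neg, map_one]
  have h2 : ∑ ij ∈ antidiagonal (2 * n), b ij.1 ij.2 + b (2 * n) 0 = 0 := by
    have := congrArg (linExt fsh) (sh_eWord_zero (2 * n))
    rw [h.shuffle.linExt_sh, map_add, map_sum] at this
    exact this.symm.trans (by rw [show linExt fsh (eWord 0) = 0 from a0, zero_mul])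
  have h3 : b 0 (2 * n) + b (2 * n) 0 + a (2 * n + 1) = 0 := by
    have := hst (0, 2 * n) (by simp)
    rw [← this]
    simp only [a0, zero_mul]
  have h4 : ∑ ij ∈ antidiagonal (2 * n), a ij.1 * a ij.2 =
      2 * ∑ ij ∈ antidiagonal (2 * n), b ij.1 ij.2 + (2 * n + 1 : ℕ) * a (2 * n + 1) := by
    rw [Finset.sum_congr rfl hst, Finset.sum_add_distrib, Finset.sum_add_distrib,
      Finset.sum_const, Finset.Nat.card_antidiagonal, nsmul_eq_mul]
    have := Finset.Nat.sum_antidiagonal_swap (n := 2 * n) (f := fun ij => b ij.1 ij.2)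
    simp only [Prod.fst_swap, Prod.snd_swap] at this
    rw [this]
    ring
  have h5 : ((2 * n + 3 : ℕ) : ℚ) • a (2 * n + 1) =
      ∑ ij ∈ antidiagonal (2 * n), (1 - (-1) ^ ij.1) * (a ij.1 * a ij.2) := by
    simp only [sub_mul, one_mul, Finset.sum_sub_distrib, h1, h4]
    rw [Algebra.smul_def, map_natCast]
    push_cast
    linear_combination (-2) * h2 + 2 * h3
  have h6 : ∑ ij ∈ antidiagonal (2 * n), (1 - (-1) ^ ij.1) * (a ij.1 * a ij.2) ∈
      Ideal.span {fsh [0, 1]} := by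
    refine Ideal.sum_mem _ fun ij hij => ?_
    rw [HasAntidiagonal.mem_antidiagonal] at hij
    rcases Nat.even_or_odd ij.1 with he | ⟨k, hk⟩
    · rw [he.neg_one_pow, sub_self, zero_mul]
      exact Ideal.zero_mem _
    · refine Ideal.mul_mem_left _ _ (Ideal.mul_mem_right _ _ ?_)
      rw [hk]
      exact ih k (by omega)
  have h7 : a (2 * n + 1) = algebraMap ℚ R ((2 * n + 3 : ℕ) : ℚ)⁻¹ *
      (((2 * n + 3 : ℕ) : ℚ) • a (2 * n + 1)) := by
    rw [← Algebra.smul_def, smul_smul, inv_mul_cancel₀ (by positivity), one_smul]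
  change a (2 * n + 1) ∈ _
  rw [h7, h5]
  exact Ideal.mul_mem_left _ _ h6

theorem RegDoubleShuffle.apply_singleton (h : RegDoubleShuffle fst fsh) (i : ℕ) :
    fst [Nat.succPNat i] = linExt fsh (eWord i) := by
  rcases i with _ | i
  · rw [eWord_zero, linExt_mono, h.sh_e1]; exact h.st_y1
  · rw [h.agree _ _ (by change 2 ≤ i + 1 + 1; omega), ← linExt_mono fsh, ← phi_mono]
    exact congrArg _ (phi_y_succPNat _)

/-- The even power sums vanish modulo the value at `y_2`, so that `Λ(-x) Λ(x) = 1` for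
`Λ(x) = ∑_n f_*(y_1^n) x^n`. -/
theorem RegDoubleShuffle.sum_antidiagonal_mem (h : RegDoubleShuffle fst fsh) {m : ℕ} (hm : 1 ≤ m) :
    ∑ ij ∈ antidiagonal m, (-1) ^ ij.1 * fst (List.replicate ij.1 1) * fst (List.replicate ij.2 1) ∈
      Ideal.span {fsh [0, 1]} := by
  set I := Ideal.span {fsh [0, 1]}
  set c : ℕ → R := fun n => fst (List.replicate n 1) with hc
  set q : ℕ → R := fun n => fst [Nat.succPNat n] with hq
  obtain ⟨m, rfl⟩ : ∃ k, m = k + 1 := ⟨m - 1, by omega⟩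
  have hN : ∀ n, ((n + 1 : ℕ) : R) * c (n + 1) = ∑ ij ∈ antidiagonal n, (-1) ^ ij.1 * q ij.1 * c ij.2 := by
    intro n
    have := h.stuffle.newton h.stuffle_one n
    rw [Algebra.smul_def, map_natCast] at this
    exact this
  set P : PowerSeries R := PowerSeries.mk fun n => (-1) ^ n * q n with hP
  set P' : PowerSeries R := PowerSeries.mk fun n => q n with hP'
  set L : PowerSeries R := PowerSeries.mk c with hL
  set L' : PowerSeries R := PowerSeries.mk fun n => (-1) ^ n * c n with hL'
  have dL : PowerSeries.derivative R L = P * L := by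
    ext n
    rw [PowerSeries.coeff_derivative, PowerSeries.coeff_mul, hL, PowerSeries.coeff_mk, hP, mul_comm]
    simp only [PowerSeries.coeff_mk]
    exact_mod_cast hN n
  have dL' : PowerSeries.derivative R L' = -(P' * L') := by
    ext n
    rw [PowerSeries.coeff_derivative, map_neg, PowerSeries.coeff_mul, hL', PowerSeries.coeff_mk, hP']
    simp only [PowerSeries.coeff_mk]
    have := hN n
    push_cast at this
    rw [mul_assoc, mul_comm (c (n + 1)), this, Finset.mul_sum, ← Finset.sum_neg_distrib]
    refine Finset.sum_congr rfl fun ij hij => ?_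
    rw [← HasAntidiagonal.mem_antidiagonal.mp hij]
    have e : ((-1 : R) ^ ij.1) * (-1) ^ ij.1 = 1 := by rw [← mul_pow]; simp
    rw [pow_succ, pow_add]
    linear_combination (-(-1) ^ ij.2 * q ij.1 * c ij.2) * e
  have dM : PowerSeries.derivative R (L' * L) = (P - P') * (L' * L) := by
    rw [Derivation.leibniz, dL, dL', smul_eq_mul, smul_eq_mul]
    ring
  have hPI : ∀ n, PowerSeries.coeff n (P - P') ∈ I := by
    intro n
    rw [map_sub, hP, hP', PowerSeries.coeff_mk, PowerSeries.coeff_mk, ← sub_one_mul]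
    rcases Nat.even_or_odd n with he | ⟨k, hk⟩
    · rw [he.neg_one_pow, sub_self, zero_mul]
      exact Ideal.zero_mem _
    · refine Ideal.mul_mem_left _ _ ?_
      rw [hq]
      dsimp only
      rw [h.apply_singleton, hk]
      exact h.even_mem k
  have hM := congrArg (PowerSeries.coeff m) dM
  rw [PowerSeries.coeff_derivative, PowerSeries.coeff_mul m] at hM
  have hmem : PowerSeries.coeff (m + 1) (L' * L) * ((m : R) + 1) ∈ I := by
    rw [hM]
    exact Ideal.sum_mem _ fun ij _ => Ideal.mul_mem_right _ _ (hPI _)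
  have e1 : PowerSeries.coeff (m + 1) (L' * L) = algebraMap ℚ R ((m + 1 : ℕ) : ℚ)⁻¹ *
      (PowerSeries.coeff (m + 1) (L' * L) * ((m : R) + 1)) := by
    have : algebraMap ℚ R ((m + 1 : ℕ) : ℚ)⁻¹ * ((m : R) + 1) = 1 := by
      have e : ((m : R) + 1) = algebraMap ℚ R ((m + 1 : ℕ) : ℚ) := by
        rw [map_natCast]; push_cast; rfl
      rw [e, ← map_mul, inv_mul_cancel₀ (by positivity), map_one]
    linear_combination (-PowerSeries.coeff (m + 1) (L' * L)) * this
  have e2 : ∑ ij ∈ antidiagonal (m + 1), (-1) ^ ij.1 * c ij.1 * c ij.2 =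
      PowerSeries.coeff (m + 1) (L' * L) := by
    rw [PowerSeries.coeff_mul, hL, hL']
    simp only [PowerSeries.coeff_mk]
  rw [e2, e1]
  exact Ideal.mul_mem_left _ _ hmem

end Newton

/-! ### Symmetrizations of the two regularizations -/

section Symmetrization

variable {R : Type*} [CommRing R] [Algebra ℚ R] {fst : Ser ℕ+ R} {fsh : Ser (Fin 2) R}

theorem coeff_mem_of_map_mk_eq {I : Ideal R} {P Q : PowerSeries R}
    (h : PowerSeries.map (Ideal.Quotient.mk I) P = PowerSeries.map (Ideal.Quotient.mk I) Q) (n : ℕ) :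
    PowerSeries.coeff n (P - Q) ∈ I := by
  have := congrArg (PowerSeries.coeff n) h
  rw [PowerSeries.coeff_map, PowerSeries.coeff_map, Ideal.Quotient.eq] at this
  rwa [map_sub]

theorem RegDoubleShuffle.map_symStuffle (h : RegDoubleShuffle fst fsh) (w : List ℕ+) :
    PowerSeries.map (Ideal.Quotient.mk (Ideal.span {fsh [0, 1]})) (symStuffle (toY fsh) w) =
      PowerSeries.map (Ideal.Quotient.mk (Ideal.span {fsh [0, 1]})) (symStuffle fst w) := by
  set q := PowerSeries.map (Ideal.Quotient.mk (Ideal.span {fsh [0, 1]}))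
  have e := symStuffle_onesSer_mul (fun n => fst (List.replicate n 1)) (toY fsh)
  rw [← h.eq_onesSer_mul] at e
  set μ : ℕ → R := fun n => ∑ ij ∈ antidiagonal n,
    (-1) ^ ij.1 * fst (List.replicate ij.1 1) * fst (List.replicate ij.2 1) with hμ
  have hone : NCS.map q (toNCS fun w => PowerSeries.C (onesSer μ w)) = 1 := by
    ext v
    rw [NCS.map_apply, toNCS_apply, PowerSeries.map_C]
    rcases v with _ | ⟨s, u⟩
    · rw [onesSer_nil, NCS.one_nil, hμ]
      simp [h.stuffle_one]
    · rw [NCS.one_cons, onesSer]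
      split_ifs
      · rw [Ideal.Quotient.eq_zero_iff_mem.mpr (h.sum_antidiagonal_mem (by simp)), map_zero]
      · rw [map_zero, map_zero]
  have e1 : NCS.map q (toNCS (symStuffle fst)) = NCS.map q (toNCS (symStuffle (toY fsh))) := by
    rw [e, symStuffle_eq, toNCS_mul, toNCS_mul, toNCS_mul, map_mul, map_mul, map_mul, hone, one_mul]
  exact (congrFun e1 w).symm

/-- The comparison of `f⁻¹ e₁ f` with the symmetrization of `f_*`. -/
theorem RegDoubleShuffle.coeff_sub_mem (h : RegDoubleShuffle fst fsh) (w : List ℕ+) (n : ℕ) :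
    PowerSeries.coeff n (evalT (conjE1 fsh) (jLie (PowerSeries.C (phi (mono w)))) -
      symStuffle fst w) ∈ Ideal.span {fsh [0, 1]} := by
  have e : evalT (conjE1 fsh) (jLie (PowerSeries.C (phi (mono w)))) = symStuffle (toY fsh) w := by
    ext n
    have e1 := conv_C (lam (linExt (conjE1 fsh))) (phi (mono w)) n
    rw [conv] at e1
    rw [coeff_evalT_jLie, e1, lam_apply, phi_mono, mono_mul_mono, mono_mul_mono, linExt_mono,
      ← h.shuffle.conjE1_apply h.sh_e0, List.append_assoc, List.singleton_append]
  rw [e]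
  exact coeff_mem_of_map_mk_eq (h.map_symStuffle w) n

end Symmetrization

end DShuffle

theorem theorem1 :
    -- multiple zeta values setting
    (∀ (R : Type*) [CommRing R] [Algebra ℚ R],
      -- series shuffle
      (∀ f : Ser ℕ+ R, StuffleRel f → StuffleRel (symStuffle f)) ∧
      -- integral shuffle
      (∀ f : Ser (Fin 2) R, f [] = 1 → (∀ n : ℕ, 1 ≤ n → f (List.replicate n 1) = 0) →
        List.TFAE [IsGrouplike f, IsLieSeries (conjE1 f),
          E0Reg (conjE1 f) ∧ CondA (conjE1 f),
          E0Reg (conjE1 f) ∧ CondB (conjE1 f),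
          E0Reg (conjE1 f) ∧ CondC (conjE1 f)]) ∧
      (∀ h : Ser (Fin 2) R, List.TFAE [CondA h, CondB h, CondC h]) ∧
      -- symmetry
      (∀ h : Ser (Fin 2) R, IsLieSeries h → ∀ w w₂ : Hst,
        evalT h (jLie (mapT phi (itilde w₂ * PowerSeries.C w))) =
          evalT h (jLie (mapT phi (itilde w * PowerSeries.C w₂)))) ∧
      -- comparison of regularizations
      (∀ (fst : Ser ℕ+ R) (fsh : Ser (Fin 2) R), RegDoubleShuffle fst fsh →
        ∀ (w : List ℕ+) (n : ℕ),
          PowerSeries.coeff n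
            (evalT (conjE1 fsh) (jLie (PowerSeries.C (phi (mono w)))) - symStuffle fst w) ∈
              Ideal.span {fsh [0, 1]})) ∧
    -- finite multiple zeta values setting
    (∀ k : ℕ, 1 ≤ k →
      -- series shuffle
      StuffleRel (zetaF k) ∧
      -- integral shuffle
      (∀ w w₂ : Hst, HasZetaValue k (itilde w₂ * PowerSeries.C w)
        (linExt (zetaF k) (piY (sh (phi w) (phi w₂))))) ∧
      -- symmetry
      (∀ w w₂ : Hst, ∃ x : ProdQp, HasZetaValue k (itilde w₂ * PowerSeries.C w) x ∧
        HasZetaValue k (itilde w * PowerSeries.C w₂) x) ∧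
      -- truncated iterated sums and truncated iterated integrals agree on all words
      (∀ w : List ℕ+, zetaF k w = fun p : Nat.Primes =>
        (((((p : ℕ) : ℚ) ^ k) ^ weight w *
          ∑ n ∈ Finset.range ((p : ℕ) ^ k), PowerSeries.coeff n (Li (toLetters w)) : ℚ) :
            ℚ_[(p : ℕ)])) ∧
      -- explicit formulas
      (∀ (s : ℕ+) (u w₂ : List ℕ+),
        HasZetaValue k (itilde (mono (s :: u)) * PowerSeries.C (mono w₂))
          (fun p : Nat.Primes =>
            (((((p : ℕ) : ℚ) ^ k) ^ (weight (s :: u) + weight w₂) *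
              ∑ n ∈ Finset.Ico 1 ((p : ℕ) ^ k),
                harm u n / (n : ℚ) ^ (s : ℕ) * harm w₂ ((p : ℕ) ^ k - n) : ℚ) :
              ℚ_[(p : ℕ)]))) ∧
      (∀ (w : List ℕ+) (t : ℕ+) (v : List ℕ+),
        HasZetaValue k (itilde (mono w) * PowerSeries.C (mono (t :: v)))
          (fun p : Nat.Primes =>
            (((((p : ℕ) : ℚ) ^ k) ^ (weight w + weight (t :: v)) *
              ∑ n ∈ Finset.Ico 1 ((p : ℕ) ^ k),
                harm w n * (harm v ((p : ℕ) ^ k - n) /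
                  (((p : ℕ) ^ k - n : ℕ) : ℚ) ^ (t : ℕ)) : ℚ) :
              ℚ_[(p : ℕ)])))) := by
  refine ⟨fun R _ _ => ⟨fun f => StuffleRel.symStuffle, fun f => conjE1_tfae, condABC_tfae,
    fun h hh => hh.evalT_jLie_itilde_comm, fun fst fsh h => h.coeff_sub_mem⟩,
    fun k hk => ⟨stuffleRel_zetaF k, hasZetaValue_sh, fun w w₂ => ⟨_, hasZetaValue_sh w w₂, ?_⟩,
      zetaF_eq_sum_coeff_Li, hasZetaValue_first, hasZetaValue_second⟩⟩
  -- by the integral shuffle relation both sides are the value at a shuffle product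
  rw [sh_comm]
  exact hasZetaValue_sh w₂ w
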